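/- Let $\mathcal H$ be a Hopf algebra with invertible antipode $S$ over a field $k$, $A$ a left $\mathcal H$-module algebra, $B$ a left $\mathcal H$-comodule algebra with coaction $b\mapsto b_{(-1)}\otimes b_{(0)}$ and iterated coactions $b\mapsto b_{(-m)}\otimes\cdots\otimes b_{(-1)}\otimes b_{(0)}$, and $M$ a right-left stable anti-Yetter–Drinfeld module over $\mathcal H$, i.e. a right module and left comodule with $m_{(0)}m_{(-1)}=m$ and $(mh)_{(-1)}\otimes(mh)_{(0)}=S(h_{(3)})m_{(-1)}h_{(1)}\otimes m_{(0)}h_{(2)}$. Let $A\rtimes B$ be the crossed product algebra: the vector space $A\otimes B$ with unit $1\rtimes 1$ and $(a\rtimes b)(a'\rtimes b')=a\,(b_{(-1)}a')\rtimes b_{(0)}b'$. Let $C^n_{\mathcal H}(A,M)=\mathrm{Hom}_{\mathcal H}(M\otimes A^{\otimes n+1},k)$, where $(m\otimes\tilde a)h=mh_{(1)}\otimes S(h_{(2)})\tilde a$, let ${}^{\mathcal H}C^n(B,M)$ be the space of $\mathcal H$-colinear maps $B^{\otimes n+1}\to M$, and let $C^n(A\rtimes B)=\mathrm{Hom}((A\rtimes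 B)^{\otimes n+1},k)$. In all three, the coface $\partial_i$ ($0\le i\le n$) multiplies the arguments with indices $i$ and $i+1$, and the last cofaces are $$(\partial_{n+1}\varphi)(m\otimes a^0\otimes\cdots\otimes a^{n+1})=\varphi(m_{(0)}\otimes (S^{-1}(m_{(-1)})a^{n+1})a^0\otimes a^1\otimes\cdots\otimes a^n),$$ $$(\partial_{n+1}\psi)(b^0\otimes\cdots\otimes b^{n+1})=\psi(b^{n+1}_{(0)}b^0\otimes b^1\otimes\cdots\otimes b^n)\,b^{n+1}_{(-1)},$$ $$(\partial_{n+1}f)(r^0\otimes\cdots\otimes r^{n+1})=f(r^{n+1}r^0\otimes r^1\otimes\cdots\otimes r^n).$$ The Hochschild cohomologies $HH^n_{\mathcal H}(A,M)$, ${}^{\mathcal H}HH^n(B,M)$ and $HH^n(A\rtimes B)$ are those of the coboundary $\sum_{i=0}^{n+1}(-1)^i\partial_i$. Put $$\Psi(\varphi\otimes\psi)(a^0\rtimes b^0\otimes\cdots\otimes a^n\rtimes b^n)=\varphi\big(\psi(b^0_{(0)}\otimes\cdots\otimes b^n_{(0)})\otimes S^{-1}(b^0_{(-1)}\cdots b^n_{(-1)})a^0\otimes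 S^{-1}(b^1_{(-2)}\cdots b^n_{(-2)})a^1\otimes\cdots\otimes S^{-1}(b^n_{(-n-1)})a^n\big),$$ and let $AW$ be the Alexander–Whitney map $\varphi\otimes\psi\mapsto(\partial_0)^q\varphi\otimes\partial_{p+q}\cdots\partial_{q+1}\psi$ on $C^p_{\mathcal H}(A,M)\otimes{}^{\mathcal H}C^q(B,M)$. The cup product is $\varphi\cup\psi=\Psi(AW(\varphi\otimes\psi))\in C^{p+q}(A\rtimes B)$. **Proposition.** For all $p,q\ge0$, $\varphi\in C^p_{\mathcal H}(A,M)$, $\psi\in{}^{\mathcal H}C^q(B,M)$, $a^i\in A$ and $b^i\in B$, $$\begin{aligned}(\varphi\cup\psi)&(a^0\rtimes b^0\otimes\cdots\otimes a^{p+q}\rtimes b^{p+q})=\\ \varphi\Big(&\psi\big(b^{q+1}_{(0)}\cdots b^{p+q}_{(0)}\,b^0_{(0)}\otimes b^1_{(0)}\otimes\cdots\otimes b^q_{(0)}\big)\otimes\\ & S^{-1}(b^0_{(-1)}\cdots b^q_{(-1)})a^0\cdot S^{-1}(b^1_{(-2)}\cdots b^q_{(-2)})a^1\cdots S^{-1}(b^q_{(-q-1)})a^q\otimes\\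 & a^{q+1}\otimes b^{q+1}_{(-p+1)}a^{q+2}\otimes b^{q+1}_{(-p+2)}b^{q+2}_{(-p+2)}a^{q+3}\otimes\cdots\otimes b^{q+1}_{(-1)}\cdots b^{p+q-1}_{(-1)}a^{p+q}\Big).\end{aligned}$$ Here $b^i$ has $i+1$ legs in $\mathcal H$ for $i\le q$ and $p+q-i$ legs for $i>q$. Moreover, $\cup$ carries pairs of Hochschild cocycles to Hochschild cocycles, and there is a unique bilinear map $HH^p_{\mathcal H}(A,M)\otimes{}^{\mathcal H}HH^q(B,M)\to HH^{p+q}(A\rtimes B)$ that sends $[\varphi]\otimes[\psi]$ to $[\varphi\cup\psi]$, so that the formula describes the cup product in Hochschild cohomology. -/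

import Mathlib

open scoped TensorProduct

noncomputable section

namespace HopfCup

/-! ## Modules, comodules and coefficients over a Hopf algebra -/

section Actions

variable (k : Type*) [Field k]

/-- The antipode of `H` is invertible. -/
class InvertibleAntipode (H : Type*) [Ring H] [HopfAlgebra k H] : Prop where
  bijective : Function.Bijective (HopfAlgebra.antipode k (A := H))

/-- The inverse `S⁻¹ : H → H` of the antipode. -/
def antipodeInv (H : Type*) [Ring H] [HopfAlgebra k H] [InvertibleAntipode k H] : H →ₗ[k] H :=
  (LinearEquiv.ofBijective (HopfAlgebra.antipode k (A := H))
    InvertibleAntipode.bijective).symm.toLinearMap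

/-- A left action as a linear map: `h ⊗ a ↦ h • a`. -/
def lact (H A : Type*) [Ring H] [Algebra k H] [AddCommGroup A] [Module k A] [Module H A]
    [IsScalarTower k H A] : H ⊗[k] A →ₗ[k] A :=
  TensorProduct.lift (Algebra.lsmul k k A : H →ₐ[k] Module.End k A).toLinearMap

/-- A right action (a module over `Hᵐᵒᵖ`) as a linear map `h ↦ (m ↦ m · h)`. -/
def rightMul (H M : Type*) [Ring H] [Algebra k H] [AddCommGroup M] [Module k M]
    [Module Hᵐᵒᵖ M] [IsScalarTower k Hᵐᵒᵖ M] : H →ₗ[k] (M →ₗ[k] M) :=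
  (Algebra.lsmul k k M : Hᵐᵒᵖ →ₐ[k] Module.End k M).toLinearMap ∘ₗ
    (MulOpposite.opLinearEquiv k : H ≃ₗ[k] Hᵐᵒᵖ).toLinearMap

/-- A left `H`-module algebra: `h (a a') = (h₁ a) (h₂ a')` and `h 1 = ε(h) 1`. -/
class ModuleAlgebra (H A : Type*) [Ring H] [HopfAlgebra k H] [Ring A] [Algebra k A]
    [Module H A] [IsScalarTower k H A] : Prop where
  smul_mul' : ∀ (h : H) (a a' : A), h • (a * a') =
    LinearMap.mul' k A (TensorProduct.map
      ((Algebra.lsmul k k A : H →ₐ[k] Module.End k A).toLinearMap.flip a)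
      ((Algebra.lsmul k k A : H →ₐ[k] Module.End k A).toLinearMap.flip a')
      (Coalgebra.comul (R := k) h))
  smul_one' : ∀ h : H, h • (1 : A) = algebraMap k A (Coalgebra.counit (R := k) h)

/-- A left `H`-comodule; the coaction is `m ↦ m₍₋₁₎ ⊗ m₍₀₎`. -/
class LeftComodule (H M : Type*) [Ring H] [HopfAlgebra k H] [AddCommGroup M] [Module k M] where
  coact : M →ₗ[k] H ⊗[k] M
  coassoc : TensorProduct.assoc k H H M ∘ₗ (Coalgebra.comul (R := k)).rTensor M ∘ₗ coact =
    coact.lTensor H ∘ₗ coact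
  counit_coact : TensorProduct.lid k M ∘ₗ (Coalgebra.counit (R := k)).rTensor M ∘ₗ coact =
    LinearMap.id

/-- The coaction of a left comodule. -/
def coact (H M : Type*) [Ring H] [HopfAlgebra k H] [AddCommGroup M] [Module k M]
    [LeftComodule k H M] : M →ₗ[k] H ⊗[k] M :=
  LeftComodule.coact

/-- A left `H`-comodule algebra: the coaction `B → H ⊗ B` is a unital algebra map. -/
class ComoduleAlgebra (H B : Type*) [Ring H] [HopfAlgebra k H] [Ring B] [Algebra k B]
    [LeftComodule k H B] : Prop where
  coact_one : coact k H B 1 = 1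
  coact_mul : ∀ b b' : B, coact k H B (b * b') = coact k H B b * coact k H B b'

/-- For `h₁ ⊗ (h₂ ⊗ h₃)` the operator `u ⊗ m ↦ S(h₃) u h₁ ⊗ m h₂` on `H ⊗ M`. -/
def aydTwist (H M : Type*) [Ring H] [HopfAlgebra k H] [AddCommGroup M] [Module k M]
    [Module Hᵐᵒᵖ M] [IsScalarTower k Hᵐᵒᵖ M] :
    H ⊗[k] (H ⊗[k] H) →ₗ[k] Module.End k (H ⊗[k] M) :=
  LinearMap.mul' k (Module.End k (H ⊗[k] M)) ∘ₗ
    TensorProduct.map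
      (LinearMap.rTensorHom M ∘ₗ (LinearMap.mul k H).flip)
      (LinearMap.mul' k (Module.End k (H ⊗[k] M)) ∘ₗ
        TensorProduct.map
          (LinearMap.lTensorHom H ∘ₗ rightMul k H M)
          (LinearMap.rTensorHom M ∘ₗ LinearMap.mul k H ∘ₗ HopfAlgebra.antipode k))

/-- A right-left stable anti-Yetter-Drinfeld module over `H`: a right module and left comodule with
`m₍₀₎ m₍₋₁₎ = m` and `(m h)₍₋₁₎ ⊗ (m h)₍₀₎ = S(h₃) m₍₋₁₎ h₁ ⊗ m₍₀₎ h₂`. -/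
class SAYD (H M : Type*) [Ring H] [HopfAlgebra k H] [AddCommGroup M] [Module k M]
    [Module Hᵐᵒᵖ M] [IsScalarTower k Hᵐᵒᵖ M] [LeftComodule k H M] : Prop where
  stable : ∀ m : M, TensorProduct.lift (rightMul k H M) (coact k H M m) = m
  coact_act : ∀ (m : M) (h : H), coact k H M (rightMul k H M h m) =
    aydTwist k H M ((Coalgebra.comul (R := k)).lTensor H (Coalgebra.comul (R := k) h))
      (coact k H M m)

end Actions

/-! ## Tensor powers -/

section TensorPowers

variable (k : Type*) [Field k]

/-- `v ⊗ (v¹ ⊗ ⋯ ⊗ vⁿ) ↦ v ⊗ v¹ ⊗ ⋯ ⊗ vⁿ`. -/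
def consT (V : Type*) [AddCommGroup V] [Module k V] (n : ℕ) :
    V ⊗[k] (⨂[k]^n V) →ₗ[k] ⨂[k]^(n + 1) V :=
  TensorProduct.lift ((PiTensorProduct.lift (R := k) (s := fun _ : Fin n => V)).toLinearMap ∘ₗ
    (PiTensorProduct.tprod k (s := fun _ : Fin (n + 1) => V)).curryLeft)

/-- `v⁰ ⊗ v¹ ⊗ ⋯ ⊗ vⁿ ↦ v⁰ ⊗ (v¹ ⊗ ⋯ ⊗ vⁿ)`. -/
def unconsT (V : Type*) [AddCommGroup V] [Module k V] (n : ℕ) :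
    (⨂[k]^(n + 1) V) →ₗ[k] V ⊗[k] (⨂[k]^n V) :=
  PiTensorProduct.lift (LinearMap.uncurryLeft (M := fun _ : Fin (n + 1) => V)
    ((PiTensorProduct.lift (R := k) (s := fun _ : Fin n => V)).symm.toLinearMap ∘ₗ
      TensorProduct.mk k V (⨂[k]^n V)))

/-- Cyclic rotation `v⁰ ⊗ ⋯ ⊗ vⁿ ↦ vⁿ ⊗ v⁰ ⊗ ⋯ ⊗ vⁿ⁻¹`. -/
def rotT (V : Type*) [AddCommGroup V] [Module k V] (n : ℕ) :
    (⨂[k]^(n + 1) V) →ₗ[k] ⨂[k]^(n + 1) V :=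
  (PiTensorProduct.reindex k (fun _ : Fin (n + 1) => V) (finRotate (n + 1))).toLinearMap

theorem consT_tmul (V : Type*) [AddCommGroup V] [Module k V] (n : ℕ) (v : V) (f : Fin n → V) :
    consT k V n (v ⊗ₜ PiTensorProduct.tprod k f) =
      PiTensorProduct.tprod k (Fin.cons v f : Fin (n + 1) → V) := by
  simp [consT]

theorem unconsT_tprod (V : Type*) [AddCommGroup V] [Module k V] (n : ℕ) (f : Fin (n + 1) → V) :
    unconsT k V n (PiTensorProduct.tprod k f) =
      f 0 ⊗ₜ PiTensorProduct.tprod k (Fin.tail f) := by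
  simp [unconsT, PiTensorProduct.lift_symm]

section Algebras

variable (A : Type*) [Ring A] [Algebra k A]

/-- `a ⊗ (a⁰ ⊗ ⋯ ⊗ aⁿ) ↦ a a⁰ ⊗ a¹ ⊗ ⋯ ⊗ aⁿ`. -/
def mulHead (n : ℕ) : A ⊗[k] (⨂[k]^(n + 1) A) →ₗ[k] ⨂[k]^(n + 1) A :=
  consT k A n ∘ₗ (LinearMap.mul' k A).rTensor (⨂[k]^n A) ∘ₗ
    (TensorProduct.assoc k A A (⨂[k]^n A)).symm.toLinearMap ∘ₗ (unconsT k A n).lTensor A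

/-- `a⁰ ⊗ ⋯ ⊗ aⁿ⁺¹ ↦ a⁰ ⊗ ⋯ ⊗ aⁱ aⁱ⁺¹ ⊗ ⋯ ⊗ aⁿ⁺¹`, for `i ≤ n`. (It is not used for `i > n`.) -/
def mulAt : (n i : ℕ) → (⨂[k]^(n + 2) A) →ₗ[k] ⨂[k]^(n + 1) A
  | n, 0 => mulHead k A n ∘ₗ unconsT k A (n + 1)
  | 0, _ + 1 => 0
  | n + 1, i + 1 => consT k A (n + 1) ∘ₗ (mulAt n i).lTensor A ∘ₗ unconsT k A (n + 2)

end Algebras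

/-- The diagonal left action on a tensor power:
`h ⊗ (a¹ ⊗ ⋯ ⊗ aⁿ) ↦ h₁ a¹ ⊗ ⋯ ⊗ hₙ aⁿ` (and `ε(h)` for `n = 0`). -/
def actT (H A : Type*) [Ring H] [HopfAlgebra k H] [AddCommGroup A] [Module k A] [Module H A]
    [IsScalarTower k H A] : (n : ℕ) → H ⊗[k] (⨂[k]^n A) →ₗ[k] ⨂[k]^n A
  | 0 => (TensorProduct.lid k (⨂[k]^0 A)).toLinearMap ∘ₗ
      (Coalgebra.counit (R := k)).rTensor (⨂[k]^0 A)
  | n + 1 => consT k A n ∘ₗ TensorProduct.map (lact k H A) (actT H A n) ∘ₗ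
      (TensorProduct.tensorTensorTensorComm k H H A (⨂[k]^n A)).toLinearMap ∘ₗ
      TensorProduct.map (Coalgebra.comul (R := k)) (unconsT k A n)

/-- The diagonal left coaction on a tensor power:
`b¹ ⊗ ⋯ ⊗ bⁿ ↦ b¹₍₋₁₎ ⋯ bⁿ₍₋₁₎ ⊗ (b¹₍₀₎ ⊗ ⋯ ⊗ bⁿ₍₀₎)`. -/
def coactT (H B : Type*) [Ring H] [HopfAlgebra k H] [AddCommGroup B] [Module k B]
    [LeftComodule k H B] : (n : ℕ) → (⨂[k]^n B) →ₗ[k] H ⊗[k] (⨂[k]^n B)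
  | 0 => TensorProduct.mk k H (⨂[k]^0 B) 1
  | n + 1 => TensorProduct.map (LinearMap.mul' k H) (consT k B n) ∘ₗ
      (TensorProduct.tensorTensorTensorComm k H B H (⨂[k]^n B)).toLinearMap ∘ₗ
      TensorProduct.map (coact k H B) (coactT H B n) ∘ₗ unconsT k B n

/-- The iterated coaction `b ↦ b₍₋ₘ₎ ⊗ ⋯ ⊗ b₍₋₁₎ ⊗ b₍₀₎`. The legs in `H` are listed in the order
`b₍₋₁₎, b₍₋₂₎, …, b₍₋ₘ₎`: the factor with index `l : Fin m` is `b₍₋₍ₗ₊₁₎₎`. -/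
def iterCoact (H B : Type*) [Ring H] [HopfAlgebra k H] [AddCommGroup B] [Module k B]
    [LeftComodule k H B] : (m : ℕ) → B →ₗ[k] (⨂[k]^m H) ⊗[k] B
  | 0 => TensorProduct.mk k (⨂[k]^0 H) B (PiTensorProduct.tprod k Fin.elim0)
  | m + 1 => (consT k H m ∘ₗ (TensorProduct.comm k (⨂[k]^m H) H).toLinearMap).rTensor B ∘ₗ
      (TensorProduct.assoc k (⨂[k]^m H) H B).symm.toLinearMap ∘ₗ
      (coact k H B).lTensor (⨂[k]^m H) ∘ₗ iterCoact H B m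

end TensorPowers

/-! ## The crossed product algebra -/

section Crossed

variable (k : Type*) [Field k] (H A B : Type*) [Ring H] [HopfAlgebra k H]
  [Ring A] [Algebra k A] [Module H A] [IsScalarTower k H A]
  [Ring B] [Algebra k B] [LeftComodule k H B]

/-- The crossed product `A ⋊ B`: the vector space `A ⊗ B` with the product
`(a ⋊ b) (a' ⋊ b') = a (b₍₋₁₎ a') ⋊ b₍₀₎ b'`. -/
@[nolint unusedArguments]
def CrossedProduct (k : Type*) [Field k] (H A B : Type*) [Ring H] [HopfAlgebra k H]
    [Ring A] [Algebra k A] [Module H A] [IsScalarTower k H A]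
    [Ring B] [Algebra k B] [LeftComodule k H B] : Type _ := A ⊗[k] B

instance : AddCommGroup (CrossedProduct k H A B) := inferInstanceAs (AddCommGroup (A ⊗[k] B))

instance : Module k (CrossedProduct k H A B) := inferInstanceAs (Module k (A ⊗[k] B))

/-- The identification of vector spaces `A ⊗ B = A ⋊ B`. -/
def CrossedProduct.equiv : (A ⊗[k] B) ≃ₗ[k] CrossedProduct k H A B := LinearEquiv.refl k _

/-- The element `a ⋊ b`. -/
def CrossedProduct.mk (a : A) (b : B) : CrossedProduct k H A B :=
  CrossedProduct.equiv k H A B (a ⊗ₜ b)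

/-- `b ⊗ a' ↦ b₍₋₁₎ a' ⊗ b₍₀₎`. -/
def crossing : B ⊗[k] A →ₗ[k] A ⊗[k] B :=
  (lact k H A).rTensor B ∘ₗ (TensorProduct.rightComm k H B A).toLinearMap ∘ₗ
    (coact k H B).rTensor A

/-- `(a ⊗ b) ⊗ (a' ⊗ b') ↦ a (b₍₋₁₎ a') ⊗ b₍₀₎ b'`. -/
def crossedMul : (A ⊗[k] B) ⊗[k] (A ⊗[k] B) →ₗ[k] A ⊗[k] B :=
  TensorProduct.map (LinearMap.mul' k A) (LinearMap.mul' k B) ∘ₗ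
    (TensorProduct.assoc k A A (B ⊗[k] B)).symm.toLinearMap ∘ₗ
    ((TensorProduct.assoc k A B B).toLinearMap ∘ₗ (crossing k H A B).rTensor B ∘ₗ
      (TensorProduct.assoc k B A B).symm.toLinearMap).lTensor A ∘ₗ
    (TensorProduct.assoc k A B (A ⊗[k] B)).toLinearMap

variable {k H A B}

theorem crossedMul_tmul (a a' : A) (b b' : B) :
    crossedMul k H A B ((a ⊗ₜ b) ⊗ₜ (a' ⊗ₜ b')) =
      TensorProduct.map
        (LinearMap.mulLeft k a ∘ₗ
          (Algebra.lsmul k k A : H →ₐ[k] Module.End k A).toLinearMap.flip a')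
        (LinearMap.mulRight k b') (coact k H B b) := by
  simp only [crossedMul, crossing, LinearMap.comp_apply, LinearEquiv.coe_coe,
    TensorProduct.assoc_tmul, LinearMap.lTensor_tmul, TensorProduct.assoc_symm_tmul,
    LinearMap.rTensor_tmul]
  induction coact k H B b with
  | zero => simp
  | add x y hx hy => simp only [TensorProduct.add_tmul, TensorProduct.tmul_add, map_add, hx, hy]
  | tmul h c => simp [lact]

theorem crossedMul_assoc [ModuleAlgebra k H A] [ComoduleAlgebra k H B] (x y z : A ⊗[k] B) :
    crossedMul k H A B (crossedMul k H A B (x ⊗ₜ y) ⊗ₜ z) =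
      crossedMul k H A B (x ⊗ₜ crossedMul k H A B (y ⊗ₜ z)) := by
  induction x with
  | zero => simp
  | add x x' hx hx' => simp only [TensorProduct.add_tmul, map_add, hx, hx']
  | tmul a b =>
  induction y with
  | zero => simp
  | add x x' hx hx' => simp only [TensorProduct.add_tmul, TensorProduct.tmul_add, map_add, hx, hx']
  | tmul a' b' =>
  induction z with
  | zero => simp
  | add x x' hx hx' => simp only [TensorProduct.tmul_add, map_add, hx, hx']
  | tmul a'' b'' =>
  rw [crossedMul_tmul, crossedMul_tmul]
  let act : A → H →ₗ[k] A := (Algebra.lsmul k k A : H →ₐ[k] Module.End k A).toLinearMap.flip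
  have hact : ∀ (h : H) (c : A), act c h = h • c := fun _ _ => rfl
  let K : H ⊗[k] (H ⊗[k] B) →ₗ[k] A ⊗[k] B :=
    (LinearMap.mul' k A).rTensor B ∘ₗ (TensorProduct.assoc k A A B).symm.toLinearMap ∘ₗ
      TensorProduct.map (LinearMap.mulLeft k a ∘ₗ act a')
        (TensorProduct.map (act a'') (LinearMap.mulRight k b''))
  have hK : ∀ (h h' : H) (c : B),
      K (h ⊗ₜ (h' ⊗ₜ c)) = (a * (h • a') * (h' • a'')) ⊗ₜ (c * b'') := fun _ _ _ => rfl
  have hL : ∀ t : H ⊗[k] B,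
      crossedMul k H A B (TensorProduct.map (LinearMap.mulLeft k a ∘ₗ act a')
        (LinearMap.mulRight k b') t ⊗ₜ (a'' ⊗ₜ b'')) =
      K ((LinearMap.mulRight k (coact k H B b')).lTensor H ((coact k H B).lTensor H t)) := by
    intro t
    induction t with
    | zero => simp
    | add x y hx hy => simp only [map_add, TensorProduct.add_tmul, hx, hy]
    | tmul h c =>
      simp only [TensorProduct.map_tmul, crossedMul_tmul, LinearMap.lTensor_tmul,
        LinearMap.mulRight_apply, LinearMap.comp_apply, LinearMap.mulLeft_apply, hact,
        ComoduleAlgebra.coact_mul]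
      generalize coact k H B c * coact k H B b' = w
      induction w with
      | zero => simp
      | add x y hx hy => simp only [map_add, TensorProduct.tmul_add, hx, hy]
      | tmul h' c' => rfl
  have hR : ∀ t' : H ⊗[k] B,
      crossedMul k H A B ((a ⊗ₜ b) ⊗ₜ TensorProduct.map (LinearMap.mulLeft k a' ∘ₗ act a'')
        (LinearMap.mulRight k b'') t') =
      K ((LinearMap.mulRight k t').lTensor H (TensorProduct.assoc k H H B
        ((Coalgebra.comul (R := k)).rTensor B (coact k H B b)))) := by
    intro t'
    induction t' with
    | zero => simp [LinearMap.mulRight_zero_eq_zero]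
    | add x y hx hy =>
      have hadd : LinearMap.mulRight k (x + y) = LinearMap.mulRight k x + LinearMap.mulRight k y :=
        LinearMap.ext fun w => mul_add w x y
      simp only [map_add, TensorProduct.tmul_add, hx, hy, hadd, LinearMap.lTensor_add,
        LinearMap.add_apply]
    | tmul h' c' =>
      simp only [TensorProduct.map_tmul, crossedMul_tmul]
      induction coact k H B b with
      | zero => simp
      | add x y hx hy => simp only [map_add, hx, hy]
      | tmul h c =>
        simp only [TensorProduct.map_tmul, LinearMap.comp_apply, LinearMap.mulLeft_apply,
          LinearMap.mulRight_apply, LinearMap.flip_apply, AlgHom.toLinearMap_apply,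
          Algebra.lsmul_coe, LinearMap.rTensor_tmul, hact, ModuleAlgebra.smul_mul' (k := k)]
        induction Coalgebra.comul (R := k) h with
        | zero => simp
        | add x y hx hy => simp only [map_add, mul_add, TensorProduct.add_tmul, hx, hy]
        | tmul h₁ h₂ =>
          simp only [TensorProduct.map_tmul, TensorProduct.assoc_tmul, LinearMap.lTensor_tmul,
            LinearMap.mulRight_apply, Algebra.TensorProduct.tmul_mul_tmul, hK]
          simp [mul_assoc, mul_smul]
  refine (hL _).trans (Eq.trans ?_ (hR _).symm)
  have h := LinearMap.congr_fun (LeftComodule.coassoc (k := k) (H := H) (M := B)) b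
  exact congrArg K (congrArg _ h.symm)

theorem one_crossedMul [ModuleAlgebra k H A] [ComoduleAlgebra k H B] (x : A ⊗[k] B) :
    crossedMul k H A B ((1 ⊗ₜ 1) ⊗ₜ x) = x := by
  induction x with
  | zero => simp
  | add x y hx hy => simp only [TensorProduct.tmul_add, map_add, hx, hy]
  | tmul a b =>
    rw [crossedMul_tmul, ComoduleAlgebra.coact_one, Algebra.TensorProduct.one_def]
    simp

theorem crossedMul_one [ModuleAlgebra k H A] [ComoduleAlgebra k H B] (x : A ⊗[k] B) :
    crossedMul k H A B (x ⊗ₜ (1 ⊗ₜ 1)) = x := by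
  induction x with
  | zero => simp
  | add x y hx hy => simp only [TensorProduct.add_tmul, map_add, hx, hy]
  | tmul a b =>
    have h := LinearMap.congr_fun (LeftComodule.counit_coact (k := k) (H := H) (M := B)) b
    have h2 : ∀ t : H ⊗[k] B, TensorProduct.map (LinearMap.mulLeft k a ∘ₗ
        (Algebra.lsmul k k A : H →ₐ[k] Module.End k A).toLinearMap.flip 1)
        (LinearMap.mulRight k (1 : B)) t =
        a ⊗ₜ (TensorProduct.lid k B) ((Coalgebra.counit (R := k)).rTensor B t) := by
      intro t
      induction t with
      | zero => simp
      | add x y hx hy => simp only [map_add, TensorProduct.tmul_add, hx, hy]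
      | tmul h c =>
        simp [ModuleAlgebra.smul_one' (k := k), Algebra.algebraMap_eq_smul_one,
          TensorProduct.smul_tmul]
    rw [crossedMul_tmul, h2]
    exact congrArg _ h

instance : Mul (CrossedProduct k H A B) :=
  ⟨fun x y => CrossedProduct.equiv k H A B (crossedMul k H A B
    ((CrossedProduct.equiv k H A B).symm x ⊗ₜ (CrossedProduct.equiv k H A B).symm y))⟩

instance : One (CrossedProduct k H A B) := ⟨CrossedProduct.mk k H A B 1 1⟩

instance [ModuleAlgebra k H A] [ComoduleAlgebra k H B] : Ring (CrossedProduct k H A B) :=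
  { (inferInstance : AddCommGroup (CrossedProduct k H A B)),
    (inferInstance : Mul (CrossedProduct k H A B)),
    (inferInstance : One (CrossedProduct k H A B)) with
    left_distrib := fun x y z =>
      (congrArg (crossedMul k H A B) (TensorProduct.tmul_add x y z)).trans (map_add _ _ _)
    right_distrib := fun x y z =>
      (congrArg (crossedMul k H A B) (TensorProduct.add_tmul x y z)).trans (map_add _ _ _)
    zero_mul := fun x =>
      (congrArg (crossedMul k H A B) (TensorProduct.zero_tmul _ x)).trans (map_zero _)
    mul_zero := fun x =>
      (congrArg (crossedMul k H A B) (TensorProduct.tmul_zero _ x)).trans (map_zero _)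
    mul_assoc := fun x y z => crossedMul_assoc (k := k) (H := H) (A := A) (B := B) x y z
    one_mul := fun x => one_crossedMul (k := k) (H := H) (A := A) (B := B) x
    mul_one := fun x => crossedMul_one (k := k) (H := H) (A := A) (B := B) x }

instance [ModuleAlgebra k H A] [ComoduleAlgebra k H B] : Algebra k (CrossedProduct k H A B) :=
  Algebra.ofModule
    (fun r x y => (congrArg (crossedMul k H A B)
      (TensorProduct.smul_tmul' (R := k) (M := A ⊗[k] B) (N := A ⊗[k] B) r x y).symm).trans
        (map_smul _ _ _))
    (fun r x y => (congrArg (crossedMul k H A B)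
      (TensorProduct.tmul_smul (R := k) (M := A ⊗[k] B) (N := A ⊗[k] B) r x y)).trans
        (map_smul _ _ _))

end Crossed

/-! ## Hochschild cohomology of a family of cochains -/

section Cohomology

variable {k : Type*} [Field k] {C : ℕ → Type*} [∀ n, AddCommGroup (C n)] [∀ n, Module k (C n)]

/-- The alternating sum `∑_{i=0}^{n+1} (-1)ⁱ ∂ᵢ` of the cofaces in degree `n`. -/
def alternatingSum {n : ℕ} (face : ℕ → C n →ₗ[k] C (n + 1)) : C n →ₗ[k] C (n + 1) :=
  ∑ i ∈ Finset.range (n + 2), (-1 : k) ^ i • face i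

/-- Cocycles of degree `n` among the cochains in `S`. -/
def cocycles (S : ∀ n, Submodule k (C n)) (d : ∀ n, C n →ₗ[k] C (n + 1)) (n : ℕ) :
    Submodule k (C n) :=
  S n ⊓ LinearMap.ker (d n)

/-- Coboundaries in degree `n` of the cochains in `S`. -/
def coboundaries (S : ∀ n, Submodule k (C n)) (d : ∀ n, C n →ₗ[k] C (n + 1)) :
    (n : ℕ) → Submodule k (C n)
  | 0 => ⊥
  | n + 1 => (S n).map (d n)

/-- The `n`-th cohomology of the cochains in `S`: cocycles modulo coboundaries. -/
abbrev Cohomology (S : ∀ n, Submodule k (C n)) (d : ∀ n, C n →ₗ[k] C (n + 1)) (n : ℕ) : Type _ :=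
  cocycles S d n ⧸ (coboundaries S d n).comap (cocycles S d n).subtype

end Cohomology

/-! ## The three cosimplicial modules -/

section CochainsAlgebra

variable (k : Type*) [Field k] (R : Type*) [Ring R] [Algebra k R]

/-- Hochschild cochains `Cⁿ(R) = Hom(R^{⊗ n+1}, k)`. -/
abbrev Cochain (n : ℕ) : Type _ := (⨂[k]^(n + 1) R) →ₗ[k] k

/-- The cofaces of `C*(R)`: for `i ≤ n` multiply `rⁱ` and `rⁱ⁺¹`, and
`(∂ₙ₊₁ φ)(r⁰ ⊗ ⋯ ⊗ rⁿ⁺¹) = φ(rⁿ⁺¹ r⁰ ⊗ r¹ ⊗ ⋯ ⊗ rⁿ)`. -/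
def face (n i : ℕ) : Cochain k R n →ₗ[k] Cochain k R (n + 1) :=
  if i ≤ n then LinearMap.lcomp k k (mulAt k R n i)
  else LinearMap.lcomp k k (mulHead k R n ∘ₗ unconsT k R (n + 1) ∘ₗ rotT k R (n + 1))

/-- The Hochschild coboundary of `C*(R)`. -/
def hochschildD (n : ℕ) : Cochain k R n →ₗ[k] Cochain k R (n + 1) :=
  alternatingSum (C := Cochain k R) (face k R n)

/-- The Hochschild cohomology `HHⁿ(R)` with coefficients in the dual of `R`. -/
abbrev HH (n : ℕ) : Type _ := Cohomology (C := Cochain k R) (fun _ => ⊤) (hochschildD k R) n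

end CochainsAlgebra

section CochainsModuleAlgebra

variable (k : Type*) [Field k] (H A M : Type*) [Ring H] [HopfAlgebra k H]
  [Ring A] [Algebra k A] [Module H A] [IsScalarTower k H A]
  [AddCommGroup M] [Module k M] [Module Hᵐᵒᵖ M] [IsScalarTower k Hᵐᵒᵖ M]

/-- Linear maps `M ⊗ A^{⊗ n+1} → k`. -/
abbrev CochainA (n : ℕ) : Type _ := M ⊗[k] (⨂[k]^(n + 1) A) →ₗ[k] k

/-- The diagonal right action of `H` on `M ⊗ A^{⊗ n}`: `(m ⊗ ã) h = m h₁ ⊗ S(h₂) ã`. -/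
def diagAct (n : ℕ) : H →ₗ[k] Module.End k (M ⊗[k] (⨂[k]^n A)) :=
  TensorProduct.homTensorHomMap (.id k) M (⨂[k]^n A) M (⨂[k]^n A) ∘ₗ
    TensorProduct.map (rightMul k H M)
      (TensorProduct.curry (actT k H A n) ∘ₗ HopfAlgebra.antipode k) ∘ₗ
    Coalgebra.comul (R := k)

/-- `Cⁿ_H(A, M) = Hom_H(M ⊗ A^{⊗ n+1}, k)`, with `k` an `H`-module through the counit. -/
def equivariantCochains (n : ℕ) : Submodule k (CochainA k A M n) where
  carrier := {φ | ∀ (h : H) (x : M ⊗[k] (⨂[k]^(n + 1) A)),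
    φ (diagAct k H A M (n + 1) h x) = Coalgebra.counit (R := k) h * φ x}
  add_mem' := fun hf hg h x => by simp [hf h x, hg h x, mul_add]
  zero_mem' := fun h x => by simp
  smul_mem' := fun c f hf h x => by simp [hf h x, mul_left_comm]

variable [InvertibleAntipode k H] [LeftComodule k H M]

/-- `h ⊗ a ↦ S⁻¹(h) a`. -/
def lactInv : H ⊗[k] A →ₗ[k] A := lact k H A ∘ₗ (antipodeInv k H).rTensor A

/-- `m ⊗ a⁰ ⊗ ⋯ ⊗ aⁿ⁺¹ ↦ m₍₀₎ ⊗ (S⁻¹(m₍₋₁₎) aⁿ⁺¹) a⁰ ⊗ a¹ ⊗ ⋯ ⊗ aⁿ`. -/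
def lastA (n : ℕ) : M ⊗[k] (⨂[k]^(n + 2) A) →ₗ[k] M ⊗[k] (⨂[k]^(n + 1) A) :=
  (mulHead k A n ∘ₗ (lactInv k H A).rTensor (⨂[k]^(n + 1) A)).lTensor M ∘ₗ
    ((TensorProduct.assoc k H A (⨂[k]^(n + 1) A)).symm.toLinearMap).lTensor M ∘ₗ
    (TensorProduct.assoc k M H (A ⊗[k] (⨂[k]^(n + 1) A))).toLinearMap ∘ₗ
    TensorProduct.map ((TensorProduct.comm k H M).toLinearMap ∘ₗ coact k H M)
      (unconsT k A (n + 1) ∘ₗ rotT k A (n + 1))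

/-- The cofaces of `C*_H(A, M)`: for `i ≤ n` multiply `aⁱ` and `aⁱ⁺¹`, and
`(∂ₙ₊₁ φ)(m ⊗ a⁰ ⊗ ⋯ ⊗ aⁿ⁺¹) = φ(m₍₀₎ ⊗ (S⁻¹(m₍₋₁₎) aⁿ⁺¹) a⁰ ⊗ a¹ ⊗ ⋯ ⊗ aⁿ)`. -/
def faceA (n i : ℕ) : CochainA k A M n →ₗ[k] CochainA k A M (n + 1) :=
  if i ≤ n then LinearMap.lcomp k k ((mulAt k A n i).lTensor M)
  else LinearMap.lcomp k k (lastA k H A M n)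

/-- The Hochschild coboundary of `C*_H(A, M)`. -/
def hochschildDA (n : ℕ) : CochainA k A M n →ₗ[k] CochainA k A M (n + 1) :=
  alternatingSum (C := CochainA k A M) (faceA k H A M n)

/-- The Hochschild cohomology `HHⁿ_H(A, M)` of the cocyclic module `C*_H(A, M)`. -/
abbrev HHA (n : ℕ) : Type _ :=
  Cohomology (C := CochainA k A M) (equivariantCochains k H A M) (hochschildDA k H A M) n

end CochainsModuleAlgebra

section CochainsComoduleAlgebra

variable (k : Type*) [Field k] (H B M : Type*) [Ring H] [HopfAlgebra k H]
  [Ring B] [Algebra k B] [LeftComodule k H B]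
  [AddCommGroup M] [Module k M] [Module Hᵐᵒᵖ M] [IsScalarTower k Hᵐᵒᵖ M] [LeftComodule k H M]

/-- Linear maps `B^{⊗ n+1} → M`. -/
abbrev CochainB (n : ℕ) : Type _ := (⨂[k]^(n + 1) B) →ₗ[k] M

/-- `ᴴCⁿ(B, M)`: the `H`-colinear maps `B^{⊗ n+1} → M`. -/
def colinearCochains (n : ℕ) : Submodule k (CochainB k B M n) where
  carrier := {ψ | coact k H M ∘ₗ ψ = ψ.lTensor H ∘ₗ coactT k H B (n + 1)}
  add_mem' := fun {f g} hf hg => by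
    simp only [Set.mem_ofPred_eq] at hf hg ⊢
    rw [LinearMap.comp_add, hf, hg, LinearMap.lTensor_add, LinearMap.add_comp]
  zero_mem' := by simp
  smul_mem' := fun c f hf => by
    simp only [Set.mem_ofPred_eq] at hf ⊢
    rw [LinearMap.comp_smul, hf, LinearMap.lTensor_smul, LinearMap.smul_comp]

/-- `ψ ↦ (b⁰ ⊗ ⋯ ⊗ bⁿ⁺¹ ↦ ψ(bⁿ⁺¹₍₀₎ b⁰ ⊗ b¹ ⊗ ⋯ ⊗ bⁿ) bⁿ⁺¹₍₋₁₎)`. -/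
def lastB (n : ℕ) : CochainB k B M n →ₗ[k] CochainB k B M (n + 1) :=
  (LinearMap.llcomp k _ _ _ (TensorProduct.lift (rightMul k H M))) ∘ₗ
    LinearMap.lcomp k (H ⊗[k] M)
      ((mulHead k B n).lTensor H ∘ₗ
        (TensorProduct.assoc k H B (⨂[k]^(n + 1) B)).toLinearMap ∘ₗ
        (coact k H B).rTensor (⨂[k]^(n + 1) B) ∘ₗ
        unconsT k B (n + 1) ∘ₗ rotT k B (n + 1)) ∘ₗ
    LinearMap.lTensorHom H

/-- The cofaces of `ᴴC*(B, M)`: for `i ≤ n` multiply `bⁱ` and `bⁱ⁺¹`, and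
`(∂ₙ₊₁ ψ)(b⁰ ⊗ ⋯ ⊗ bⁿ⁺¹) = ψ(bⁿ⁺¹₍₀₎ b⁰ ⊗ b¹ ⊗ ⋯ ⊗ bⁿ) bⁿ⁺¹₍₋₁₎`. -/
def faceB (n i : ℕ) : CochainB k B M n →ₗ[k] CochainB k B M (n + 1) :=
  if i ≤ n then LinearMap.lcomp k M (mulAt k B n i) else lastB k H B M n

/-- The Hochschild coboundary of `ᴴC*(B, M)`. -/
def hochschildDB (n : ℕ) : CochainB k B M n →ₗ[k] CochainB k B M (n + 1) :=
  alternatingSum (C := CochainB k B M) (faceB k H B M n)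

/-- The Hochschild cohomology `ᴴHHⁿ(B, M)` of the cocyclic module `ᴴC*(B, M)`. -/
abbrev HHB (n : ℕ) : Type _ :=
  Cohomology (C := CochainB k B M) (colinearCochains k H B M) (hochschildDB k H B M) n

end CochainsComoduleAlgebra

/-! ## The map `Ψ`, the Alexander-Whitney map and the cup product -/

section Cup

variable (k : Type*) [Field k] (H A B M : Type*) [Ring H] [HopfAlgebra k H]
  [InvertibleAntipode k H]
  [Ring A] [Algebra k A] [Module H A] [IsScalarTower k H A]
  [Ring B] [Algebra k B] [LeftComodule k H B]
  [AddCommGroup M] [Module k M] [Module Hᵐᵒᵖ M] [IsScalarTower k Hᵐᵒᵖ M] [LeftComodule k H M]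

/-- The twisting map `(A ⋊ B)^{⊗ n} → A^{⊗ n} ⊗ B^{⊗ n}`, which for `n + 1` factors is
`a⁰ ⋊ b⁰ ⊗ ⋯ ⊗ aⁿ ⋊ bⁿ ↦ (S⁻¹(b⁰₍₋₁₎ ⋯ bⁿ₍₋₁₎) a⁰ ⊗ S⁻¹(b¹₍₋₂₎ ⋯ bⁿ₍₋₂₎) a¹ ⊗ ⋯
  ⊗ S⁻¹(bⁿ₍₋ₙ₋₁₎) aⁿ) ⊗ (b⁰₍₀₎ ⊗ ⋯ ⊗ bⁿ₍₀₎)`.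
It is computed from the last factor to the first: after the factors `1, …, n` have been treated,
the diagonal coaction of `b⁰ ⊗ ⋯ ⊗ bⁿ` gives `b⁰₍₋₁₎ ⋯ bⁿ₍₋₁₎`, whose `S⁻¹` acts on `a⁰`; the legs
split off before are then the ones further from `b₍₀₎`. -/
def twist : (n : ℕ) → (⨂[k]^n (CrossedProduct k H A B)) →ₗ[k] (⨂[k]^n A) ⊗[k] (⨂[k]^n B)
  | 0 => (LinearMap.toSpanSingleton k _
      (PiTensorProduct.tprod k Fin.elim0 ⊗ₜ PiTensorProduct.tprod k Fin.elim0)) ∘ₗ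
      (PiTensorProduct.isEmptyEquiv (Fin 0)).toLinearMap
  | n + 1 =>
    (consT k A n ∘ₗ (lactInv k H A).rTensor (⨂[k]^n A) ∘ₗ
        (TensorProduct.assoc k H A (⨂[k]^n A)).symm.toLinearMap ∘ₗ
        (TensorProduct.comm k (A ⊗[k] (⨂[k]^n A)) H).toLinearMap).rTensor (⨂[k]^(n + 1) B) ∘ₗ
      (TensorProduct.assoc k (A ⊗[k] (⨂[k]^n A)) H (⨂[k]^(n + 1) B)).symm.toLinearMap ∘ₗ
      (coactT k H B (n + 1) ∘ₗ consT k B n).lTensor (A ⊗[k] (⨂[k]^n A)) ∘ₗ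
      (TensorProduct.tensorTensorTensorComm k A B (⨂[k]^n A) (⨂[k]^n B)).toLinearMap ∘ₗ
      TensorProduct.map (CrossedProduct.equiv k H A B).symm.toLinearMap (twist n) ∘ₗ
      unconsT k (CrossedProduct k H A B) n

/-- The map `Ψ` from the diagonal `Cⁿ(A, M) ⊗ Cⁿ(B, M)` to `Cⁿ(A ⋊ B)`:
`Ψ(φ ⊗ ψ)(a⁰ ⋊ b⁰ ⊗ ⋯ ⊗ aⁿ ⋊ bⁿ) =
  φ(ψ(b⁰₍₀₎ ⊗ ⋯ ⊗ bⁿ₍₀₎) ⊗ S⁻¹(b⁰₍₋₁₎ ⋯ bⁿ₍₋₁₎) a⁰ ⊗ ⋯ ⊗ S⁻¹(bⁿ₍₋ₙ₋₁₎) aⁿ)`. -/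
def Psi (n : ℕ) : CochainA k A M n ⊗[k] CochainB k B M n →ₗ[k]
    ((⨂[k]^(n + 1) (CrossedProduct k H A B)) →ₗ[k] k) :=
  TensorProduct.lift (LinearMap.mk₂ k
    (fun φ ψ => φ ∘ₗ ψ.rTensor (⨂[k]^(n + 1) A) ∘ₗ
      (TensorProduct.comm k (⨂[k]^(n + 1) A) (⨂[k]^(n + 1) B)).toLinearMap ∘ₗ
      twist k H A B (n + 1))
    (fun _ _ _ => rfl)
    (fun _ _ _ => rfl)
    (fun φ ψ ψ' => by rw [LinearMap.rTensor_add, LinearMap.add_comp, LinearMap.comp_add])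
    (fun c φ ψ => by rw [LinearMap.rTensor_smul, LinearMap.smul_comp, LinearMap.comp_smul]))

/-- The Alexander-Whitney map from bidegree `(p, q)` to the diagonal: first cofaces on the
cochains of `A` and last cofaces on the cochains of `B`,
`φ ⊗ ψ ↦ (∂₀)^q φ ⊗ ∂_{p+q} ⋯ ∂_{q+1} ψ`. -/
def AW (p q : ℕ) (φ : CochainA k A M p) (ψ : CochainB k B M q) :
    CochainA k A M (p + q) ⊗[k] CochainB k B M (p + q) :=
  (Nat.leRecOn (C := CochainA k A M) (Nat.le_add_right p q)
      (fun {n} => faceA k H A M n 0) φ) ⊗ₜ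
    (Nat.leRecOn (C := CochainB k B M) (Nat.le_add_left q p)
      (fun {n} => faceB k H B M n (n + 1)) ψ)

/-- The cup product of cochains, `φ ∪ ψ = Ψ(AW(φ ⊗ ψ))`. -/
def cup (p q : ℕ) (φ : CochainA k A M p) (ψ : CochainB k B M q) :
    (⨂[k]^(p + q + 1) (CrossedProduct k H A B)) →ₗ[k] k :=
  Psi k H A B M (p + q) (AW k H A B M p q φ ψ)

end Cup

/-! ## The terms of the explicit formula -/

section Formula

variable {k : Type*} [Field k] {H A B M : Type*} [Ring H] [HopfAlgebra k H]
  [InvertibleAntipode k H]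
  [Ring A] [Algebra k A] [Module H A] [IsScalarTower k H A]
  [Ring B] [Algebra k B]
  [AddCommGroup M] [Module k M]

/-- The ordered product `f i * f (i + 1) * ⋯ * f (j - 1)`; it is `1` if `j ≤ i`. -/
def orderedProd {R : Type*} [Monoid R] (i j : ℕ) (f : ℕ → R) : R :=
  ((List.range' i (j - i)).map f).prod

/-- With `x i l` in the place of `bⁱ₍₋ₗ₎` and `y i` in the place of `bⁱ₍₀₎`, the expression
`φ(ψ(b^{q+1}₍₀₎ ⋯ b^{p+q}₍₀₎ b⁰₍₀₎ ⊗ b¹₍₀₎ ⊗ ⋯ ⊗ b^q₍₀₎)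
  ⊗ S⁻¹(b⁰₍₋₁₎ ⋯ b^q₍₋₁₎) a⁰ · S⁻¹(b¹₍₋₂₎ ⋯ b^q₍₋₂₎) a¹ ⋯ S⁻¹(b^q₍₋q₋₁₎) a^q
  ⊗ a^{q+1} ⊗ b^{q+1}₍₋p₊₁₎ a^{q+2} ⊗ ⋯ ⊗ b^{q+1}₍₋₁₎ ⋯ b^{p+q-1}₍₋₁₎ a^{p+q})`. -/
def cupTerm (p q : ℕ) (φ : CochainA k A M p) (ψ : CochainB k B M q)
    (a : ℕ → A) (x : ℕ → ℕ → H) (y : ℕ → B) : k :=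
  φ (ψ (PiTensorProduct.tprod k (Fin.cons (orderedProd (q + 1) (p + q + 1) y * y 0)
        (fun j : Fin q => y (j + 1)) : Fin (q + 1) → B)) ⊗ₜ
    PiTensorProduct.tprod k (Fin.cons
        (orderedProd 0 (q + 1) fun i =>
          antipodeInv k H (orderedProd i (q + 1) fun j => x j (i + 1)) • a i)
        (fun j : Fin p =>
          (orderedProd (q + 1) (q + 1 + j) fun i => x i (p - j)) • a (q + 1 + j)) :
      Fin (p + 1) → A))

/-- The number of legs of `bⁱ` in `H` that occur in the formula: `i + 1` for `i ≤ q`, and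
`p + q - i` for `q < i ≤ p + q`. -/
def legCount (p q i : ℕ) : ℕ := if i ≤ q then i + 1 else p + q - i

end Formula

end HopfCup

end

/-!
The two halves of the theorem rest on one reduction. Every element of a comodule over a field lies
in a finite family `ν` with a multiplicative matrix `c` of coefficients, `ν j ↦ ∑ c j l ⊗ ν l`
(`IsCoeff`, `exists_isCoeff`). Iterated coactions then become products of matrices, and the Hopf
algebra identities become statements that two matrices are inverse to each other, such as
`∑ c m l * S⁻¹ (c j m) = δ_{jl}` (`IsCoeff.mul_antipodeInv_self`).

*Descent to cohomology.* The twisting map `(A ⋊ B)^{⊗ n} → A^{⊗ n} ⊗ B^{⊗ n}`, defined by adding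
factors in front, can also be computed by adding factors at the end: a new last factor `a ⋊ b`
attaches `a` and `b₍₀₎` and lets `S⁻¹(b₍₋₁₎)` act diagonally (`twist_snocT`). Hence it commutes with
merging adjacent factors (`twist_mulAt`), which settles all cofaces but the last. For the last one,
an equivariant `φ` satisfies `φ(m h ⊗ ã) = φ(m ⊗ h ã)` (`isBalanced_of_mem`), so that the leg which
`∂ₙ₊₁ ψ` moves to the coefficients cancels the `S⁻¹` of the twist (`pairing_faceB_last`); the
colinearity of `ψ` takes care of the coface of `φ` (`Psi_face_last`). Thus `Ψ` is a map of
cosimplicial modules on the diagonal (`Psi_face`), the Alexander-Whitney map commutes with the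
coboundaries (`diagonal_coboundary`), and together they give the Leibniz rule
`d(φ ∪ ψ) = φ ∪ dψ + (-1)^q dφ ∪ ψ` (`hochschildD_cupTo`). Anti-Yetter-Drinfeld compatibility enters
in that last cofaces preserve balanced cochains (`IsBalanced.faceA_last`) and colinear cochains
(`faceB_last_mem`). The Leibniz rule makes the product of classes well defined, and classes of
cocycles exhaust the cohomology, so it is unique (`existsUnique_cupCohomology`).

*The formula.* The same cancellation, applied to one last coface of `ψ` at a time, turns the last
factors of the twist into the tail `a^{q+1} ⊗ b^{q+1}₍₋ₚ₊₁₎ a^{q+2} ⊗ ⋯` on which no antipode acts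
(`tailPairing_faceB_last`, `pairing_twist_eq_tailPairing`), while the first cofaces of `φ` multiply
the remaining `q + 1` factors of `A` (`tailPairing_seqT`). It remains to rewrite nested coactions as
iterated ones (`sum_actT_of_iterCoact`, `sum_actT_antipodeInv_of_iterCoact`) and to collect the sums
over the summands of the given expansions (`choiceSum`), which is done for the twist in `twist_seqT`
and for the tail in `tailTwist_eq_choiceSum`.
-/

noncomputable section

namespace HopfCup

/-! ### Matrix coefficients of comodules -/

section Coefficients

variable {k : Type*} [Field k] {H N : Type*} [Ring H] [HopfAlgebra k H]
  [AddCommGroup N] [Module k N]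

/-- A finite family `ν` in a comodule `N` together with its matrix `c` of coefficients in `H`:
`ν j ↦ ∑ c j l ⊗ ν l`, where `c` is a multiplicative matrix, `Δ (c j l) = ∑ c j m ⊗ c m l` and
`ε (c j l) = δ_{jl}`. The coaction `ρ` is a bare linear map, so that the same notion applies to
comodules, to their tensor powers and to `H` itself. -/
structure IsCoeff {J : Type*} [Fintype J] [DecidableEq J] (ρ : N →ₗ[k] H ⊗[k] N)
    (ν : J → N) (c : J → J → H) : Prop where
  coact : ∀ j, ρ (ν j) = ∑ l, c j l ⊗ₜ ν l
  comul : ∀ j l, Coalgebra.comul (R := k) (c j l) = ∑ m, c j m ⊗ₜ c m l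
  counit : ∀ j l, Coalgebra.counit (R := k) (c j l) = if j = l then 1 else 0

/-- Every element of a comodule over a field lies in a finite family with a coefficient matrix: a
basis of a finite-dimensional subcomodule that contains it. -/
theorem exists_isCoeff (ρ : N →ₗ[k] H ⊗[k] N)
    (hassoc : TensorProduct.assoc k H H N ∘ₗ (Coalgebra.comul (R := k)).rTensor N ∘ₗ ρ =
      ρ.lTensor H ∘ₗ ρ)
    (hcounit : TensorProduct.lid k N ∘ₗ (Coalgebra.counit (R := k)).rTensor N ∘ₗ ρ =
      LinearMap.id) (n : N) :
    ∃ (d : ℕ) (ν : Fin d → N) (c : Fin d → Fin d → H) (j : Fin d), IsCoeff ρ ν c ∧ ν j = n := by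
  classical
  rcases eq_or_ne n 0 with rfl | hn
  · refine ⟨1, fun _ => 0, fun _ _ => 1, 0, ⟨fun _ => by simp, fun _ _ => ?_, fun j l => ?_⟩, rfl⟩
    · simp [Algebra.TensorProduct.one_def]
    · simp [Subsingleton.elim j l]
  let e := Module.Basis.ofVectorSpace k H
  obtain ⟨F, hF⟩ := TensorProduct.eq_repr_basis_left e (ρ n)
  rw [Finsupp.sum] at hF
  let ev : (H →ₗ[k] k) → (H ⊗[k] N →ₗ[k] N) := fun f => TensorProduct.lid k N ∘ₗ f.rTensor N
  have hev : ∀ (f : H →ₗ[k] k) (h : H) (x : N), ev f (h ⊗ₜ x) = f h • x := fun f h x => by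
    simp [ev]
  have hFi : ∀ i, F i = ev (e.coord i) (ρ n) := by
    intro i
    rw [← hF, map_sum]
    simp only [hev, Module.Basis.coord_apply, Module.Basis.repr_self, Finsupp.single_apply,
      ite_smul, one_smul, zero_smul]
    rw [Finset.sum_ite_eq']
    split_ifs with h
    · rfl
    · exact Finsupp.notMem_support_iff.1 h
  -- The span of the right tensor factors of `ρ n` is the subcomodule generated by `n`.
  have hρF : ∀ i, ρ (F i) = ∑ l ∈ F.support,
      (TensorProduct.lid k H ((e.coord i).rTensor H (Coalgebra.comul (R := k) (e l)))) ⊗ₜ F l := by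
    intro i
    have h1 := LinearMap.congr_fun hassoc n
    simp only [LinearMap.comp_apply, LinearEquiv.coe_coe] at h1
    have h2 : ∀ t : H ⊗[k] N, ρ (ev (e.coord i) t) =
        TensorProduct.lid k (H ⊗[k] N) ((e.coord i).rTensor _ (ρ.lTensor H t)) := by
      intro t
      induction t with
      | zero => simp
      | add x y hx hy => simp only [map_add, hx, hy]
      | tmul h x => simp [hev]
    rw [hFi, h2, ← h1, ← hF]
    simp only [map_sum, LinearMap.rTensor_tmul]
    refine Finset.sum_congr rfl fun l _ => ?_
    induction Coalgebra.comul (R := k) (e l) with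
    | zero => simp
    | add x y hx hy => simp only [map_add, TensorProduct.add_tmul, hx, hy]
    | tmul h x => simp [TensorProduct.smul_tmul']
  let W : Submodule k N := Submodule.span k (F '' F.support)
  have hFW : ∀ l ∈ F.support, F l ∈ W := fun l hl => Submodule.subset_span ⟨l, hl, rfl⟩
  have hfin : Module.Finite k W :=
    FiniteDimensional.span_of_finite k ((Finset.finite_toSet _).image _)
  have hnW : n ∈ W := by
    have h1 := LinearMap.congr_fun hcounit n
    simp only [LinearMap.comp_apply, LinearEquiv.coe_coe, LinearMap.id_apply] at h1
    rw [← h1, ← hF, map_sum, map_sum]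
    refine Submodule.sum_mem _ fun l hl => ?_
    simpa using W.smul_mem _ (hFW l hl)
  have hρW : W ≤ (LinearMap.range (W.subtype.lTensor H)).comap ρ := by
    refine Submodule.span_le.2 ?_
    rintro _ ⟨i, -, rfl⟩
    refine Submodule.mem_comap.2 ?_
    rw [hρF i]
    exact Submodule.sum_mem _ fun l hl => ⟨_ ⊗ₜ ⟨F l, hFW l hl⟩, rfl⟩
  have hli : LinearIndepOn k id ({⟨n, hnW⟩} : Set W) :=
    LinearIndepOn.singleton (by simpa [Subtype.ext_iff] using hn)
  let b' := Module.Basis.extend hli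
  have : Fintype (hli.extend (Set.subset_univ _)) := FiniteDimensional.fintypeBasisIndex b'
  let b := b'.reindex (Fintype.equivFin _)
  let j0 := Fintype.equivFin (hli.extend (Set.subset_univ _))
    ⟨⟨n, hnW⟩, Module.Basis.subset_extend hli rfl⟩
  have hj0 : (b j0 : N) = n := by
    simp [b, j0, b']
  choose g hg using fun l => (b.coord l).exists_extend
  have hgb : ∀ l m, g l (b m) = if m = l then 1 else 0 := by
    intro l m
    have := LinearMap.congr_fun (hg l) (b m)
    simp only [LinearMap.comp_apply, Submodule.subtype_apply] at this
    rw [this, Module.Basis.coord_apply, Module.Basis.repr_self, Finsupp.single_apply]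
  let evr : (N →ₗ[k] k) → (H ⊗[k] N →ₗ[k] H) := fun f => TensorProduct.rid k H ∘ₗ f.lTensor H
  have hevr : ∀ f h x, evr f (h ⊗ₜ x) = f x • h := fun f h x => by simp [evr]
  let c : Fin _ → Fin _ → H := fun j l => evr (g l) (ρ (b j))
  have hexp : ∀ t : H ⊗[k] W, W.subtype.lTensor H t =
      ∑ l, evr (g l) (W.subtype.lTensor H t) ⊗ₜ (b l : N) := by
    intro t
    induction t with
    | zero => simp
    | add x y hx hy =>
      rw [map_add]
      nth_rewrite 1 [hx, hy]
      simp only [map_add, TensorProduct.add_tmul, Finset.sum_add_distrib]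
    | tmul h x =>
      have hx : (x : N) = ∑ l, g l x • (b l : N) := by
        conv_lhs => rw [← b.sum_repr x]
        simp only [Submodule.coe_sum, Submodule.coe_smul]
        refine Finset.sum_congr rfl fun l _ => ?_
        have := LinearMap.congr_fun (hg l) x
        simp only [LinearMap.comp_apply, Submodule.subtype_apply] at this
        rw [this, Module.Basis.coord_apply]
      simp only [LinearMap.lTensor_tmul, Submodule.subtype_apply, hevr]
      conv_lhs => rw [hx]
      simp only [TensorProduct.tmul_sum, TensorProduct.smul_tmul]
  have hco : ∀ j, ρ (b j) = ∑ l, c j l ⊗ₜ (b l : N) := by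
    intro j
    obtain ⟨t, ht⟩ := hρW (b j).2
    have := hexp t
    rw [ht] at this
    exact this
  refine ⟨_, fun j => (b j : N), c, j0, ⟨hco, fun j l => ?_, fun j l => ?_⟩, hj0⟩
  · have h1 := LinearMap.congr_fun hassoc (b j)
    simp only [LinearMap.comp_apply, LinearEquiv.coe_coe, hco, map_sum, LinearMap.rTensor_tmul,
      LinearMap.lTensor_tmul, TensorProduct.tmul_sum] at h1
    let evl : H ⊗[k] (H ⊗[k] N) →ₗ[k] H ⊗[k] H := (evr (g l)).lTensor H
    have h2 : ∀ (t : H ⊗[k] H) (x : N), evl (TensorProduct.assoc k H H N (t ⊗ₜ x)) = g l x • t := by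
      intro t x
      induction t with
      | zero => simp
      | add x y hx hy => simp only [map_add, TensorProduct.add_tmul, hx, hy, smul_add]
      | tmul h x => simp [evl, hevr]
    have h3 := congrArg evl h1
    simp only [map_sum, h2, hgb] at h3
    simpa [evl, hevr, hgb, TensorProduct.tmul_ite] using h3
  · have h1 := LinearMap.congr_fun hcounit (b j)
    simp only [LinearMap.comp_apply, LinearEquiv.coe_coe, LinearMap.id_apply, hco, map_sum,
      LinearMap.rTensor_tmul, TensorProduct.lid_tmul] at h1
    have h3 := congrArg (g l) h1
    simpa [hgb] using h3

theorem exists_isCoeff_coact [LeftComodule k H N] (n : N) :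
    ∃ (d : ℕ) (ν : Fin d → N) (c : Fin d → Fin d → H) (j : Fin d),
      IsCoeff (coact k H N) ν c ∧ ν j = n :=
  exists_isCoeff _ LeftComodule.coassoc LeftComodule.counit_coact n

theorem exists_isCoeff_comul (h : H) :
    ∃ (d : ℕ) (ν : Fin d → H) (c : Fin d → Fin d → H) (j : Fin d),
      IsCoeff (N := H) (Coalgebra.comul (R := k) (A := H)) ν c ∧ ν j = h :=
  exists_isCoeff (N := H) (Coalgebra.comul (R := k) (A := H)) (Coalgebra.coassoc (R := k) (A := H))
    (LinearMap.ext fun x => (congrArg (TensorProduct.lid k H)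
      (Coalgebra.rTensor_counit_comul (R := k) x)).trans (by simp)) h

end Coefficients

/-! ### The antipode and its inverse -/

section Antipode

variable {k : Type*} [Field k] {H N : Type*} [Ring H] [HopfAlgebra k H]
  [AddCommGroup N] [Module k N] {J : Type*} [Fintype J] [DecidableEq J]
  {ρ : N →ₗ[k] H ⊗[k] N} {ν : J → N} {c : J → J → H}

theorem IsCoeff.antipode_mul (hc : IsCoeff ρ ν c) (j l : J) :
    ∑ m, HopfAlgebra.antipode k (c j m) * c m l = if j = l then 1 else 0 := by
  have h := HopfAlgebra.mul_antipode_rTensor_comul_apply (R := k) (c j l)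
  rw [hc.comul, hc.counit] at h
  simpa [apply_ite] using h

theorem IsCoeff.mul_antipode (hc : IsCoeff ρ ν c) (j l : J) :
    ∑ m, c j m * HopfAlgebra.antipode k (c m l) = if j = l then 1 else 0 := by
  have h := HopfAlgebra.mul_antipode_lTensor_comul_apply (R := k) (c j l)
  rw [hc.comul, hc.counit] at h
  simpa [apply_ite] using h

/-- The antipode reverses the comultiplication: both sides are inverse to the matrix `Δ (c j l)`. -/
theorem IsCoeff.comul_antipode (hc : IsCoeff ρ ν c) (j l : J) :
    Coalgebra.comul (R := k) (HopfAlgebra.antipode k (c j l)) =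
      ∑ m, HopfAlgebra.antipode k (c m l) ⊗ₜ[k] HopfAlgebra.antipode k (c j m) := by
  let X : Matrix J J (H ⊗[k] H) := Matrix.of fun j l => Coalgebra.comul (R := k) (c j l)
  let Y : Matrix J J (H ⊗[k] H) := Matrix.of fun j l =>
    Coalgebra.comul (R := k) (HopfAlgebra.antipode k (c j l))
  let Z : Matrix J J (H ⊗[k] H) := Matrix.of fun j l =>
    ∑ m, HopfAlgebra.antipode k (c m l) ⊗ₜ[k] HopfAlgebra.antipode k (c j m)
  have hYX : Y * X = 1 := by
    ext j l
    simp only [Matrix.mul_apply, Matrix.of_apply, X, Y, ← Bialgebra.comul_mul, ← map_sum,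
      hc.antipode_mul,
      Matrix.one_apply]
    split_ifs <;> simp
  have hXZ : X * Z = 1 := by
    ext j l
    simp only [Matrix.mul_apply, Matrix.of_apply, X, Z, hc.comul, Finset.sum_mul, Finset.mul_sum,
      Algebra.TensorProduct.tmul_mul_tmul]
    calc _ = ∑ x, ∑ i, (c j x * HopfAlgebra.antipode k (c i l)) ⊗ₜ[k]
          (∑ m, c x m * HopfAlgebra.antipode k (c m i)) := by
          rw [Finset.sum_comm_cycle]
          simp only [TensorProduct.tmul_sum]
          exact Finset.sum_congr rfl fun x _ => Finset.sum_comm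
      _ = _ := by
          simp only [hc.mul_antipode, TensorProduct.tmul_ite,
            Finset.sum_ite_eq, Finset.mem_univ, if_true, ← TensorProduct.sum_tmul]
          rw [Matrix.one_apply]
          split_ifs <;> simp [Algebra.TensorProduct.one_def]
  have h : Y = Z := left_inv_eq_right_inv hYX hXZ
  exact congrFun (congrFun h j) l

theorem comul_antipode (h : H) : Coalgebra.comul (R := k) (HopfAlgebra.antipode k h) =
    TensorProduct.map (HopfAlgebra.antipode k) (HopfAlgebra.antipode k)
      (TensorProduct.comm k H H (Coalgebra.comul (R := k) h)) := by
  obtain ⟨d, ν, c, j, hc, rfl⟩ := exists_isCoeff_comul (k := k) h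
  have hν : ν j = ∑ l, Coalgebra.counit (R := k) (ν l) • c j l := by
    have := congrArg (TensorProduct.rid k H) (congrArg
      ((Coalgebra.counit (R := k)).lTensor H) (hc.coact j))
    simpa using this
  have hcν : ∀ m, ∑ l, Coalgebra.counit (R := k) (ν l) • c m l = ν m := fun m => by
    have := congrArg (TensorProduct.rid k H) (congrArg
      ((Coalgebra.counit (R := k)).lTensor H) (hc.coact m))
    simpa using this.symm
  rw [hν]
  simp only [map_sum, map_smul, hc.comul_antipode, hc.comul, TensorProduct.comm_tmul,
    TensorProduct.map_tmul]

variable [InvertibleAntipode k H]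

theorem antipodeInv_antipode (h : H) : antipodeInv k H (HopfAlgebra.antipode k h) = h :=
  (LinearEquiv.ofBijective (HopfAlgebra.antipode k (A := H))
    InvertibleAntipode.bijective).symm_apply_apply h

theorem antipode_antipodeInv (h : H) : HopfAlgebra.antipode k (antipodeInv k H h) = h :=
  (LinearEquiv.ofBijective (HopfAlgebra.antipode k (A := H))
    InvertibleAntipode.bijective).apply_symm_apply h

theorem antipode_injective : Function.Injective (HopfAlgebra.antipode k (A := H)) :=
  InvertibleAntipode.bijective.1

theorem antipodeInv_mul (g h : H) :
    antipodeInv k H (g * h) = antipodeInv k H h * antipodeInv k H g :=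
  antipode_injective (k := k) (by
    simp only [HopfAlgebra.antipode_mul_antidistrib, antipode_antipodeInv])

theorem antipodeInv_one : antipodeInv k H 1 = 1 :=
  antipode_injective (k := k) (by rw [antipode_antipodeInv, HopfAlgebra.antipode_one])

theorem counit_antipodeInv (h : H) :
    Coalgebra.counit (R := k) (antipodeInv k H h) = Coalgebra.counit (R := k) h := by
  rw [← HopfAlgebra.counit_antipode, antipode_antipodeInv]

/-- `S⁻¹(h₂) h₁ = ε(h)`. -/
theorem IsCoeff.antipodeInv_mul_self (hc : IsCoeff ρ ν c) (j l : J) :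
    ∑ m, antipodeInv k H (c m l) * c j m = if j = l then 1 else 0 := by
  apply antipode_injective (k := k)
  simp only [map_sum, HopfAlgebra.antipode_mul_antidistrib, antipode_antipodeInv,
    hc.antipode_mul]
  split_ifs <;> simp

/-- `h₂ S⁻¹(h₁) = ε(h)`. -/
theorem IsCoeff.mul_antipodeInv_self (hc : IsCoeff ρ ν c) (j l : J) :
    ∑ m, c m l * antipodeInv k H (c j m) = if j = l then 1 else 0 := by
  apply antipode_injective (k := k)
  simp only [map_sum, HopfAlgebra.antipode_mul_antidistrib, antipode_antipodeInv,
    hc.mul_antipode]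
  split_ifs <;> simp

theorem comul_antipodeInv (h : H) : Coalgebra.comul (R := k) (antipodeInv k H h) =
    TensorProduct.map (antipodeInv k H) (antipodeInv k H)
      (TensorProduct.comm k H H (Coalgebra.comul (R := k) h)) := by
  conv_rhs => rw [← antipode_antipodeInv (k := k) h, comul_antipode]
  induction Coalgebra.comul (R := k) (antipodeInv k H h) with
  | zero => simp
  | add x y hx hy => simp only [map_add, ← hx, ← hy]
  | tmul x y => simp [antipodeInv_antipode]

theorem IsCoeff.comul_antipodeInv (hc : IsCoeff ρ ν c) (j l : J) :
    Coalgebra.comul (R := k) (antipodeInv k H (c j l)) =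
      ∑ m, antipodeInv k H (c m l) ⊗ₜ[k] antipodeInv k H (c j m) := by
  rw [HopfCup.comul_antipodeInv, hc.comul]
  simp

end Antipode

/-! ### Tensor powers: first and last factors -/

section TensorPower

variable {k : Type*} [Field k] {V W : Type*} [AddCommGroup V] [Module k V]

variable (k) in
/-- `f 0 ⊗ f 1 ⊗ ⋯ ⊗ f (n - 1)`. Sequences indexed by `ℕ` avoid casts between the types `Fin n`. -/
def seqT (n : ℕ) (f : ℕ → V) : ⨂[k]^n V :=
  PiTensorProduct.tprod k fun i : Fin n => f i

variable (k V) in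
/-- `(v¹ ⊗ ⋯ ⊗ vⁿ) ⊗ v ↦ v¹ ⊗ ⋯ ⊗ vⁿ ⊗ v`. -/
def snocT (n : ℕ) : (⨂[k]^n V) ⊗[k] V →ₗ[k] ⨂[k]^(n + 1) V :=
  TensorProduct.lift (PiTensorProduct.lift
    (PiTensorProduct.tprod k (s := fun _ : Fin (n + 1) => V)).curryRight)

theorem snocT_tmul (n : ℕ) (f : Fin n → V) (v : V) :
    snocT k V n (PiTensorProduct.tprod k f ⊗ₜ v) =
      PiTensorProduct.tprod k (Fin.snoc f v : Fin (n + 1) → V) := by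
  simp [snocT]

theorem unconsT_consT (n : ℕ) (x : V ⊗[k] ⨂[k]^n V) : unconsT k V n (consT k V n x) = x := by
  suffices h : unconsT k V n ∘ₗ consT k V n = LinearMap.id from LinearMap.congr_fun h x
  ext v f
  simp [consT_tmul, unconsT_tprod]

theorem consT_unconsT (n : ℕ) (x : ⨂[k]^(n + 1) V) : consT k V n (unconsT k V n x) = x := by
  suffices h : consT k V n ∘ₗ unconsT k V n = LinearMap.id from LinearMap.congr_fun h x
  ext f
  simp [consT_tmul, unconsT_tprod]

@[elab_as_elim]
theorem cons_induction {n : ℕ} {P : (⨂[k]^(n + 1) V) → Prop} (x : ⨂[k]^(n + 1) V)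
    (cons : ∀ v α, P (consT k V n (v ⊗ₜ α))) (add : ∀ x y, P x → P y → P (x + y)) : P x := by
  rw [← consT_unconsT n x]
  induction unconsT k V n x with
  | zero => simpa using cons 0 0
  | add x y hx hy =>
    rw [map_add]
    exact add _ _ hx hy
  | tmul v α => exact cons v α

theorem seqT_succ (n : ℕ) (f : ℕ → V) :
    seqT k (n + 1) f = consT k V n (f 0 ⊗ₜ seqT k n fun i => f (i + 1)) := by
  rw [seqT, seqT, consT_tmul]
  congr 1
  ext i
  refine Fin.cases ?_ (fun i => ?_) i <;> simp

theorem seqT_succ' (n : ℕ) (f : ℕ → V) :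
    seqT k (n + 1) f = snocT k V n (seqT k n f ⊗ₜ f n) := by
  rw [seqT, seqT, snocT_tmul]
  congr 1
  ext i
  refine Fin.lastCases ?_ (fun i => ?_) i <;> simp

theorem seqT_congr {n : ℕ} {f g : ℕ → V} (h : ∀ i < n, f i = g i) : seqT k n f = seqT k n g := by
  rw [seqT, seqT]
  congr 1
  ext i
  exact h i i.2

theorem tprod_eq_seqT {n : ℕ} (f : Fin n → V) :
    ∃ g : ℕ → V, PiTensorProduct.tprod k f = seqT k n g := by
  refine ⟨fun i => if h : i < n then f ⟨i, h⟩ else 0, ?_⟩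
  rw [seqT]
  congr 1
  ext i
  simp

@[elab_as_elim]
theorem seqT_induction {n : ℕ} {P : (⨂[k]^n V) → Prop} (x : ⨂[k]^n V)
    (smul : ∀ (r : k) f, P (r • seqT k n f)) (add : ∀ x y, P x → P y → P (x + y)) : P x := by
  induction x using PiTensorProduct.induction_on with
  | smul_tprod r f =>
    obtain ⟨g, hg⟩ := tprod_eq_seqT (k := k) f
    rw [hg]
    exact smul r g
  | add x y hx hy => exact add x y hx hy

theorem seqT_ext {n : ℕ} [AddCommGroup W] [Module k W] {f g : (⨂[k]^n V) →ₗ[k] W}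
    (h : ∀ s : ℕ → V, f (seqT k n s) = g (seqT k n s)) : f = g := by
  ext x
  obtain ⟨s, hs⟩ := tprod_eq_seqT (k := k) x
  simpa [← hs] using h s

@[elab_as_elim]
theorem snoc_induction {n : ℕ} {P : (⨂[k]^(n + 1) V) → Prop} (x : ⨂[k]^(n + 1) V)
    (snoc : ∀ α v, P (snocT k V n (α ⊗ₜ v))) (add : ∀ x y, P x → P y → P (x + y)) : P x := by
  induction x using seqT_induction with
  | smul r f =>
    rw [seqT_succ', ← map_smul, TensorProduct.smul_tmul']
    exact snoc _ _
  | add x y hx hy => exact add x y hx hy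

theorem snocT_consT (n : ℕ) (v w : V) (α : ⨂[k]^n V) :
    snocT k V (n + 1) (consT k V n (v ⊗ₜ α) ⊗ₜ w) =
      consT k V (n + 1) (v ⊗ₜ snocT k V n (α ⊗ₜ w)) := by
  induction α using PiTensorProduct.induction_on with
  | smul_tprod r f =>
    simp only [TensorProduct.tmul_smul, map_smul, ← TensorProduct.smul_tmul', consT_tmul,
      snocT_tmul]
    congr 2
    exact (Fin.cons_snoc_eq_snoc_cons (β := V) v f w).symm
  | add x y hx hy =>
    simp only [TensorProduct.tmul_add, TensorProduct.add_tmul, map_add, hx, hy]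

theorem rotT_snocT (n : ℕ) (α : ⨂[k]^n V) (v : V) :
    rotT k V n (snocT k V n (α ⊗ₜ v)) = consT k V n (v ⊗ₜ α) := by
  induction α using PiTensorProduct.induction_on with
  | smul_tprod r f =>
    simp only [TensorProduct.tmul_smul, map_smul, ← TensorProduct.smul_tmul', consT_tmul,
      snocT_tmul]
    congr 1
    refine (PiTensorProduct.reindex_tprod _ _).trans ?_
    congr 1
    ext i
    refine Fin.cases ?_ (fun i => ?_) i
    · rw [(Equiv.symm_apply_eq _).2 (finRotate_last (n := n)).symm]
      simp
    · rw [(Equiv.symm_apply_eq _).2 (show i.succ = finRotate (n + 1) i.castSucc by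
        exact (finRotate_of_lt (k := i) i.2).symm)]
      simp
  | add x y hx hy =>
    simp only [TensorProduct.tmul_add, TensorProduct.add_tmul, map_add, hx, hy]

/-- A tensor of degree zero is a multiple of the empty tensor, so the order in which a factor is
attached to it does not matter. -/
theorem snocT_zero (α : ⨂[k]^0 V) (v : V) :
    snocT k V 0 (α ⊗ₜ v) = consT k V 0 (v ⊗ₜ α) := by
  induction α using PiTensorProduct.induction_on with
  | smul_tprod r f =>
    simp only [TensorProduct.tmul_smul, map_smul, ← TensorProduct.smul_tmul', consT_tmul,
      snocT_tmul]
    congr 2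
    ext i
    obtain rfl : i = 0 := Fin.fin_one_eq_zero i
    simp [Fin.snoc]
  | add x y hx hy =>
    simp only [TensorProduct.tmul_add, TensorProduct.add_tmul, map_add, hx, hy]

variable (k V) in
/-- Concatenation `(v⁰ ⊗ ⋯ ⊗ vⁿ⁻¹) ⊗ (w⁰ ⊗ ⋯ ⊗ wᵖ⁻¹) ↦ v⁰ ⊗ ⋯ ⊗ vⁿ⁻¹ ⊗ w⁰ ⊗ ⋯ ⊗ wᵖ⁻¹`, with values
in any degree `N` that is provably `n + p`. -/
def joinT {n p N : ℕ} (h : n + p = N) : (⨂[k]^n V) ⊗[k] (⨂[k]^p V) →ₗ[k] ⨂[k]^N V :=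
  (PiTensorProduct.reindex k (fun _ => V) (finSumFinEquiv.trans (finCongr h))).toLinearMap ∘ₗ
    (PiTensorProduct.tmulEquiv k V).toLinearMap

theorem joinT_seqT {n p N : ℕ} (h : n + p = N) (f g : ℕ → V) :
    joinT k V h (seqT k n f ⊗ₜ seqT k p g) =
      seqT k N fun i => if i < n then f i else g (i - n) := by
  subst h
  rw [joinT, LinearMap.comp_apply, LinearEquiv.coe_coe, LinearEquiv.coe_coe, seqT, seqT,
    PiTensorProduct.tmulEquiv_apply]
  refine (PiTensorProduct.reindex_tprod _ _).trans ?_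
  rw [seqT]
  congr 1
  ext i
  refine Fin.addCases (fun i => ?_) (fun i => ?_) i <;> simp

theorem joinT_consT {n p N : ℕ} (h : n + p = N) (h' : n + 1 + p = N + 1) (v : V) (α : ⨂[k]^n V)
    (β : ⨂[k]^p V) :
    joinT k V h' (consT k V n (v ⊗ₜ α) ⊗ₜ β) = consT k V N (v ⊗ₜ joinT k V h (α ⊗ₜ β)) := by
  induction α using seqT_induction with
  | add x y hx hy => simp only [TensorProduct.tmul_add, TensorProduct.add_tmul, map_add, hx, hy]
  | smul r f =>
  induction β using seqT_induction with
  | add x y hx hy => simp only [TensorProduct.tmul_add, map_add, hx, hy]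
  | smul r' g =>
    simp only [TensorProduct.tmul_smul, map_smul, ← TensorProduct.smul_tmul', joinT_seqT]
    congr 2
    have h1 : consT k V n (v ⊗ₜ seqT k n f) = seqT k (n + 1) (fun i => Nat.casesOn i v f) := by
      rw [seqT_succ]; rfl
    rw [h1, joinT_seqT, seqT_succ]
    simp

theorem joinT_snocT {n p N : ℕ} (h : n + 1 + p = N) (h' : n + (p + 1) = N) (v : V) (α : ⨂[k]^n V)
    (β : ⨂[k]^p V) :
    joinT k V h (snocT k V n (α ⊗ₜ v) ⊗ₜ β) = joinT k V h' (α ⊗ₜ consT k V p (v ⊗ₜ β)) := by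
  induction α using seqT_induction with
  | add x y hx hy => simp only [TensorProduct.add_tmul, map_add, hx, hy]
  | smul r f =>
  induction β using seqT_induction with
  | add x y hx hy => simp only [TensorProduct.tmul_add, map_add, hx, hy]
  | smul r' g =>
    simp only [TensorProduct.tmul_smul, map_smul, ← TensorProduct.smul_tmul']
    congr 2
    have h1 : consT k V p (v ⊗ₜ seqT k p g) = seqT k (p + 1) (fun i => Nat.casesOn i v g) := by
      rw [seqT_succ]; rfl
    have h2 : snocT k V n (seqT k n f ⊗ₜ v) = seqT k (n + 1)
        (fun i => if i < n then f i else v) := by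
      rw [seqT_succ', seqT_congr (g := f) fun i hi => if_pos hi]
      simp
    rw [h1, h2, joinT_seqT, joinT_seqT]
    refine seqT_congr fun i _ => ?_
    rcases lt_trichotomy i n with hi | rfl | hi
    · simp [hi, Nat.lt_succ_of_lt hi]
    · simp
    · rw [if_neg (by omega), if_neg (by omega)]
      obtain ⟨m, rfl⟩ := Nat.exists_eq_add_of_lt hi
      rw [show n + m + 1 - n = m + 1 by omega]
      congr 1
      omega

theorem joinT_zero {n N : ℕ} (h : n + 0 = N) (α : ⨂[k]^n V) (f : ℕ → V) :
    joinT k V h (α ⊗ₜ seqT k 0 f) = h ▸ α := by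
  subst h
  induction α using seqT_induction with
  | add x y hx hy => simp only [TensorProduct.add_tmul, map_add, hx, hy]
  | smul r f =>
    simp only [map_smul, ← TensorProduct.smul_tmul', joinT_seqT]
    congr 1
    exact seqT_congr fun i hi => if_pos hi

end TensorPower

/-! ### Merging adjacent factors -/

section Merge

variable {k : Type*} [Field k] {A : Type*} [Ring A] [Algebra k A]

theorem mulHead_consT (n : ℕ) (a b : A) (α : ⨂[k]^n A) :
    mulHead k A n (a ⊗ₜ consT k A n (b ⊗ₜ α)) = consT k A n ((a * b) ⊗ₜ α) := by
  simp [mulHead, unconsT_consT]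

theorem mulAt_zero_consT (n : ℕ) (a : A) (α : ⨂[k]^(n + 1) A) :
    mulAt k A n 0 (consT k A (n + 1) (a ⊗ₜ α)) = mulHead k A n (a ⊗ₜ α) := by
  simp [mulAt, unconsT_consT]

theorem mulAt_succ_consT (n i : ℕ) (a : A) (α : ⨂[k]^(n + 2) A) :
    mulAt k A (n + 1) (i + 1) (consT k A (n + 2) (a ⊗ₜ α)) =
      consT k A (n + 1) (a ⊗ₜ mulAt k A n i α) := by
  simp [mulAt, unconsT_consT]

theorem mulHead_mul (n : ℕ) (a b : A) (α : ⨂[k]^(n + 1) A) :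
    mulHead k A n (a ⊗ₜ mulHead k A n (b ⊗ₜ α)) = mulHead k A n ((a * b) ⊗ₜ α) := by
  induction α using cons_induction with
  | cons v α => simp only [mulHead_consT, mul_assoc]
  | add x y hx hy => simp only [TensorProduct.tmul_add, map_add, hx, hy]

theorem one_mulHead (n : ℕ) (α : ⨂[k]^(n + 1) A) : mulHead k A n (1 ⊗ₜ α) = α := by
  induction α using cons_induction with
  | cons v α => simp only [mulHead_consT, one_mul]
  | add x y hx hy => simp only [TensorProduct.tmul_add, map_add, hx, hy]

theorem mulHead_snocT (n : ℕ) (a b : A) (α : ⨂[k]^(n + 1) A) :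
    mulHead k A (n + 1) (a ⊗ₜ snocT k A (n + 1) (α ⊗ₜ b)) =
      snocT k A (n + 1) (mulHead k A n (a ⊗ₜ α) ⊗ₜ b) := by
  induction α using cons_induction with
  | cons v α => simp only [mulHead_consT, snocT_consT]
  | add x y hx hy => simp only [TensorProduct.tmul_add, TensorProduct.add_tmul, map_add, hx, hy]

theorem mulAt_mulHead (n i : ℕ) (a : A) (α : ⨂[k]^(n + 2) A) :
    mulAt k A n i (mulHead k A (n + 1) (a ⊗ₜ α)) = mulHead k A n (a ⊗ₜ mulAt k A n i α) := by
  induction α using cons_induction with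
  | add x y hx hy => simp only [TensorProduct.tmul_add, map_add, hx, hy]
  | cons v α =>
    match n, i with
    | n, 0 => rw [mulHead_consT, mulAt_zero_consT, mulAt_zero_consT, mulHead_mul]
    | 0, i + 1 => simp [mulAt]
    | n + 1, i + 1 => rw [mulHead_consT, mulAt_succ_consT, mulAt_succ_consT, mulHead_consT]

/-- Merging the first two factors commutes with merging two later adjacent factors; for `i = 0` this
is associativity. -/
theorem mulAt_zero_mulAt_succ (n i : ℕ) (x : ⨂[k]^(n + 3) A) :
    mulAt k A n 0 (mulAt k A (n + 1) (i + 1) x) = mulAt k A n i (mulAt k A (n + 1) 0 x) := by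
  induction x using cons_induction with
  | add x y hx hy => simp only [map_add, hx, hy]
  | cons a x => rw [mulAt_succ_consT, mulAt_zero_consT, mulAt_zero_consT, mulAt_mulHead]

theorem mulAt_snocT {n i : ℕ} (hi : i ≤ n) (α : ⨂[k]^(n + 2) A) (b : A) :
    mulAt k A (n + 1) i (snocT k A (n + 2) (α ⊗ₜ b)) =
      snocT k A (n + 1) (mulAt k A n i α ⊗ₜ b) := by
  induction n generalizing i with
  | zero =>
    obtain rfl : i = 0 := by omega
    induction α using cons_induction with
    | add x y hx hy => simp only [TensorProduct.add_tmul, map_add, hx, hy]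
    | cons v α => rw [snocT_consT, mulAt_zero_consT, mulAt_zero_consT, mulHead_snocT]
  | succ n ih =>
    induction α using cons_induction with
    | add x y hx hy => simp only [TensorProduct.add_tmul, map_add, hx, hy]
    | cons v α =>
      cases i with
      | zero => rw [snocT_consT, mulAt_zero_consT, mulAt_zero_consT, mulHead_snocT]
      | succ i =>
        rw [snocT_consT, mulAt_succ_consT, mulAt_succ_consT, ih (by omega), snocT_consT]

theorem mulAt_snocT_snocT (n : ℕ) (α : ⨂[k]^n A) (a b : A) :
    mulAt k A n n (snocT k A (n + 1) (snocT k A n (α ⊗ₜ a) ⊗ₜ b)) =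
      snocT k A n (α ⊗ₜ (a * b)) := by
  induction n with
  | zero =>
    rw [snocT_zero, snocT_consT, snocT_zero, mulAt_zero_consT, mulHead_consT, snocT_zero]
  | succ n ih =>
    induction α using cons_induction with
    | add x y hx hy => simp only [TensorProduct.add_tmul, map_add, hx, hy]
    | cons v α => rw [snocT_consT, snocT_consT, mulAt_succ_consT, ih, snocT_consT]

end Merge

/-! ### The diagonal action on tensor powers -/

section Action

variable {k : Type*} [Field k] {H A : Type*} [Ring H] [HopfAlgebra k H]

section Module

variable [AddCommGroup A] [Module k A] [Module H A] [IsScalarTower k H A]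

theorem lact_tmul (h : H) (a : A) : lact k H A (h ⊗ₜ a) = h • a := rfl

theorem actT_zero (h : H) (α : ⨂[k]^0 A) :
    actT k H A 0 (h ⊗ₜ α) = Coalgebra.counit (R := k) h • α := by
  simp [actT]

theorem actT_consT {ι : Type*} {s : Finset ι} {x y : ι → H} {h : H}
    (hh : Coalgebra.comul (R := k) h = ∑ i ∈ s, x i ⊗ₜ y i) (n : ℕ) (a : A) (α : ⨂[k]^n A) :
    actT k H A (n + 1) (h ⊗ₜ consT k A n (a ⊗ₜ α)) =
      ∑ i ∈ s, consT k A n ((x i • a) ⊗ₜ actT k H A n (y i ⊗ₜ α)) := by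
  simp [actT, unconsT_consT, hh, TensorProduct.sum_tmul, lact_tmul]

theorem actT_one (n : ℕ) (α : ⨂[k]^n A) : actT k H A n (1 ⊗ₜ α) = α := by
  induction n with
  | zero => simp [actT_zero]
  | succ n ih =>
    induction α using cons_induction with
    | add x y hx hy => simp only [TensorProduct.tmul_add, map_add, hx, hy]
    | cons v α =>
      rw [actT_consT (s := {()}) (x := fun _ => 1) (y := fun _ => 1)]
      · simp [ih]
      · simp [Algebra.TensorProduct.one_def]

theorem actT_mul (n : ℕ) (g h : H) (α : ⨂[k]^n A) :
    actT k H A n ((g * h) ⊗ₜ α) = actT k H A n (g ⊗ₜ actT k H A n (h ⊗ₜ α)) := by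
  induction n generalizing g h with
  | zero =>
    simp only [actT_zero, Bialgebra.counit_mul, mul_smul, TensorProduct.tmul_smul, map_smul]
    exact smul_comm _ _ _
  | succ n ih =>
    induction α using cons_induction with
    | add x y hx hy => simp only [TensorProduct.tmul_add, map_add, hx, hy]
    | cons v α =>
      obtain ⟨d, ν, c, j, hc, rfl⟩ := exists_isCoeff_comul (k := k) g
      obtain ⟨d', ν', c', j', hc', rfl⟩ := exists_isCoeff_comul (k := k) h
      rw [actT_consT (hc'.coact j'), actT_consT (s := Finset.univ)
        (x := fun i : Fin d × Fin d' => c j i.1 * c' j' i.2) (y := fun i => ν i.1 * ν' i.2)]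
      · simp only [ih, TensorProduct.tmul_sum, map_sum, actT_consT (hc.coact j), mul_smul]
        rw [Fintype.sum_prod_type, Finset.sum_comm]
      · rw [Bialgebra.comul_mul, hc.coact, hc'.coact, Finset.sum_mul_sum, Fintype.sum_prod_type]
        simp only [Algebra.TensorProduct.tmul_mul_tmul]

theorem actT_snocT {ι : Type*} {s : Finset ι} {x y : ι → H} {h : H}
    (hh : Coalgebra.comul (R := k) h = ∑ i ∈ s, x i ⊗ₜ y i) (n : ℕ) (α : ⨂[k]^n A) (a : A) :
    actT k H A (n + 1) (h ⊗ₜ snocT k A n (α ⊗ₜ a)) =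
      ∑ i ∈ s, snocT k A n (actT k H A n (x i ⊗ₜ α) ⊗ₜ (y i • a)) := by
  suffices hm : ∀ h : H, actT k H A (n + 1) (h ⊗ₜ snocT k A n (α ⊗ₜ a)) =
      snocT k A n (TensorProduct.map ((actT k H A n) ∘ₗ (TensorProduct.mk k H (⨂[k]^n A)).flip α)
        ((Algebra.lsmul k k A : H →ₐ[k] Module.End k A).toLinearMap.flip a)
        (Coalgebra.comul (R := k) h)) by
    rw [hm, hh]
    simp
  intro h
  obtain ⟨d, ν, c, j, hc, rfl⟩ := exists_isCoeff_comul (k := k) h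
  have hcounit : ∀ j, ∑ l, Coalgebra.counit (R := k) (ν l) • c j l = ν j := fun m => by
    have := congrArg (TensorProduct.rid k H) (congrArg
      ((Coalgebra.counit (R := k)).lTensor H) (hc.coact m))
    simpa using this.symm
  induction n generalizing j with
  | zero =>
    rw [snocT_zero, actT_consT (hc.coact j), hc.coact j]
    simp only [map_sum, TensorProduct.map_tmul, LinearMap.comp_apply, LinearMap.flip_apply,
      TensorProduct.mk_apply, actT_zero, snocT_zero, TensorProduct.tmul_smul, map_smul,
      AlgHom.toLinearMap_apply, Algebra.lsmul_coe, ← TensorProduct.smul_tmul']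
    conv_rhs => simp only [hc.counit, ite_smul, one_smul, zero_smul, Finset.sum_ite_eq,
      Finset.mem_univ, if_true]
    conv_rhs => rw [← hcounit j]
    simp only [Finset.sum_smul, map_sum, smul_assoc, map_smul]
  | succ n ih =>
    induction α using cons_induction with
    | add x y hx hy =>
      simp only [TensorProduct.tmul_add, TensorProduct.add_tmul, map_add, hx, hy,
        LinearMap.comp_add,
        TensorProduct.map_add_left, LinearMap.add_apply]
    | cons v α =>
      rw [snocT_consT, actT_consT (hc.coact j), hc.coact j]
      simp only [ih, hc.coact, map_sum, TensorProduct.map_tmul, LinearMap.comp_apply,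
        LinearMap.flip_apply, TensorProduct.mk_apply, TensorProduct.tmul_sum,
        AlgHom.toLinearMap_apply, Algebra.lsmul_coe, actT_consT (hc.comul _ _),
        TensorProduct.sum_tmul, snocT_consT]
      exact Finset.sum_comm

theorem actT_consT_zero (h : H) (a : A) (α : ⨂[k]^0 A) :
    actT k H A (0 + 1) (h ⊗ₜ consT k A 0 (a ⊗ₜ α)) = consT k A 0 ((h • a) ⊗ₜ α) := by
  obtain ⟨d, ν, c, j, hc, rfl⟩ := exists_isCoeff_comul (k := k) h
  have hcounit : ∑ l, Coalgebra.counit (R := k) (ν l) • c j l = ν j := by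
    have := congrArg (TensorProduct.rid k H) (congrArg
      ((Coalgebra.counit (R := k)).lTensor H) (hc.coact j))
    simpa using this.symm
  rw [actT_consT (hc.coact j)]
  conv_rhs => rw [← hcounit]
  simp only [actT_zero, TensorProduct.tmul_smul, Finset.sum_smul, TensorProduct.sum_tmul, map_sum,
    smul_assoc, TensorProduct.smul_tmul']

theorem actT_joinT {ι : Type*} {s : Finset ι} {x y : ι → H} {h : H}
    (hh : Coalgebra.comul (R := k) h = ∑ i ∈ s, x i ⊗ₜ y i) {n p N : ℕ} (e : n + p = N)
    (α : ⨂[k]^n A) (β : ⨂[k]^p A) :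
    actT k H A N (h ⊗ₜ joinT k A e (α ⊗ₜ β)) =
      ∑ i ∈ s, joinT k A e (actT k H A n (x i ⊗ₜ α) ⊗ₜ actT k H A p (y i ⊗ₜ β)) := by
  suffices hm : ∀ h : H, actT k H A N (h ⊗ₜ joinT k A e (α ⊗ₜ β)) =
      joinT k A e (TensorProduct.map ((actT k H A n) ∘ₗ (TensorProduct.mk k H (⨂[k]^n A)).flip α)
        ((actT k H A p) ∘ₗ (TensorProduct.mk k H (⨂[k]^p A)).flip β)
        (Coalgebra.comul (R := k) h)) by
    rw [hm, hh]
    simp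
  clear hh
  induction n generalizing N with
  | zero =>
    intro h
    obtain rfl : p = N := by omega
    induction α using seqT_induction with
    | add x y hx hy =>
      simp only [TensorProduct.tmul_add, TensorProduct.add_tmul, map_add, hx, hy,
        LinearMap.comp_add,
        TensorProduct.map_add_left, LinearMap.add_apply]
    | smul r f =>
      have hj : ∀ γ : ⨂[k]^p A, joinT k A e (seqT k 0 f ⊗ₜ γ) = γ := fun γ => by
        induction γ using seqT_induction with
        | add x y hx hy => simp only [TensorProduct.tmul_add, map_add, hx, hy]
        | smul r g => simp [joinT_seqT]
      obtain ⟨d, ν, c, j, hc, rfl⟩ := exists_isCoeff_comul (k := k) h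
      rw [hc.coact j]
      simp only [map_sum, TensorProduct.map_tmul, LinearMap.comp_apply, LinearMap.flip_apply,
        TensorProduct.mk_apply, LinearMap.smul_apply, actT_zero, hc.counit, ite_smul, one_smul,
        zero_smul, TensorProduct.ite_tmul, ← TensorProduct.smul_tmul',
        map_smul, hj, TensorProduct.tmul_smul, smul_ite, smul_zero, Finset.sum_ite_eq,
        Finset.mem_univ, if_true]
  | succ n ih =>
    intro h
    obtain ⟨N, rfl⟩ : ∃ N', N = N' + 1 := ⟨n + p, by omega⟩
    have e' : n + p = N := by omega
    induction α using cons_induction with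
    | add x y hx hy =>
      simp only [TensorProduct.tmul_add, TensorProduct.add_tmul, map_add, hx, hy,
        LinearMap.comp_add,
        TensorProduct.map_add_left, LinearMap.add_apply]
    | cons v α =>
      obtain ⟨d, ν, c, j, hc, rfl⟩ := exists_isCoeff_comul (k := k) h
      rw [joinT_consT e', actT_consT (hc.coact j), hc.coact j]
      simp only [ih e', hc.coact, map_sum, TensorProduct.map_tmul, LinearMap.comp_apply,
        LinearMap.flip_apply, TensorProduct.mk_apply, TensorProduct.tmul_sum,
        actT_consT (hc.comul _ _), TensorProduct.sum_tmul, joinT_consT e']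
      exact Finset.sum_comm

end Module

section Algebra

variable [Ring A] [Algebra k A] [Module H A] [IsScalarTower k H A] [ModuleAlgebra k H A]

theorem smul_mul_of_comul {ι : Type*} {s : Finset ι} {x y : ι → H} {h : H}
    (hh : Coalgebra.comul (R := k) h = ∑ i ∈ s, x i ⊗ₜ y i) (a b : A) :
    h • (a * b) = ∑ i ∈ s, (x i • a) * (y i • b) := by
  rw [ModuleAlgebra.smul_mul' (k := k), hh]
  simp

theorem actT_mulHead {ι : Type*} {s : Finset ι} {x y : ι → H} {h : H}
    (hh : Coalgebra.comul (R := k) h = ∑ i ∈ s, x i ⊗ₜ y i) (n : ℕ) (a : A)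
    (α : ⨂[k]^(n + 1) A) :
    actT k H A (n + 1) (h ⊗ₜ mulHead k A n (a ⊗ₜ α)) =
      ∑ i ∈ s, mulHead k A n ((x i • a) ⊗ₜ actT k H A (n + 1) (y i ⊗ₜ α)) := by
  suffices hm : ∀ h : H, actT k H A (n + 1) (h ⊗ₜ mulHead k A n (a ⊗ₜ α)) =
      mulHead k A n (TensorProduct.map
        ((Algebra.lsmul k k A : H →ₐ[k] Module.End k A).toLinearMap.flip a)
        ((actT k H A (n + 1)) ∘ₗ (TensorProduct.mk k H (⨂[k]^(n + 1) A)).flip α)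
        (Coalgebra.comul (R := k) h)) by
    rw [hm, hh]
    simp
  intro h
  obtain ⟨d, ν, c, j, hc, rfl⟩ := exists_isCoeff_comul (k := k) h
  induction α using cons_induction with
  | add x y hx hy =>
    simp only [TensorProduct.tmul_add, map_add, hx, hy, LinearMap.comp_add,
      TensorProduct.map_add_right, LinearMap.add_apply]
  | cons v α =>
    rw [mulHead_consT, actT_consT (hc.coact j), hc.coact j]
    simp only [map_sum, TensorProduct.map_tmul, LinearMap.comp_apply, LinearMap.flip_apply,
      TensorProduct.mk_apply, AlgHom.toLinearMap_apply, Algebra.lsmul_coe,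
      actT_consT (hc.coact _), TensorProduct.tmul_sum, mulHead_consT,
      smul_mul_of_comul (hc.comul _ _), TensorProduct.sum_tmul]
    exact Finset.sum_comm

theorem actT_mulAt_zero (n : ℕ) (h : H) (α : ⨂[k]^(n + 2) A) :
    actT k H A (n + 1) (h ⊗ₜ mulAt k A n 0 α) = mulAt k A n 0 (actT k H A (n + 2) (h ⊗ₜ α)) := by
  obtain ⟨d, ν, c, j, hc, rfl⟩ := exists_isCoeff_comul (k := k) h
  induction α using cons_induction with
  | add x y hx hy => simp only [TensorProduct.tmul_add, map_add, hx, hy]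
  | cons v α =>
    rw [mulAt_zero_consT, actT_mulHead (hc.coact j), actT_consT (hc.coact j), map_sum]
    simp only [mulAt_zero_consT]

end Algebra

end Action

/-! ### The diagonal coaction on tensor powers -/

section Coaction

variable {k : Type*} [Field k] {H B : Type*} [Ring H] [HopfAlgebra k H]

/-- For a linear map `f : N ⊗ P → Q`, the map `(h ⊗ n) ⊗ (h' ⊗ p) ↦ h h' ⊗ f (n ⊗ p)`. It gives
`f` of the coaction of a tensor product of comodules. -/
def coProd {N P Q : Type*} [AddCommGroup N] [Module k N] [AddCommGroup P] [Module k P]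
    [AddCommGroup Q] [Module k Q] (f : N ⊗[k] P →ₗ[k] Q) :
    (H ⊗[k] N) ⊗[k] (H ⊗[k] P) →ₗ[k] H ⊗[k] Q :=
  TensorProduct.map (LinearMap.mul' k H) f ∘ₗ
    (TensorProduct.tensorTensorTensorComm k H N H P).toLinearMap

theorem coProd_tmul {N P Q : Type*} [AddCommGroup N] [Module k N] [AddCommGroup P] [Module k P]
    [AddCommGroup Q] [Module k Q] (f : N ⊗[k] P →ₗ[k] Q) (h h' : H) (x : N) (y : P) :
    coProd f ((h ⊗ₜ x) ⊗ₜ (h' ⊗ₜ y)) = (h * h') ⊗ₜ f (x ⊗ₜ y) := rfl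

theorem coProd_sum {N P Q : Type*} [AddCommGroup N] [Module k N] [AddCommGroup P] [Module k P]
    [AddCommGroup Q] [Module k Q] (f : N ⊗[k] P →ₗ[k] Q) {ι κ : Type*} (s : Finset ι)
    (t : Finset κ) (h : ι → H) (h' : κ → H) (x : ι → N) (y : κ → P) :
    coProd f ((∑ i ∈ s, h i ⊗ₜ x i) ⊗ₜ (∑ j ∈ t, h' j ⊗ₜ y j)) =
      ∑ i ∈ s, ∑ j ∈ t, (h i * h' j) ⊗ₜ f (x i ⊗ₜ y j) := by
  simp only [TensorProduct.sum_tmul, map_sum]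
  simp only [TensorProduct.tmul_sum, map_sum, coProd_tmul]

/-- A product of multiplicative matrices is multiplicative. -/
theorem IsCoeff.prod {J K : Type*} [Fintype J] [DecidableEq J] [Fintype K] [DecidableEq K]
    {c : J → J → H} {d : K → K → H} {N : Type*} [AddCommGroup N]
    [Module k N] {P : Type*} [AddCommGroup P]
    [Module k P] {Q : Type*} [AddCommGroup Q] [Module k Q] {ρ : N →ₗ[k] H ⊗[k] N}
    {σ : P →ₗ[k] H ⊗[k] P} {τ : Q →ₗ[k] H ⊗[k] Q}
    {ν : J → N} {μ : K → P} (hc : IsCoeff ρ ν c) (hd : IsCoeff σ μ d) (f : J × K → Q)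
    (hf : ∀ j l, τ (f (j, l)) = ∑ j', ∑ l', (c j j' * d l l') ⊗ₜ f (j', l')) :
    IsCoeff τ f fun i i' => c i.1 i'.1 * d i.2 i'.2 where
  coact i := by rw [hf, Fintype.sum_prod_type]
  comul i i' := by
    rw [Bialgebra.comul_mul, hc.comul, hd.comul, Finset.sum_mul_sum, Fintype.sum_prod_type]
    simp only [Algebra.TensorProduct.tmul_mul_tmul]
  counit i i' := by
    rw [Bialgebra.counit_mul, hc.counit, hd.counit]
    by_cases h : i.1 = i'.1 <;> by_cases h' : i.2 = i'.2 <;> simp [Prod.ext_iff, h, h']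

section Comodule

variable [AddCommGroup B] [Module k B] [LeftComodule k H B]

theorem coactT_consT_tmul {n : ℕ} (b : B) (β : ⨂[k]^n B) :
    coactT k H B (n + 1) (consT k B n (b ⊗ₜ β)) =
      coProd (consT k B n) (coact k H B b ⊗ₜ coactT k H B n β) := by
  simp [coactT, unconsT_consT, coProd]

theorem coactT_snocT_tmul {n : ℕ} (β : ⨂[k]^n B) (b : B) :
    coactT k H B (n + 1) (snocT k B n (β ⊗ₜ b)) =
      coProd (snocT k B n) (coactT k H B n β ⊗ₜ coact k H B b) := by
  induction n with
  | zero =>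
    rw [snocT_zero, coactT_consT_tmul]
    simp only [coactT, TensorProduct.mk_apply]
    induction coact k H B b with
    | zero => simp
    | add x y hx hy => simp only [TensorProduct.tmul_add, TensorProduct.add_tmul, map_add, hx, hy]
    | tmul h x => simp [coProd_tmul, snocT_zero]
  | succ n ih =>
    induction β using cons_induction with
    | add x y hx hy => simp only [TensorProduct.add_tmul, map_add, hx, hy]
    | cons v β =>
      rw [snocT_consT, coactT_consT_tmul, ih, coactT_consT_tmul]
      induction coact k H B v with
      | zero => simp
      | add x y hx hy =>
        simp only [TensorProduct.add_tmul, map_add, hx, hy]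
      | tmul h x =>
      induction coactT k H B n β with
      | zero => simp
      | add x y hx hy => simp only [TensorProduct.tmul_add, TensorProduct.add_tmul, map_add, hx, hy]
      | tmul h' x' =>
      induction coact k H B b with
      | zero => simp
      | add x y hx hy =>
        simp only [TensorProduct.tmul_add, map_add, hx, hy]
      | tmul h'' x'' => simp [coProd_tmul, snocT_consT, mul_assoc]

variable {J K : Type*} [Fintype J] [DecidableEq J] [Fintype K] [DecidableEq K] {n : ℕ}
  {ν : J → B} {c : J → J → H} {μ : K → ⨂[k]^n B} {d : K → K → H}

theorem coactT_consT (hc : IsCoeff (coact k H B) ν c) (hd : IsCoeff (coactT k H B n) μ d)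
    (j : J) (l : K) :
    coactT k H B (n + 1) (consT k B n (ν j ⊗ₜ μ l)) =
      ∑ j', ∑ l', (c j j' * d l l') ⊗ₜ consT k B n (ν j' ⊗ₜ μ l') := by
  rw [coactT_consT_tmul, hc.coact, hd.coact, coProd_sum]

theorem coactT_snocT (hc : IsCoeff (coact k H B) ν c) (hd : IsCoeff (coactT k H B n) μ d)
    (j : J) (l : K) :
    coactT k H B (n + 1) (snocT k B n (μ l ⊗ₜ ν j)) =
      ∑ l', ∑ j', (d l l' * c j j') ⊗ₜ snocT k B n (μ l' ⊗ₜ ν j') := by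
  rw [coactT_snocT_tmul, hc.coact, hd.coact, coProd_sum]

theorem exists_isCoeff_seqT (n : ℕ) (f : ℕ → B) :
    ∃ (J : Type) (_ : Fintype J) (_ : DecidableEq J) (ν : J → ⨂[k]^n B) (c : J → J → H) (j : J),
      IsCoeff (coactT k H B n) ν c ∧ ν j = seqT k n f := by
  induction n generalizing f with
  | zero =>
    refine ⟨Unit, inferInstance, inferInstance, fun _ => seqT k 0 f, fun _ _ => 1, (),
      ⟨fun _ => by simp [coactT], fun _ _ => ?_, fun _ _ => by simp⟩, rfl⟩
    simp [Algebra.TensorProduct.one_def]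
  | succ n ih =>
    obtain ⟨K, _, _, μ, d, l, hd, hl⟩ := ih fun i => f (i + 1)
    obtain ⟨m, ν, c, j, hc, hj⟩ := exists_isCoeff_coact (k := k) (H := H) (f 0)
    refine ⟨Fin m × K, inferInstance, inferInstance, fun i => consT k B n (ν i.1 ⊗ₜ μ i.2), _,
      (j, l), hc.prod hd _ fun j l => coactT_consT hc hd j l, ?_⟩
    simp only [seqT_succ, hj, hl]

theorem exists_isCoeff_coactT (n : ℕ) (β : ⨂[k]^n B) :
    ∃ (d : ℕ) (ν : Fin d → ⨂[k]^n B) (c : Fin d → Fin d → H) (j : Fin d),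
      IsCoeff (coactT k H B n) ν c ∧ ν j = β := by
  refine exists_isCoeff (coactT k H B n) (seqT_ext fun f => ?_) (seqT_ext fun f => ?_) β
  · obtain ⟨J, _, _, ν, c, j, hc, hj⟩ := exists_isCoeff_seqT (k := k) (H := H) n f
    rw [← hj]
    simp only [LinearMap.comp_apply, hc.coact, map_sum, LinearMap.rTensor_tmul, hc.comul,
      LinearMap.lTensor_tmul, TensorProduct.tmul_sum, TensorProduct.sum_tmul, LinearEquiv.coe_coe,
      TensorProduct.assoc_tmul]
    exact Finset.sum_comm
  · obtain ⟨J, _, _, ν, c, j, hc, hj⟩ := exists_isCoeff_seqT (k := k) (H := H) n f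
    rw [← hj]
    simp [hc.coact, hc.counit]

end Comodule

section Algebra

variable [Ring B] [Algebra k B] [LeftComodule k H B] [ComoduleAlgebra k H B]

theorem coact_mul_coeff {J K : Type*} [Fintype J] [DecidableEq J] [Fintype K] [DecidableEq K]
    {ν : J → B} {c : J → J → H} {μ : K → B} {d : K → K → H}
    (hc : IsCoeff (coact k H B) ν c) (hd : IsCoeff (coact k H B) μ d) (j : J) (l : K) :
    coact k H B (ν j * μ l) = ∑ j', ∑ l', (c j j' * d l l') ⊗ₜ (ν j' * μ l') := by
  simp only [ComoduleAlgebra.coact_mul, hc.coact, hd.coact, Finset.sum_mul_sum,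
    Algebra.TensorProduct.tmul_mul_tmul]

theorem coactT_mulHead_tmul (n : ℕ) (b : B) (β : ⨂[k]^(n + 1) B) :
    coactT k H B (n + 1) (mulHead k B n (b ⊗ₜ β)) =
      coProd (mulHead k B n) (coact k H B b ⊗ₜ coactT k H B (n + 1) β) := by
  induction β using cons_induction with
  | add x y hx hy => simp only [TensorProduct.tmul_add, map_add, hx, hy]
  | cons v β =>
    rw [mulHead_consT, coactT_consT_tmul, coactT_consT_tmul, ComoduleAlgebra.coact_mul]
    induction coact k H B b with
    | zero => simp
    | add x y hx hy => simp only [add_mul, TensorProduct.add_tmul, map_add, hx, hy]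
    | tmul h x =>
    induction coact k H B v with
    | zero => simp
    | add x y hx hy =>
      simp only [mul_add, TensorProduct.tmul_add, TensorProduct.add_tmul, map_add, hx, hy]
    | tmul h' x' =>
    induction coactT k H B n β with
    | zero => simp
    | add x y hx hy => simp only [TensorProduct.tmul_add, map_add, hx, hy]
    | tmul h'' x'' => simp [coProd_tmul, mulHead_consT, mul_assoc]

theorem coactT_mulHead {J K : Type*} [Fintype J] [DecidableEq J] [Fintype K] [DecidableEq K]
    {n : ℕ} {ν : J → B} {c : J → J → H} {μ : K → ⨂[k]^(n + 1) B} {d : K → K → H}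
    (hc : IsCoeff (coact k H B) ν c) (hd : IsCoeff (coactT k H B (n + 1)) μ d) (j : J) (l : K) :
    coactT k H B (n + 1) (mulHead k B n (ν j ⊗ₜ μ l)) =
      ∑ j', ∑ l', (c j j' * d l l') ⊗ₜ mulHead k B n (ν j' ⊗ₜ μ l') := by
  rw [coactT_mulHead_tmul, hc.coact, hd.coact, coProd_sum]

theorem coactT_mulAt {n i : ℕ} (hi : i ≤ n) (β : ⨂[k]^(n + 2) B) :
    coactT k H B (n + 1) (mulAt k B n i β) =
      (mulAt k B n i).lTensor H (coactT k H B (n + 2) β) := by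
  induction n generalizing i with
  | zero =>
    obtain rfl : i = 0 := by omega
    induction β using cons_induction with
    | add x y hx hy => simp only [map_add, hx, hy]
    | cons b β =>
      rw [mulAt_zero_consT, coactT_mulHead_tmul, coactT_consT_tmul]
      generalize coact k H B b = x, coactT k H B _ β = y
      induction x with
      | zero => simp
      | add x y hx hy => simp only [TensorProduct.add_tmul, map_add, hx, hy]
      | tmul x x' =>
      induction y with
      | zero => simp
      | add x y hx hy => simp only [TensorProduct.tmul_add, map_add, hx, hy]
      | tmul y y' => simp [coProd_tmul, mulAt_zero_consT]
  | succ n ih =>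
    induction β using cons_induction with
    | add x y hx hy => simp only [map_add, hx, hy]
    | cons b β =>
      cases i with
      | zero =>
        rw [mulAt_zero_consT, coactT_mulHead_tmul, coactT_consT_tmul]
        generalize coact k H B b = x, coactT k H B _ β = y
        induction x with
        | zero => simp
        | add x y hx hy => simp only [TensorProduct.add_tmul, map_add, hx, hy]
        | tmul x x' =>
        induction y with
        | zero => simp
        | add x y hx hy => simp only [TensorProduct.tmul_add, map_add, hx, hy]
        | tmul y y' => simp [coProd_tmul, mulAt_zero_consT]
      | succ i =>
        rw [mulAt_succ_consT, coactT_consT_tmul, coactT_consT_tmul, ih (by omega)]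
        generalize coact k H B b = x, coactT k H B _ β = y
        induction x with
        | zero => simp
        | add x y hx hy => simp only [TensorProduct.add_tmul, map_add, hx, hy]
        | tmul x x' =>
        induction y with
        | zero => simp
        | add x y hx hy => simp only [TensorProduct.tmul_add, map_add, hx, hy]
        | tmul y y' => simp [coProd_tmul, mulAt_succ_consT]

end Algebra

end Coaction

/-! ### The twisting map -/

section Twist

variable {k : Type*} [Field k] {H A B : Type*} [Ring H] [HopfAlgebra k H]
  [Ring A] [Algebra k A] [Module H A] [IsScalarTower k H A]
  [Ring B] [Algebra k B] [LeftComodule k H B]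

@[elab_as_elim]
theorem CrossedProduct.mk_induction {P : CrossedProduct k H A B → Prop}
    (x : CrossedProduct k H A B) (zero : P 0) (mk : ∀ a b, P (CrossedProduct.mk k H A B a b))
    (add : ∀ x y, P x → P y → P (x + y)) : P x := by
  obtain ⟨t, rfl⟩ := (CrossedProduct.equiv k H A B).surjective x
  induction t with
  | zero => simpa using zero
  | add x y hx hy =>
    rw [map_add]
    exact add _ _ hx hy
  | tmul a b => exact mk a b

theorem CrossedProduct.mk_mul_mk {ι : Type*} {s : Finset ι} {x : ι → H} {y : ι → B} {b : B}
    (hb : coact k H B b = ∑ i ∈ s, x i ⊗ₜ y i) (a a' : A) (b' : B) :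
    CrossedProduct.mk k H A B a b * CrossedProduct.mk k H A B a' b' =
      ∑ i ∈ s, CrossedProduct.mk k H A B (a * (x i • a')) (y i * b') := by
  refine (congrArg (CrossedProduct.equiv k H A B) (crossedMul_tmul a a' b b')).trans ?_
  rw [hb, map_sum, map_sum]
  rfl

variable [InvertibleAntipode k H]

theorem lactInv_tmul (h : H) (a : A) : lactInv k H A (h ⊗ₜ a) = antipodeInv k H h • a := rfl

variable (k H) in
/-- Adding a first factor `a ⋊ b` to the twisting map: with `γ = b ⊗ β`,
`α ⊗ β ↦ (S⁻¹(γ₍₋₁₎) a ⊗ α) ⊗ γ₍₀₎`. -/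
def headTwist (n : ℕ) (a : A) (b : B) :
    (⨂[k]^n A) ⊗[k] (⨂[k]^n B) →ₗ[k] (⨂[k]^(n + 1) A) ⊗[k] (⨂[k]^(n + 1) B) :=
  (consT k A n ∘ₗ (lactInv k H A).rTensor (⨂[k]^n A) ∘ₗ
      (TensorProduct.assoc k H A (⨂[k]^n A)).symm.toLinearMap ∘ₗ
      (TensorProduct.comm k (A ⊗[k] (⨂[k]^n A)) H).toLinearMap).rTensor (⨂[k]^(n + 1) B) ∘ₗ
    (TensorProduct.assoc k (A ⊗[k] (⨂[k]^n A)) H (⨂[k]^(n + 1) B)).symm.toLinearMap ∘ₗ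
    (coactT k H B (n + 1) ∘ₗ consT k B n).lTensor (A ⊗[k] (⨂[k]^n A)) ∘ₗ
    (TensorProduct.tensorTensorTensorComm k A B (⨂[k]^n A) (⨂[k]^n B)).toLinearMap ∘ₗ
    TensorProduct.mk k (A ⊗[k] B) _ (a ⊗ₜ b)

theorem headTwist_tmul {ι : Type*} {s : Finset ι} {n : ℕ} {x : ι → H} {y : ι → ⨂[k]^(n + 1) B}
    {b : B} {β : ⨂[k]^n B}
    (hb : coactT k H B (n + 1) (consT k B n (b ⊗ₜ β)) = ∑ i ∈ s, x i ⊗ₜ y i) (a : A)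
    (α : ⨂[k]^n A) :
    headTwist k H n a b (α ⊗ₜ β) =
      ∑ i ∈ s, consT k A n ((antipodeInv k H (x i) • a) ⊗ₜ α) ⊗ₜ y i := by
  simp only [headTwist, LinearMap.comp_apply, TensorProduct.mk_apply, LinearEquiv.coe_coe,
    TensorProduct.tensorTensorTensorComm_tmul, LinearMap.lTensor_tmul, hb,
    TensorProduct.tmul_sum, map_sum, TensorProduct.assoc_symm_tmul, LinearMap.rTensor_tmul,
    TensorProduct.comm_tmul, lactInv_tmul]

theorem twist_consT (n : ℕ) (a : A) (b : B) (r : ⨂[k]^n (CrossedProduct k H A B)) :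
    twist k H A B (n + 1) (consT k _ n (CrossedProduct.mk k H A B a b ⊗ₜ r)) =
      headTwist k H n a b (twist k H A B n r) := by
  rw [twist]
  simp only [LinearMap.comp_apply, unconsT_consT, TensorProduct.map_tmul]
  rfl

variable (k H) in
/-- Adding a last factor `a ⋊ b` to the twisting map:
`α ⊗ β ↦ S⁻¹(b₍₋₁₎) (α ⊗ a) ⊗ (β ⊗ b₍₀₎)`, where `H` acts diagonally on the tensor power of `A`. -/
def lastTwist (n : ℕ) (a : A) (b : B) :
    (⨂[k]^n A) ⊗[k] (⨂[k]^n B) →ₗ[k] (⨂[k]^(n + 1) A) ⊗[k] (⨂[k]^(n + 1) B) :=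
  TensorProduct.homTensorHomMap (.id k) (⨂[k]^n A) (⨂[k]^n B) (⨂[k]^(n + 1) A) (⨂[k]^(n + 1) B)
    (TensorProduct.map
      (LinearMap.lcomp k (⨂[k]^(n + 1) A) (snocT k A n ∘ₗ (TensorProduct.mk k _ A).flip a) ∘ₗ
        TensorProduct.curry (actT k H A (n + 1)) ∘ₗ antipodeInv k H)
      (TensorProduct.curry (snocT k B n)).flip (coact k H B b))

theorem lastTwist_tmul {ι : Type*} {s : Finset ι} {n : ℕ} {x : ι → H} {y : ι → B} {b : B}
    (hb : coact k H B b = ∑ i ∈ s, x i ⊗ₜ y i) (a : A) (α : ⨂[k]^n A) (β : ⨂[k]^n B) :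
    lastTwist k H n a b (α ⊗ₜ β) =
      ∑ i ∈ s, actT k H A (n + 1) (antipodeInv k H (x i) ⊗ₜ snocT k A n (α ⊗ₜ a)) ⊗ₜ
        snocT k B n (β ⊗ₜ y i) := by
  simp only [lastTwist, hb, map_sum, LinearMap.sum_apply]
  rfl

theorem headTwist_lastTwist (n : ℕ) (a a₀ : A) (b b₀ : B)
    (t : (⨂[k]^n A) ⊗[k] (⨂[k]^n B)) :
    headTwist k H (n + 1) a₀ b₀ (lastTwist k H n a b t) =
      lastTwist k H (n + 1) a b (headTwist k H n a₀ b₀ t) := by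
  induction t with
  | zero => simp only [map_zero]
  | add x y hx hy => simp only [map_add, hx, hy]
  | tmul α β =>
    obtain ⟨p, ν, c, j, hc, rfl⟩ := exists_isCoeff_coact (k := k) (H := H) b
    obtain ⟨q, μ, d, l, hd, hl⟩ := exists_isCoeff_coactT (k := k) (H := H) (n + 1)
      (consT k B n (b₀ ⊗ₜ β))
    have hhead : ∀ (α' : ⨂[k]^(n + 1) A) (i : Fin p),
        headTwist k H (n + 1) a₀ b₀ (α' ⊗ₜ snocT k B n (β ⊗ₜ ν i)) =
          ∑ l', ∑ i', consT k A (n + 1) ((antipodeInv k H (d l l' * c i i') • a₀) ⊗ₜ α') ⊗ₜ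
            snocT k B (n + 1) (μ l' ⊗ₜ ν i') := by
      intro α' i
      rw [headTwist_tmul (s := Finset.univ) (x := fun z : Fin q × Fin p => d l z.1 * c i z.2)
        (y := fun z => snocT k B (n + 1) (μ z.1 ⊗ₜ ν z.2))]
      · rw [Fintype.sum_prod_type]
      · rw [← snocT_consT, ← hl, coactT_snocT hc hd, Fintype.sum_prod_type]
    rw [lastTwist_tmul (hc.coact j), headTwist_tmul (by rw [← hl]; exact hd.coact l), map_sum,
      map_sum]
    simp only [hhead, lastTwist_tmul (hc.coact j), snocT_consT,
      actT_consT (hc.comul_antipodeInv _ _),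
      TensorProduct.sum_tmul, antipodeInv_mul, mul_smul]
    rw [Finset.sum_comm]
    exact Finset.sum_congr rfl fun l' _ => Finset.sum_comm

/-- The twisting map is built by moving each `a` to the left past all the `b` before and at it; it
may therefore also be computed by adding factors at the end. -/
theorem twist_snocT (n : ℕ) (a : A) (b : B) (r : ⨂[k]^n (CrossedProduct k H A B)) :
    twist k H A B (n + 1) (snocT k _ n (r ⊗ₜ CrossedProduct.mk k H A B a b)) =
      lastTwist k H n a b (twist k H A B n r) := by
  induction n with
  | zero =>
    rw [snocT_zero, twist_consT]
    induction twist k H A B 0 r with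
    | zero => simp only [map_zero]
    | add x y hx hy => simp only [map_add, hx, hy]
    | tmul α β =>
      obtain ⟨p, ν, c, j, hc, rfl⟩ := exists_isCoeff_coact (k := k) (H := H) b
      rw [lastTwist_tmul (hc.coact j), headTwist_tmul (s := Finset.univ) (x := fun i => c j i)
        (y := fun i => consT k B 0 (ν i ⊗ₜ β))]
      · simp only [snocT_zero, actT_consT_zero]
      · rw [coactT_consT_tmul, hc.coact, TensorProduct.sum_tmul, map_sum]
        simp only [coactT, TensorProduct.mk_apply, coProd_tmul, mul_one]
  | succ n ih =>
    induction r using cons_induction with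
    | add x y hx hy => simp only [TensorProduct.add_tmul, map_add, hx, hy]
    | cons v r =>
      induction v using CrossedProduct.mk_induction with
      | zero => simp only [TensorProduct.zero_tmul, map_zero]
      | add x y hx hy => simp only [TensorProduct.add_tmul, map_add, hx, hy]
      | mk a₀ b₀ => rw [snocT_consT, twist_consT, ih, twist_consT, headTwist_lastTwist]

variable [ModuleAlgebra k H A] [ComoduleAlgebra k H B]

theorem map_mulAt_zero_headTwist (n : ℕ) (a a' : A) (b b' : B)
    (t : (⨂[k]^n A) ⊗[k] (⨂[k]^n B)) {p : ℕ} {ν : Fin p → B} {c : Fin p → Fin p → H} {j : Fin p}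
    (hc : IsCoeff (coact k H B) ν c) (hj : ν j = b) :
    TensorProduct.map (mulAt k A n 0) (mulAt k B n 0)
        (headTwist k H (n + 1) a b (headTwist k H n a' b' t)) =
      ∑ i, headTwist k H n (a * (c j i • a')) (ν i * b') t := by
  subst hj
  induction t with
  | zero => simp only [map_zero, Finset.sum_const_zero]
  | add x y hx hy => simp only [map_add, hx, hy, Finset.sum_add_distrib]
  | tmul α β =>
    obtain ⟨q, μ, d, l, hd, hl⟩ := exists_isCoeff_coactT (k := k) (H := H) (n + 1)
      (consT k B n (b' ⊗ₜ β))
    have hcd := hc.prod hd (τ := coactT k H B (n + 2))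
      (fun z => consT k B (n + 1) (ν z.1 ⊗ₜ μ z.2)) fun j l => coactT_consT hc hd j l
    have h1 : ∀ (α' : ⨂[k]^(n + 1) A) (m : Fin q), headTwist k H (n + 1) a (ν j) (α' ⊗ₜ μ m) =
        ∑ z : Fin p × Fin q, consT k A (n + 1) ((antipodeInv k H (c j z.1 * d m z.2) • a) ⊗ₜ α') ⊗ₜ
          consT k B (n + 1) (ν z.1 ⊗ₜ μ z.2) := fun α' m => headTwist_tmul (hcd.coact (j, m)) a α'
    have h2 : ∀ (a'' : A) (i : Fin p), headTwist k H n a'' (ν i * b') (α ⊗ₜ β) =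
        ∑ z : Fin p × Fin q, consT k A n ((antipodeInv k H (c i z.1 * d l z.2) • a'') ⊗ₜ α) ⊗ₜ
          mulHead k B n (ν z.1 ⊗ₜ μ z.2) := by
      intro a'' i
      refine headTwist_tmul ?_ a'' α
      rw [← mulHead_consT, ← hl, coactT_mulHead hc hd, Fintype.sum_prod_type]
    rw [headTwist_tmul (by rw [← hl]; exact hd.coact l)]
    simp only [map_sum, h1, h2, TensorProduct.map_tmul, mulAt_zero_consT, mulHead_consT]
    rw [Finset.sum_comm, Finset.sum_comm (γ := Fin p)]
    refine Finset.sum_congr rfl fun z _ => ?_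
    simp only [← TensorProduct.sum_tmul, ← map_sum]
    congr 3
    -- `S⁻¹(b₍₋₂₎) b₍₋₃₎` cancels.
    have h3 : ∀ i, antipodeInv k H (c i z.1 * d l z.2) • (a * (c j i • a')) =
        ∑ m, ∑ w, (antipodeInv k H (c m z.1 * d w z.2) • a) *
          (antipodeInv k H (d l w) • (antipodeInv k H (c i m) * c j i) • a') := by
      intro i
      rw [smul_mul_of_comul (hcd.comul_antipodeInv (i, l) z), Fintype.sum_prod_type]
      simp only [antipodeInv_mul, mul_smul]
    simp only [h3]
    rw [Finset.sum_comm]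
    have h4 : ∀ m w, ∑ i, (antipodeInv k H (c m z.1 * d w z.2) • a) *
          (antipodeInv k H (d l w) • (antipodeInv k H (c i m) * c j i) • a') =
        if j = m then (antipodeInv k H (c m z.1 * d w z.2) • a) * (antipodeInv k H (d l w) • a')
          else 0 := by
      intro m w
      rw [← Finset.mul_sum, ← Finset.smul_sum, ← Finset.sum_smul]
      rw [hc.antipodeInv_mul_self j m]
      split_ifs <;> simp
    rw [Finset.sum_congr rfl fun m _ => Finset.sum_comm]
    simp only [h4]
    rw [Finset.sum_comm]
    simp only [Finset.sum_ite_eq, Finset.mem_univ, if_true]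

theorem twist_mulHead (n : ℕ) (v : CrossedProduct k H A B)
    (x : ⨂[k]^(n + 1) (CrossedProduct k H A B)) :
    twist k H A B (n + 1) (mulHead k (CrossedProduct k H A B) n (v ⊗ₜ x)) =
      TensorProduct.map (mulAt k A n 0) (mulAt k B n 0)
        (twist k H A B (n + 2) (consT k _ (n + 1) (v ⊗ₜ x))) := by
  induction x using cons_induction with
  | add x y hx hy => simp only [TensorProduct.tmul_add, map_add, hx, hy]
  | cons w r =>
    induction v using CrossedProduct.mk_induction with
    | zero => simp only [TensorProduct.zero_tmul, map_zero]
    | add x y hx hy => simp only [TensorProduct.add_tmul, map_add, hx, hy]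
    | mk a b =>
    induction w using CrossedProduct.mk_induction with
    | zero => simp only [TensorProduct.zero_tmul, TensorProduct.tmul_zero, map_zero]
    | add x y hx hy => simp only [TensorProduct.add_tmul, TensorProduct.tmul_add, map_add, hx, hy]
    | mk a' b' =>
      obtain ⟨p, ν, c, j, hc, hj⟩ := exists_isCoeff_coact (k := k) (H := H) b
      rw [mulHead_consT, twist_consT, twist_consT, map_mulAt_zero_headTwist n a a' b b' _ hc hj,
        CrossedProduct.mk_mul_mk (hj ▸ hc.coact j)]
      simp only [TensorProduct.sum_tmul, map_sum, twist_consT]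

theorem twist_mulAt_zero (n : ℕ) (x : ⨂[k]^(n + 2) (CrossedProduct k H A B)) :
    twist k H A B (n + 1) (mulAt k (CrossedProduct k H A B) n 0 x) =
      TensorProduct.map (mulAt k A n 0) (mulAt k B n 0) (twist k H A B (n + 2) x) := by
  induction x using cons_induction with
  | add x y hx hy => simp only [map_add, hx, hy]
  | cons v x => rw [mulAt_zero_consT, twist_mulHead]

omit [ModuleAlgebra k H A] in
theorem map_mulAt_succ_headTwist {n i : ℕ} (hi : i ≤ n) (a : A) (b : B)
    (t : (⨂[k]^(n + 2) A) ⊗[k] (⨂[k]^(n + 2) B)) :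
    TensorProduct.map (mulAt k A (n + 1) (i + 1)) (mulAt k B (n + 1) (i + 1))
        (headTwist k H (n + 2) a b t) =
      headTwist k H (n + 1) a b (TensorProduct.map (mulAt k A n i) (mulAt k B n i) t) := by
  induction t with
  | zero => simp only [map_zero]
  | add x y hx hy => simp only [map_add, hx, hy]
  | tmul α β =>
    obtain ⟨q, μ, d, l, hd, hl⟩ := exists_isCoeff_coactT (k := k) (H := H) (n + 3)
      (consT k B (n + 2) (b ⊗ₜ β))
    have h1 : coactT k H B (n + 2) (consT k B (n + 1) (b ⊗ₜ mulAt k B n i β)) =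
        ∑ m, d l m ⊗ₜ mulAt k B (n + 1) (i + 1) (μ m) := by
      rw [← mulAt_succ_consT, coactT_mulAt (by omega), ← hl, hd.coact, map_sum]
      simp only [LinearMap.lTensor_tmul]
    rw [headTwist_tmul (by rw [← hl]; exact hd.coact l), TensorProduct.map_tmul,
      headTwist_tmul h1, map_sum]
    simp only [TensorProduct.map_tmul, mulAt_succ_consT]

/-- The twisting map is compatible with merging adjacent factors. -/
theorem twist_mulAt {n i : ℕ} (hi : i ≤ n) (x : ⨂[k]^(n + 2) (CrossedProduct k H A B)) :
    twist k H A B (n + 1) (mulAt k (CrossedProduct k H A B) n i x) =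
      TensorProduct.map (mulAt k A n i) (mulAt k B n i) (twist k H A B (n + 2) x) := by
  induction n generalizing i with
  | zero =>
    obtain rfl : i = 0 := by omega
    exact twist_mulAt_zero 0 x
  | succ n ih =>
    cases i with
    | zero => exact twist_mulAt_zero (n + 1) x
    | succ i =>
      induction x using cons_induction with
      | add x y hx hy => simp only [map_add, hx, hy]
      | cons v x =>
        induction v using CrossedProduct.mk_induction with
        | zero => simp only [TensorProduct.zero_tmul, map_zero]
        | add x y hx hy => simp only [TensorProduct.add_tmul, map_add, hx, hy]
        | mk a b =>
          rw [mulAt_succ_consT, twist_consT, twist_consT, ih (by omega),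
            map_mulAt_succ_headTwist (by omega)]

end Twist

/-! ### Balanced cochains and colinear cochains -/

section AntiYetterDrinfeld

variable {k : Type*} [Field k] {H M : Type*} [Ring H] [HopfAlgebra k H]
  [AddCommGroup M] [Module k M] [Module Hᵐᵒᵖ M] [IsScalarTower k Hᵐᵒᵖ M]
  [LeftComodule k H M] [SAYD k H M]

/-- The anti-Yetter-Drinfeld compatibility for an entry of a column `g` of coefficients. -/
theorem coact_rightMul {J : Type*} [Fintype J] {c : J → J → H} {g : J → H}
    (hg : ∀ j, Coalgebra.comul (R := k) (g j) = ∑ l, c j l ⊗ₜ g l)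
    {ι : Type*} {s : Finset ι} {x : ι → H} {y : ι → M} {m : M}
    (hm : coact k H M m = ∑ i ∈ s, x i ⊗ₜ y i) (j : J) :
    coact k H M (rightMul k H M (g j) m) =
      ∑ z ∈ s ×ˢ (Finset.univ : Finset (J × J)),
        (HopfAlgebra.antipode k (g z.2.2) * x z.1 * c j z.2.1) ⊗ₜ
          rightMul k H M (c z.2.1 z.2.2) (y z.1) := by
  rw [SAYD.coact_act, hg, hm, Finset.sum_product]
  simp only [map_sum, LinearMap.lTensor_tmul, hg, TensorProduct.tmul_sum, LinearMap.sum_apply,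
    Fintype.sum_prod_type]
  rfl

end AntiYetterDrinfeld

section Balanced

variable {k : Type*} [Field k] {H A M : Type*} [Ring H] [HopfAlgebra k H]
  [Ring A] [Algebra k A] [Module H A] [IsScalarTower k H A]
  [AddCommGroup M] [Module k M] [Module Hᵐᵒᵖ M] [IsScalarTower k Hᵐᵒᵖ M]

variable (H) in
/-- `φ(m h ⊗ ã) = φ(m ⊗ h ã)`: the form in which the equivariance of a cochain is used. -/
def IsBalanced {n : ℕ} (φ : M ⊗[k] (⨂[k]^n A) →ₗ[k] k) : Prop :=
  ∀ (h : H) (m : M) (α : ⨂[k]^n A),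
    φ (rightMul k H M h m ⊗ₜ α) = φ (m ⊗ₜ actT k H A n (h ⊗ₜ α))

/-- `φ(m h ⊗ ã) = φ(m h₁ ⊗ S(h₂) h₃ ã) = φ(m ⊗ h ã)`. -/
theorem isBalanced_of_mem {n : ℕ} {φ : CochainA k A M n}
    (hφ : φ ∈ equivariantCochains k H A M n) : IsBalanced H φ := by
  intro h m α
  obtain ⟨p, ν, c, j, hc, rfl⟩ := exists_isCoeff_comul (k := k) h
  have hcounit : ν j = ∑ l, Coalgebra.counit (R := k) (ν l) • c j l := by
    have := congrArg (TensorProduct.rid k H) (congrArg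
      ((Coalgebra.counit (R := k)).lTensor H) (hc.coact j))
    simpa using this
  have hanti : ∀ l, ∑ q, HopfAlgebra.antipode k (c l q) * ν q =
      Coalgebra.counit (R := k) (ν l) • (1 : H) := by
    intro l
    have h := HopfAlgebra.mul_antipode_rTensor_comul_apply (R := k) (ν l)
    rw [hc.coact] at h
    simpa [Algebra.algebraMap_eq_smul_one] using h
  have hmem : ∀ (q : Fin p) (x : ⨂[k]^(n + 1) A),
      ∑ l, φ (rightMul k H M (c j l) m ⊗ₜ
        actT k H A (n + 1) (HopfAlgebra.antipode k (c l q) ⊗ₜ x)) =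
      (if j = q then 1 else 0) * φ (m ⊗ₜ x) := by
    intro q x
    have h := hφ (c j q) (m ⊗ₜ x)
    rw [hc.counit] at h
    rw [← h, diagAct, LinearMap.comp_apply, LinearMap.comp_apply, hc.comul]
    simp only [map_sum, LinearMap.sum_apply]
    rfl
  have hone : ∀ l, Coalgebra.counit (R := k) (ν l) • α =
      ∑ q, actT k H A (n + 1) (HopfAlgebra.antipode k (c l q) ⊗ₜ actT k H A (n + 1)
          (ν q ⊗ₜ α)) := by
    intro l
    simp only [← actT_mul, ← map_sum, ← TensorProduct.sum_tmul, hanti, ← TensorProduct.smul_tmul',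
      map_smul, actT_one]
  calc φ (rightMul k H M (ν j) m ⊗ₜ α)
      = ∑ l, φ (rightMul k H M (c j l) m ⊗ₜ (Coalgebra.counit (R := k) (ν l) • α)) := by
        conv_lhs => rw [hcounit]
        simp only [map_sum, map_smul, LinearMap.sum_apply, LinearMap.smul_apply,
          TensorProduct.sum_tmul, TensorProduct.smul_tmul]
    _ = ∑ q, ∑ l, φ (rightMul k H M (c j l) m ⊗ₜ actT k H A (n + 1)
          (HopfAlgebra.antipode k (c l q) ⊗ₜ actT k H A (n + 1) (ν q ⊗ₜ α))) := by
        simp only [hone, TensorProduct.tmul_sum, map_sum]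
        exact Finset.sum_comm
    _ = φ (m ⊗ₜ actT k H A (n + 1) (ν j ⊗ₜ α)) := by
        simp only [hmem, ite_mul, one_mul, zero_mul, Finset.sum_ite_eq, Finset.mem_univ, if_true]

variable [InvertibleAntipode k H] [LeftComodule k H M]

omit [Module Hᵐᵒᵖ M] [IsScalarTower k Hᵐᵒᵖ M] in
theorem faceA_apply {n i : ℕ} (hi : i ≤ n) (φ : CochainA k A M n) (m : M)
    (α : ⨂[k]^(n + 2) A) : faceA k H A M n i φ (m ⊗ₜ α) = φ (m ⊗ₜ mulAt k A n i α) := by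
  rw [faceA, if_pos hi]
  rfl

omit [Module Hᵐᵒᵖ M] [IsScalarTower k Hᵐᵒᵖ M] in
theorem faceA_last {ι : Type*} {s : Finset ι} {x : ι → H} {y : ι → M} {m : M}
    (hm : coact k H M m = ∑ i ∈ s, x i ⊗ₜ y i) {n : ℕ} (φ : CochainA k A M n)
    (α : ⨂[k]^(n + 1) A) (a : A) :
    faceA k H A M n (n + 1) φ (m ⊗ₜ snocT k A (n + 1) (α ⊗ₜ a)) =
      ∑ i ∈ s, φ (y i ⊗ₜ mulHead k A n ((antipodeInv k H (x i) • a) ⊗ₜ α)) := by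
  rw [faceA, if_neg (by omega)]
  simp only [lastA, LinearMap.lcomp_apply', LinearMap.comp_apply, TensorProduct.map_tmul,
    rotT_snocT, unconsT_consT, hm, map_sum, LinearEquiv.coe_coe, TensorProduct.comm_tmul,
    TensorProduct.sum_tmul, TensorProduct.assoc_tmul, LinearMap.lTensor_tmul,
    TensorProduct.assoc_symm_tmul, LinearMap.rTensor_tmul, lactInv_tmul]

variable [SAYD k H M]

variable [ModuleAlgebra k H A]

omit [SAYD k H M] in
theorem IsBalanced.faceA_zero {n : ℕ} {φ : CochainA k A M n} (hφ : IsBalanced H φ) :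
    IsBalanced H (faceA k H A M n 0 φ) := by
  intro h m α
  rw [faceA_apply (Nat.zero_le n), faceA_apply (Nat.zero_le n), hφ, actT_mulAt_zero]

theorem IsBalanced.faceA_last {n : ℕ} {φ : CochainA k A M n} (hφ : IsBalanced H φ) :
    IsBalanced H (faceA k H A M n (n + 1) φ) := by
  intro h m α
  induction α using snoc_induction with
  | add x y hx hy => simp only [TensorProduct.tmul_add, map_add, hx, hy]
  | snoc α a =>
    obtain ⟨p, ν, c, j, hc, rfl⟩ := exists_isCoeff_comul (k := k) h
    obtain ⟨q, μ, e, l, he, rfl⟩ := exists_isCoeff_coact (k := k) (H := H) m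
    have h1 := coact_rightMul (fun j => hc.coact j) (he.coact l) j
    rw [HopfCup.faceA_last h1, actT_snocT (hc.coact j)]
    simp only [Finset.sum_product, Fintype.sum_prod_type, TensorProduct.tmul_sum, map_sum,
      HopfCup.faceA_last (he.coact l)]
    rw [Finset.sum_comm_cycle]
    refine Finset.sum_congr rfl fun r _ => ?_
    refine Finset.sum_congr rfl fun i _ => ?_
    have h2 : ∀ w, φ (rightMul k H M (c w r) (μ i) ⊗ₜ mulHead k A n
        ((antipodeInv k H (HopfAlgebra.antipode k (ν r) * e l i * c j w) • a) ⊗ₜ α)) =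
        ∑ z, φ (μ i ⊗ₜ mulHead k A n (((c w z * antipodeInv k H (c j w)) •
          (antipodeInv k H (e l i) * ν r) • a) ⊗ₜ actT k H A (n + 1) (c z r ⊗ₜ α))) := by
      intro w
      rw [hφ, actT_mulHead (hc.comul w r)]
      simp only [TensorProduct.tmul_sum, map_sum, antipodeInv_mul, antipodeInv_antipode, mul_smul]
    simp only [h2]
    rw [Finset.sum_comm]
    have h3 : ∀ z, ∑ w, φ (μ i ⊗ₜ mulHead k A n (((c w z * antipodeInv k H (c j w)) •
          (antipodeInv k H (e l i) * ν r) • a) ⊗ₜ actT k H A (n + 1) (c z r ⊗ₜ α))) =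
        if j = z then φ (μ i ⊗ₜ mulHead k A n (((antipodeInv k H (e l i) * ν r) • a) ⊗ₜ
          actT k H A (n + 1) (c z r ⊗ₜ α))) else 0 := by
      intro z
      simp only [← map_sum, ← TensorProduct.tmul_sum, ← TensorProduct.sum_tmul, ← Finset.sum_smul]
      rw [hc.mul_antipodeInv_self j z]
      split_ifs <;> simp
    simp only [h3, Finset.sum_ite_eq, Finset.mem_univ, if_true]
    rw [mul_smul]

end Balanced

section Colinear

variable {k : Type*} [Field k] {H B M : Type*} [Ring H] [HopfAlgebra k H]
  [Ring B] [Algebra k B] [LeftComodule k H B]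
  [AddCommGroup M] [Module k M] [Module Hᵐᵒᵖ M] [IsScalarTower k Hᵐᵒᵖ M] [LeftComodule k H M]

omit [LeftComodule k H M] in
theorem faceB_apply {n i : ℕ} (hi : i ≤ n) (ψ : CochainB k B M n) (β : ⨂[k]^(n + 2) B) :
    faceB k H B M n i ψ β = ψ (mulAt k B n i β) := by
  rw [faceB, if_pos hi]
  rfl

omit [LeftComodule k H M] in
theorem faceB_last {ι : Type*} {s : Finset ι} {x : ι → H} {y : ι → B} {b : B}
    (hb : coact k H B b = ∑ i ∈ s, x i ⊗ₜ y i) {n : ℕ} (ψ : CochainB k B M n)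
    (β : ⨂[k]^(n + 1) B) :
    faceB k H B M n (n + 1) ψ (snocT k B (n + 1) (β ⊗ₜ b)) =
      ∑ i ∈ s, rightMul k H M (x i) (ψ (mulHead k B n (y i ⊗ₜ β))) := by
  rw [faceB, if_neg (by omega)]
  simp only [lastB, LinearMap.comp_apply, LinearMap.lcomp_apply', LinearMap.llcomp_apply,
    rotT_snocT, unconsT_consT, LinearMap.rTensor_tmul, hb, TensorProduct.sum_tmul, map_sum,
    LinearEquiv.coe_coe, TensorProduct.assoc_tmul, LinearMap.lTensor_tmul]
  rfl

omit [Module Hᵐᵒᵖ M] [IsScalarTower k Hᵐᵒᵖ M] in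
theorem coact_of_mem {n : ℕ} {ψ : CochainB k B M n} (hψ : ψ ∈ colinearCochains k H B M n)
    (β : ⨂[k]^(n + 1) B) : coact k H M (ψ β) = ψ.lTensor H (coactT k H B (n + 1) β) :=
  LinearMap.congr_fun (show coact k H M ∘ₗ ψ = ψ.lTensor H ∘ₗ coactT k H B (n + 1) from hψ) β

theorem faceB_last_mem [ComoduleAlgebra k H B] [SAYD k H M] {n : ℕ} {ψ : CochainB k B M n}
    (hψ : ψ ∈ colinearCochains k H B M n) :
    faceB k H B M n (n + 1) ψ ∈ colinearCochains k H B M (n + 1) := by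
  refine LinearMap.ext fun x => ?_
  rw [LinearMap.comp_apply, LinearMap.comp_apply]
  induction x using snoc_induction with
  | add x y hx hy => simp only [map_add, hx, hy]
  | snoc β b =>
    obtain ⟨p, ν, c, j, hc, rfl⟩ := exists_isCoeff_coact (k := k) (H := H) b
    obtain ⟨q, μ, d, l, hd, rfl⟩ := exists_isCoeff_coactT (k := k) (H := H) (n + 1) β
    have h1 : ∀ i, coact k H M (ψ (mulHead k B n (ν i ⊗ₜ μ l))) =
        ∑ z : Fin p × Fin q, (c i z.1 * d l z.2) ⊗ₜ ψ (mulHead k B n (ν z.1 ⊗ₜ μ z.2)) := by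
      intro i
      rw [coact_of_mem hψ, coactT_mulHead hc hd, Fintype.sum_prod_type]
      simp only [map_sum, LinearMap.lTensor_tmul]
    rw [coactT_snocT hc hd, faceB_last (hc.coact j)]
    simp only [map_sum, LinearMap.lTensor_tmul, faceB_last (hc.coact _), TensorProduct.tmul_sum]
    have h2 : ∀ i, coact k H M (rightMul k H M (c j i) (ψ (mulHead k B n (ν i ⊗ₜ μ l)))) =
        ∑ z : Fin p × Fin q, ∑ r, ∑ w,
          (HopfAlgebra.antipode k (c w i) * (c i z.1 * d l z.2) * c j r) ⊗ₜ
            rightMul k H M (c r w) (ψ (mulHead k B n (ν z.1 ⊗ₜ μ z.2))) := by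
      intro i
      rw [coact_rightMul (g := fun r => c r i) (fun r => hc.comul r i) (h1 i) j,
        Finset.sum_product]
      simp only [Fintype.sum_prod_type]
    simp only [h2]
    have h3 : ∀ r w (z : Fin p × Fin q), ∑ i,
          (HopfAlgebra.antipode k (c w i) * (c i z.1 * d l z.2) * c j r) ⊗ₜ[k]
            rightMul k H M (c r w) (ψ (mulHead k B n (ν z.1 ⊗ₜ μ z.2))) =
        if w = z.1 then (d l z.2 * c j r) ⊗ₜ[k]
            rightMul k H M (c r w) (ψ (mulHead k B n (ν z.1 ⊗ₜ μ z.2))) else 0 := by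
      intro r w z
      rw [← TensorProduct.sum_tmul, ← Finset.sum_mul]
      simp only [← mul_assoc]
      rw [← Finset.sum_mul, hc.antipode_mul w z.1]
      split_ifs <;> simp
    calc _ = ∑ z : Fin p × Fin q, ∑ r, ∑ w, ∑ i,
          (HopfAlgebra.antipode k (c w i) * (c i z.1 * d l z.2) * c j r) ⊗ₜ[k]
            rightMul k H M (c r w) (ψ (mulHead k B n (ν z.1 ⊗ₜ μ z.2))) := by
          rw [Finset.sum_comm]
          refine Finset.sum_congr rfl fun z _ => ?_
          rw [Finset.sum_comm]
          exact Finset.sum_congr rfl fun r _ => Finset.sum_comm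
      _ = _ := by
          simp only [h3, Finset.sum_ite_eq', Finset.mem_univ, if_true]
          rw [Fintype.sum_prod_type]
          exact Finset.sum_comm_cycle.symm

end Colinear

/-! ### The map `Ψ` is a map of cosimplicial modules -/

section Psi

variable {k : Type*} [Field k] {H A B M : Type*} [Ring H] [HopfAlgebra k H]
  [Ring A] [Algebra k A] [Module H A] [IsScalarTower k H A]
  [Ring B] [Algebra k B] [LeftComodule k H B]
  [AddCommGroup M] [Module k M]

/-- `α ⊗ β ↦ φ(ψ(β) ⊗ α)`. -/
def pairing {m n : ℕ} (φ : M ⊗[k] (⨂[k]^m A) →ₗ[k] k) (ψ : (⨂[k]^n B) →ₗ[k] M) :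
    (⨂[k]^m A) ⊗[k] (⨂[k]^n B) →ₗ[k] k :=
  φ ∘ₗ ψ.rTensor (⨂[k]^m A) ∘ₗ (TensorProduct.comm k (⨂[k]^m A) (⨂[k]^n B)).toLinearMap

theorem pairing_tmul {m n : ℕ} (φ : M ⊗[k] (⨂[k]^m A) →ₗ[k] k) (ψ : (⨂[k]^n B) →ₗ[k] M)
    (α : ⨂[k]^m A) (β : ⨂[k]^n B) : pairing φ ψ (α ⊗ₜ β) = φ (ψ β ⊗ₜ α) := rfl

variable [InvertibleAntipode k H]
  [Module Hᵐᵒᵖ M] [IsScalarTower k Hᵐᵒᵖ M] [LeftComodule k H M]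

omit [Module Hᵐᵒᵖ M] [IsScalarTower k Hᵐᵒᵖ M] [LeftComodule k H M] in
theorem Psi_apply (n : ℕ) (φ : CochainA k A M n) (ψ : CochainB k B M n)
    (x : ⨂[k]^(n + 1) (CrossedProduct k H A B)) :
    Psi k H A B M n (φ ⊗ₜ ψ) x = pairing φ ψ (twist k H A B (n + 1) x) := rfl

omit [LeftComodule k H M] in
/-- Pairing with a last coface of `ψ` removes a last factor from the twist: the leg of `b` that the
coface moves to the coefficients acts on the factors of `A`, where it cancels the action of the leg
under `S⁻¹`. -/
theorem pairing_faceB_last {n m : ℕ} {φ : M ⊗[k] (⨂[k]^(m + 1) A) →ₗ[k] k} (hφ : IsBalanced H φ)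
    (ψ : CochainB k B M n) {p : ℕ} {ν : Fin p → B} {c : Fin p → Fin p → H} {j : Fin p}
    (hc : IsCoeff (coact k H B) ν c) (α : ⨂[k]^(m + 1) A) (β : ⨂[k]^(n + 1) B) :
    ∑ i, φ (faceB k H B M n (n + 1) ψ (snocT k B (n + 1) (β ⊗ₜ ν i)) ⊗ₜ
        actT k H A (m + 1) (antipodeInv k H (c j i) ⊗ₜ α)) =
      φ (ψ (mulHead k B n (ν j ⊗ₜ β)) ⊗ₜ α) := by
  have h : ∀ z, ∑ i, φ (rightMul k H M (c i z) (ψ (mulHead k B n (ν z ⊗ₜ β))) ⊗ₜ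
        actT k H A (m + 1) (antipodeInv k H (c j i) ⊗ₜ α)) =
      if j = z then φ (ψ (mulHead k B n (ν z ⊗ₜ β)) ⊗ₜ α) else 0 := by
    intro z
    simp only [hφ _ _ _, ← actT_mul, ← map_sum, ← TensorProduct.tmul_sum,
      ← TensorProduct.sum_tmul]
    rw [hc.mul_antipodeInv_self j z]
    split_ifs
    · rw [actT_one]
    · simp
  simp only [faceB_last (hc.coact _), TensorProduct.sum_tmul, map_sum]
  rw [Finset.sum_comm]
  simp only [h, Finset.sum_ite_eq, Finset.mem_univ, if_true]

theorem face_apply {R : Type*} [Ring R] [Algebra k R] {n i : ℕ} (hi : i ≤ n) (f : Cochain k R n)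
    (x : ⨂[k]^(n + 2) R) : face k R n i f x = f (mulAt k R n i x) := by
  rw [face, if_pos hi]
  rfl

theorem face_last {R : Type*} [Ring R] [Algebra k R] {n : ℕ} (f : Cochain k R n)
    (x : ⨂[k]^(n + 1) R) (r : R) :
    face k R n (n + 1) f (snocT k R (n + 1) (x ⊗ₜ r)) = f (mulHead k R n (r ⊗ₜ x)) := by
  rw [face, if_neg (by omega)]
  simp only [LinearMap.lcomp_apply', LinearMap.comp_apply, rotT_snocT, unconsT_consT]

variable [ModuleAlgebra k H A] [ComoduleAlgebra k H B] [SAYD k H M]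

theorem Psi_face_last {n : ℕ} {φ : CochainA k A M n} {ψ : CochainB k B M n}
    (hφ : IsBalanced H φ) (hψ : ψ ∈ colinearCochains k H B M n) :
    Psi k H A B M (n + 1) (faceA k H A M n (n + 1) φ ⊗ₜ faceB k H B M n (n + 1) ψ) =
      face k (CrossedProduct k H A B) n (n + 1) (Psi k H A B M n (φ ⊗ₜ ψ)) := by
  refine LinearMap.ext fun x => ?_
  induction x using snoc_induction with
  | add x y hx hy => simp only [map_add, hx, hy]
  | snoc r v =>
    induction v using CrossedProduct.mk_induction with
    | zero => simp only [TensorProduct.tmul_zero, map_zero]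
    | add x y hx hy => simp only [TensorProduct.tmul_add, map_add, hx, hy]
    | mk a b =>
      rw [face_last, Psi_apply, Psi_apply, twist_snocT, twist_mulHead, twist_consT]
      induction twist k H A B (n + 1) r with
      | zero => simp only [map_zero]
      | add x y hx hy => simp only [map_add, hx, hy]
      | tmul α β =>
        obtain ⟨p, ν, c, j, hc, rfl⟩ := exists_isCoeff_coact (k := k) (H := H) b
        obtain ⟨q, μ, d, l, hd, hl⟩ := exists_isCoeff_coactT (k := k) (H := H) (n + 2)
          (consT k B (n + 1) (ν j ⊗ₜ β))
        have h1 : coact k H M (ψ (mulHead k B n (ν j ⊗ₜ β))) =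
            ∑ m, d l m ⊗ₜ ψ (mulAt k B n 0 (μ m)) := by
          rw [coact_of_mem hψ, ← mulAt_zero_consT, ← hl, coactT_mulAt (Nat.zero_le n), hd.coact]
          simp only [map_sum, LinearMap.lTensor_tmul]
        rw [lastTwist_tmul (hc.coact j), headTwist_tmul (by rw [← hl]; exact hd.coact l)]
        simp only [map_sum, pairing_tmul, TensorProduct.map_tmul, mulAt_zero_consT]
        rw [pairing_faceB_last hφ.faceA_last ψ hc, faceA_last h1]

theorem Psi_face {n i : ℕ} (hi : i ≤ n + 1) {φ : CochainA k A M n} {ψ : CochainB k B M n}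
    (hφ : IsBalanced H φ) (hψ : ψ ∈ colinearCochains k H B M n) :
    Psi k H A B M (n + 1) (faceA k H A M n i φ ⊗ₜ faceB k H B M n i ψ) =
      face k (CrossedProduct k H A B) n i (Psi k H A B M n (φ ⊗ₜ ψ)) := by
  rcases hi.lt_or_eq with hi | rfl
  · refine LinearMap.ext fun x => ?_
    have hi : i ≤ n := by omega
    rw [face_apply hi, Psi_apply, Psi_apply, twist_mulAt hi]
    induction twist k H A B (n + 1 + 1) x with
    | zero => simp only [map_zero]
    | add x y hx hy => simp only [map_add, hx, hy]
    | tmul α β =>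
      rw [TensorProduct.map_tmul, pairing_tmul, pairing_tmul, faceA_apply hi, faceB_apply hi]
  · exact Psi_face_last hφ hψ

/-- `Ψ` commutes with the Hochschild coboundaries, that of the diagonal being
`∑ (-1)ⁱ ∂ᵢ ⊗ ∂ᵢ`. -/
theorem hochschildD_Psi {n : ℕ} {φ : CochainA k A M n} {ψ : CochainB k B M n}
    (hφ : IsBalanced H φ) (hψ : ψ ∈ colinearCochains k H B M n) :
    hochschildD k (CrossedProduct k H A B) n (Psi k H A B M n (φ ⊗ₜ ψ)) =
      Psi k H A B M (n + 1) (∑ i ∈ Finset.range (n + 2),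
        (-1 : k) ^ i • (faceA k H A M n i φ ⊗ₜ[k] faceB k H B M n i ψ)) := by
  rw [hochschildD, alternatingSum, LinearMap.sum_apply, map_sum]
  refine Finset.sum_congr rfl fun i hi => ?_
  rw [LinearMap.smul_apply, map_smul, Psi_face (by simpa [Nat.lt_succ_iff] using hi) hφ hψ]

end Psi

/-! ### Cosimplicial identities -/

section Cosimplicial

variable {k : Type*} [Field k] {H A B M : Type*} [Ring H] [HopfAlgebra k H]
  [Ring A] [Algebra k A] [Module H A] [IsScalarTower k H A]
  [Ring B] [Algebra k B] [LeftComodule k H B]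
  [AddCommGroup M] [Module k M] [Module Hᵐᵒᵖ M] [IsScalarTower k Hᵐᵒᵖ M] [LeftComodule k H M]
  [InvertibleAntipode k H]

omit [Module Hᵐᵒᵖ M] [IsScalarTower k Hᵐᵒᵖ M] in
theorem faceA_succ_zero {n i : ℕ} (hi : i ≤ n + 1) (φ : CochainA k A M n) :
    faceA k H A M (n + 1) (i + 1) (faceA k H A M n 0 φ) =
      faceA k H A M (n + 1) 0 (faceA k H A M n i φ) := by
  refine TensorProduct.ext' fun m x => ?_
  rcases hi.lt_or_eq with hi | rfl
  · rw [faceA_apply (by omega), faceA_apply (Nat.zero_le _), faceA_apply (Nat.zero_le _),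
      faceA_apply (by omega), mulAt_zero_mulAt_succ]
  · obtain ⟨p, ν, c, j, hc, rfl⟩ := exists_isCoeff_coact (k := k) (H := H) m
    induction x using snoc_induction with
    | add x y hx hy => simp only [TensorProduct.tmul_add, map_add, hx, hy]
    | snoc α a =>
      rw [faceA_last (hc.coact j), faceA_apply (Nat.zero_le _), mulAt_snocT (Nat.zero_le _),
        faceA_last (hc.coact j)]
      simp only [faceA_apply (Nat.zero_le _), mulAt_mulHead]

omit [LeftComodule k H M] [InvertibleAntipode k H] in
theorem faceB_last_comm [ComoduleAlgebra k H B] {n i : ℕ} (hi : i ≤ n + 1) (ψ : CochainB k B M n) :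
    faceB k H B M (n + 1) (n + 2) (faceB k H B M n i ψ) =
      faceB k H B M (n + 1) i (faceB k H B M n (n + 1) ψ) := by
  refine LinearMap.ext fun x => ?_
  induction x using snoc_induction with
  | add x y hx hy => simp only [map_add, hx, hy]
  | snoc β b =>
    obtain ⟨p, ν, c, j, hc, rfl⟩ := exists_isCoeff_coact (k := k) (H := H) b
    rcases hi.lt_or_eq with hi | rfl
    · have hi' : i ≤ n := by omega
      rw [faceB_last (hc.coact j), faceB_apply (by omega), mulAt_snocT hi', faceB_last (hc.coact j)]
      simp only [faceB_apply hi', mulAt_mulHead]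
    · induction β using snoc_induction with
      | add x y hx hy => simp only [TensorProduct.add_tmul, map_add, hx, hy]
      | snoc β b' =>
        obtain ⟨q, μ, d, l, hd, rfl⟩ := exists_isCoeff_coact (k := k) (H := H) b'
        have h1 : coact k H B (μ l * ν j) = ∑ z : Fin q × Fin p,
            (d l z.1 * c j z.2) ⊗ₜ (μ z.1 * ν z.2) := by
          rw [coact_mul_coeff hd hc, Fintype.sum_prod_type]
        rw [faceB_last (hc.coact j), faceB_apply le_rfl, mulAt_snocT_snocT, faceB_last h1,
          Fintype.sum_prod_type, Finset.sum_comm]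
        simp only [mulHead_snocT, faceB_last (hd.coact _), mulHead_mul, map_sum]
        simp [rightMul]

end Cosimplicial

/-! ### The Alexander-Whitney map is a map of complexes -/

section AlexanderWhitney

variable {k : Type*} [Field k] {C D : ℕ → Type*} [∀ n, AddCommGroup (C n)] [∀ n, Module k (C n)]
  [∀ n, AddCommGroup (D n)] [∀ n, Module k (D n)]

/-- The composite of the maps `f n : C n → C (n + 1)` from degree `p` to degree `N`. Keeping the
target degree free avoids casts between degrees that are equal but not definitionally so. -/
def iterFace (f : ∀ n, C n →ₗ[k] C (n + 1)) {p N : ℕ} (h : p ≤ N) : C p →ₗ[k] C N :=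
  Nat.leRecOn (C := fun n => C p →ₗ[k] C n) h (fun {n} g => f n ∘ₗ g) LinearMap.id

theorem iterFace_self (f : ∀ n, C n →ₗ[k] C (n + 1)) {p : ℕ} (h : p ≤ p) (x : C p) :
    iterFace f h x = x := by
  rw [iterFace, Nat.leRecOn_self]
  rfl

theorem iterFace_succ (f : ∀ n, C n →ₗ[k] C (n + 1)) {p N : ℕ} (h : p ≤ N) (h' : p ≤ N + 1)
    (x : C p) : iterFace f h' x = f N (iterFace f h x) := by
  rw [iterFace, Nat.leRecOn_succ h]
  rfl

theorem leRecOn_eq_iterFace (f : ∀ n, C n →ₗ[k] C (n + 1)) {p N : ℕ} (h : p ≤ N) (x : C p) :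
    Nat.leRecOn (C := C) h (fun {n} => f n) x = iterFace f h x := by
  induction N, h using Nat.le_induction with
  | base => rw [Nat.leRecOn_self, iterFace_self]
  | succ N h ih => rw [Nat.leRecOn_succ h, ih, iterFace_succ f h]

theorem iterFace_succ_left (f : ∀ n, C n →ₗ[k] C (n + 1)) {p N : ℕ} (h : p ≤ N) (h' : p + 1 ≤ N)
    (x : C p) : iterFace f h' (f p x) = iterFace f h x := by
  rw [← leRecOn_eq_iterFace, ← leRecOn_eq_iterFace]
  exact Nat.leRecOn_succ_left (C := C) x h h'

variable {f : ∀ n, ℕ → C n →ₗ[k] C (n + 1)} {g : ∀ n, ℕ → D n →ₗ[k] D (n + 1)}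

theorem face_iterFace_zero_of_le
    (hf : ∀ n i, i ≤ n + 1 → ∀ x, f (n + 1) (i + 1) (f n 0 x) = f (n + 1) 0 (f n i x))
    {p N i : ℕ} (h : p ≤ N) (h' : p ≤ N + 1) (hi : i + p ≤ N) (x : C p) :
    f N i (iterFace (fun n => f n 0) h x) = iterFace (fun n => f n 0) h' x := by
  induction N, h using Nat.le_induction generalizing i with
  | base =>
    obtain rfl : i = 0 := by omega
    rw [iterFace_succ _ le_rfl]
  | succ N h ih =>
    cases i with
    | zero => rw [iterFace_succ _ (by omega : p ≤ N + 1)]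
    | succ i =>
      rw [iterFace_succ _ h, hf _ _ (by omega), ih (by omega) (by omega),
        ← iterFace_succ (fun n => f n 0)]

theorem face_iterFace_zero_of_ge
    (hf : ∀ n i, i ≤ n + 1 → ∀ x, f (n + 1) (i + 1) (f n 0 x) = f (n + 1) 0 (f n i x))
    {p N q i : ℕ} (h : p ≤ N) (h' : p + 1 ≤ N + 1) (hN : p + q = N) (hi : i ≤ p + 1) (x : C p) :
    f N (q + i) (iterFace (fun n => f n 0) h x) =
      iterFace (fun n => f n 0) h' (f p i x) := by
  induction N, h using Nat.le_induction generalizing q with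
  | base =>
    obtain rfl : q = 0 := by omega
    rw [iterFace_self, iterFace_self, zero_add]
  | succ N h ih =>
    obtain ⟨q, rfl⟩ : ∃ q', q = q' + 1 := ⟨N - p, by omega⟩
    rw [iterFace_succ _ h, show q + 1 + i = q + i + 1 by omega, hf _ _ (by omega),
      ih (by omega) (by omega), ← iterFace_succ (fun n => f n 0)]

theorem face_iterFace_last_of_le
    (hg : ∀ n i, i ≤ n + 1 → ∀ y, g (n + 1) (n + 2) (g n i y) = g (n + 1) i (g n (n + 1) y))
    {q N i : ℕ} (h : q ≤ N) (h' : q + 1 ≤ N + 1) (hi : i ≤ q + 1) (y : D q) :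
    g N i (iterFace (fun n => g n (n + 1)) h y) =
      iterFace (fun n => g n (n + 1)) h' (g q i y) := by
  induction N, h using Nat.le_induction with
  | base => rw [iterFace_self, iterFace_self]
  | succ N h ih =>
    rw [iterFace_succ _ h, ← hg _ _ (by omega), ih (by omega),
      ← iterFace_succ (fun n => g n (n + 1))]

theorem face_iterFace_last_of_gt
    (hg : ∀ n i, i ≤ n + 1 → ∀ y, g (n + 1) (n + 2) (g n i y) = g (n + 1) i (g n (n + 1) y))
    {q N i : ℕ} (h : q ≤ N) (h' : q ≤ N + 1) (hi : q < i) (hi' : i ≤ N + 1) (y : D q) :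
    g N i (iterFace (fun n => g n (n + 1)) h y) = iterFace (fun n => g n (n + 1)) h' y := by
  induction N, h using Nat.le_induction with
  | base =>
    obtain rfl : i = q + 1 := by omega
    rw [iterFace_succ _ le_rfl]
  | succ N h ih =>
    rcases hi'.lt_or_eq with hi' | rfl
    · rw [iterFace_succ _ h, ← hg _ _ (by omega), ih (by omega) (by omega),
        ← iterFace_succ (fun n => g n (n + 1))]
    · rw [iterFace_succ _ (by omega : q ≤ N + 1)]

/-- The Alexander-Whitney map is a map of complexes: the terms of the diagonal coboundary with
`i ≤ q` give the coboundary of `y`, those with `i > q` give that of `x`, and the two terms that are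
missing, `(-1)^{q+1} ∂_{q+1} y` and `(-1)^q ∂₀ x`, cancel. -/
theorem diagonal_coboundary
    (hf : ∀ n i, i ≤ n + 1 → ∀ x, f (n + 1) (i + 1) (f n 0 x) = f (n + 1) 0 (f n i x))
    (hg : ∀ n i, i ≤ n + 1 → ∀ y, g (n + 1) (n + 2) (g n i y) = g (n + 1) i (g n (n + 1) y))
    {p q N : ℕ} (hN : p + q = N) (hp : p ≤ N) (hq : q ≤ N) (hp' : p ≤ N + 1) (hq' : q ≤ N + 1)
    (hp'' : p + 1 ≤ N + 1) (hq'' : q + 1 ≤ N + 1) (x : C p) (y : D q) :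
    ∑ i ∈ Finset.range (N + 2), (-1 : k) ^ i •
        (f N i (iterFace (fun n => f n 0) hp x) ⊗ₜ[k]
          g N i (iterFace (fun n => g n (n + 1)) hq y)) =
      iterFace (fun n => f n 0) hp' x ⊗ₜ
          iterFace (fun n => g n (n + 1)) hq'' (alternatingSum (C := D) (g q) y) +
        (-1 : k) ^ q • (iterFace (fun n => f n 0) hp'' (alternatingSum (C := C) (f p) x) ⊗ₜ
          iterFace (fun n => g n (n + 1)) hq' y) := by
  rw [show N + 2 = (q + 1) + (p + 1) by omega, Finset.sum_range_add]
  have h1 : ∀ i ∈ Finset.range (q + 1), (-1 : k) ^ i •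
        (f N i (iterFace (fun n => f n 0) hp x) ⊗ₜ[k]
          g N i (iterFace (fun n => g n (n + 1)) hq y)) =
      iterFace (fun n => f n 0) hp' x ⊗ₜ
        iterFace (fun n => g n (n + 1)) hq'' ((-1 : k) ^ i • g q i y) := by
    intro i hi
    have hi := Finset.mem_range.1 hi
    rw [face_iterFace_zero_of_le hf hp hp' (by omega),
      face_iterFace_last_of_le hg hq hq'' (by omega),
      map_smul, TensorProduct.tmul_smul]
  have h2 : ∀ i ∈ Finset.range (p + 1), (-1 : k) ^ (q + 1 + i) •
        (f N (q + 1 + i) (iterFace (fun n => f n 0) hp x) ⊗ₜ[k]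
          g N (q + 1 + i) (iterFace (fun n => g n (n + 1)) hq y)) =
      (-1 : k) ^ q • (iterFace (fun n => f n 0) hp'' ((-1 : k) ^ (i + 1) • f p (i + 1) x) ⊗ₜ
        iterFace (fun n => g n (n + 1)) hq' y) := by
    intro i hi
    have hi := Finset.mem_range.1 hi
    rw [face_iterFace_last_of_gt hg hq hq' (by omega) (by omega),
      show q + 1 + i = q + (i + 1) by omega,
      face_iterFace_zero_of_ge hf hp hp'' hN (by omega), map_smul, ← TensorProduct.smul_tmul',
      smul_smul, pow_add]
  have h3 : iterFace (fun n => g n (n + 1)) hq'' (g q (q + 1) y) =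
      iterFace (fun n => g n (n + 1)) hq' y := iterFace_succ_left (fun n => g n (n + 1)) hq' hq'' y
  have h4 : iterFace (fun n => f n 0) hp'' (f p 0 x) = iterFace (fun n => f n 0) hp' x :=
    iterFace_succ_left (fun n => f n 0) hp' hp'' x
  have h5 : iterFace (fun n => g n (n + 1)) hq'' (alternatingSum (C := D) (g q) y) =
      ∑ i ∈ Finset.range (q + 1),
        iterFace (fun n => g n (n + 1)) hq'' ((-1 : k) ^ i • g q i y) +
      (-1 : k) ^ (q + 1) • iterFace (fun n => g n (n + 1)) hq' y := by
    rw [alternatingSum, LinearMap.sum_apply, Finset.sum_range_succ (n := q + 1), map_add, map_sum,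
      LinearMap.smul_apply, map_smul, h3]
    rfl
  have h6 : iterFace (fun n => f n 0) hp'' (alternatingSum (C := C) (f p) x) =
      ∑ i ∈ Finset.range (p + 1),
        iterFace (fun n => f n 0) hp'' ((-1 : k) ^ (i + 1) • f p (i + 1) x) +
      iterFace (fun n => f n 0) hp' x := by
    rw [alternatingSum, LinearMap.sum_apply, Finset.sum_range_succ' (n := p + 1), map_add, map_sum,
      LinearMap.smul_apply, pow_zero, one_smul, h4]
    rfl
  rw [Finset.sum_congr rfl h1, Finset.sum_congr rfl h2, h5, h6, ← TensorProduct.tmul_sum,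
    ← Finset.smul_sum, ← TensorProduct.sum_tmul, TensorProduct.tmul_add, TensorProduct.add_tmul,
    TensorProduct.tmul_smul, pow_succ]
  module

end AlexanderWhitney

/-! ### The cup product in cohomology -/

section CupCoboundary

variable {k : Type*} [Field k] {H A B M : Type*} [Ring H] [HopfAlgebra k H]
  [InvertibleAntipode k H]
  [Ring A] [Algebra k A] [Module H A] [IsScalarTower k H A] [ModuleAlgebra k H A]
  [Ring B] [Algebra k B] [LeftComodule k H B] [ComoduleAlgebra k H B]
  [AddCommGroup M] [Module k M] [Module Hᵐᵒᵖ M] [IsScalarTower k Hᵐᵒᵖ M]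
  [LeftComodule k H M] [SAYD k H M]

variable (k H A B M) in
/-- The cup product with values in any degree `N`; it is meaningful for `N = p + q`. -/
def cupTo {p q N : ℕ} (hp : p ≤ N) (hq : q ≤ N) :
    CochainA k A M p →ₗ[k] CochainB k B M q →ₗ[k] Cochain k (CrossedProduct k H A B) N :=
  (TensorProduct.mk k (CochainA k A M N) (CochainB k B M N)).compr₂ (Psi k H A B M N) |>.compl₁₂
    (iterFace (C := CochainA k A M) (fun n => faceA k H A M n 0) hp)
    (iterFace (C := CochainB k B M) (fun n => faceB k H B M n (n + 1)) hq)

omit [SAYD k H M] in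
theorem cupTo_apply {p q N : ℕ} (hp : p ≤ N) (hq : q ≤ N) (φ : CochainA k A M p)
    (ψ : CochainB k B M q) : cupTo k H A B M hp hq φ ψ = Psi k H A B M N
      (iterFace (C := CochainA k A M) (fun n => faceA k H A M n 0) hp φ ⊗ₜ
        iterFace (C := CochainB k B M) (fun n => faceB k H B M n (n + 1)) hq ψ) := rfl

omit [SAYD k H M] in
theorem cup_eq_cupTo {p q : ℕ} (φ : CochainA k A M p) (ψ : CochainB k B M q) :
    cup k H A B M p q φ ψ =
      cupTo k H A B M (Nat.le_add_right p q) (Nat.le_add_left q p) φ ψ := by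
  rw [cup, AW, cupTo_apply]
  congr 2
  · exact leRecOn_eq_iterFace (C := CochainA k A M) (fun n => faceA k H A M n 0) _ φ
  · exact leRecOn_eq_iterFace (C := CochainB k B M) (fun n => faceB k H B M n (n + 1)) _ ψ

omit [SAYD k H M] in
theorem IsBalanced.iterFace {p N : ℕ} (h : p ≤ N) {φ : CochainA k A M p} (hφ : IsBalanced H φ) :
    IsBalanced H (iterFace (C := CochainA k A M) (fun n => faceA k H A M n 0) h φ) := by
  induction N, h using Nat.le_induction with
  | base => rwa [iterFace_self]
  | succ N h ih =>
    rw [iterFace_succ _ h]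
    exact ih.faceA_zero

omit [InvertibleAntipode k H] in
theorem iterFace_mem_colinearCochains {q N : ℕ} (h : q ≤ N) {ψ : CochainB k B M q}
    (hψ : ψ ∈ colinearCochains k H B M q) :
    iterFace (C := CochainB k B M) (fun n => faceB k H B M n (n + 1)) h ψ ∈
      colinearCochains k H B M N := by
  induction N, h using Nat.le_induction with
  | base => rwa [iterFace_self]
  | succ N h ih =>
    rw [iterFace_succ _ h]
    exact faceB_last_mem ih

/-- `d(φ ∪ ψ) = φ ∪ dψ + (-1)^q dφ ∪ ψ`. -/
theorem hochschildD_cupTo {p q N : ℕ} (hN : p + q = N) (hp : p ≤ N) (hq : q ≤ N)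
    (hp' : p ≤ N + 1) (hq' : q ≤ N + 1) (hp'' : p + 1 ≤ N + 1) (hq'' : q + 1 ≤ N + 1)
    {φ : CochainA k A M p} (hφ : φ ∈ equivariantCochains k H A M p)
    {ψ : CochainB k B M q} (hψ : ψ ∈ colinearCochains k H B M q) :
    hochschildD k (CrossedProduct k H A B) N (cupTo k H A B M hp hq φ ψ) =
      cupTo k H A B M hp' hq'' φ (hochschildDB k H B M q ψ) +
        (-1 : k) ^ q • cupTo k H A B M hp'' hq' (hochschildDA k H A M p φ) ψ := by
  rw [cupTo_apply, hochschildD_Psi ((isBalanced_of_mem hφ).iterFace hp)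
    (iterFace_mem_colinearCochains hq hψ), cupTo_apply, cupTo_apply, ← map_smul, ← map_add]
  congr 1
  exact diagonal_coboundary (C := CochainA k A M) (D := CochainB k B M)
    (f := fun n => faceA k H A M n) (g := fun n => faceB k H B M n)
    (fun n i hi x => faceA_succ_zero hi x) (fun n i hi y => faceB_last_comm hi y)
    hN hp hq hp' hq' hp'' hq'' φ ψ

variable (k H A B) in
/-- Hochschild cocycles of the crossed product. -/
abbrev cocyclesCrossed (n : ℕ) : Submodule k (Cochain k (CrossedProduct k H A B) n) :=
  cocycles (C := Cochain k (CrossedProduct k H A B)) (fun _ => ⊤)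
    (hochschildD k (CrossedProduct k H A B)) n

theorem cupTo_mem_cocycles {p q N : ℕ} (hN : p + q = N) (hp : p ≤ N) (hq : q ≤ N)
    {φ : CochainA k A M p}
    (hφ : φ ∈ cocycles (equivariantCochains k H A M) (hochschildDA k H A M) p)
    {ψ : CochainB k B M q}
    (hψ : ψ ∈ cocycles (colinearCochains k H B M) (hochschildDB k H B M) q) :
    cupTo k H A B M hp hq φ ψ ∈ cocyclesCrossed k H A B N := by
  refine ⟨trivial, LinearMap.mem_ker.2 ?_⟩
  rw [hochschildD_cupTo hN hp hq (by omega) (by omega) (by omega) (by omega) hφ.1 hψ.1,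
    LinearMap.mem_ker.1 hφ.2, LinearMap.mem_ker.1 hψ.2]
  simp

theorem cupTo_mem_coboundaries_left {p q N : ℕ} (hN : p + q = N) (hp : p ≤ N) (hq : q ≤ N)
    {φ : CochainA k A M p}
    (hφ : φ ∈ coboundaries (equivariantCochains k H A M) (hochschildDA k H A M) p)
    {ψ : CochainB k B M q}
    (hψ : ψ ∈ cocycles (colinearCochains k H B M) (hochschildDB k H B M) q) :
    cupTo k H A B M hp hq φ ψ ∈ coboundaries (C := Cochain k (CrossedProduct k H A B))
      (fun _ => ⊤) (hochschildD k (CrossedProduct k H A B)) N := by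
  cases p with
  | zero =>
    obtain rfl : φ = 0 := (Submodule.mem_bot k).1 hφ
    rw [map_zero, LinearMap.zero_apply]
    exact Submodule.zero_mem _
  | succ p =>
    obtain ⟨χ, hχ, rfl⟩ := hφ
    obtain ⟨N, rfl⟩ : ∃ N', N = N' + 1 := ⟨p + q, by omega⟩
    have h := hochschildD_cupTo (N := N) (by omega) (by omega) (by omega)
        (by omega) hq hp (by omega)
      hχ hψ.1
    rw [LinearMap.mem_ker.1 hψ.2, map_zero, zero_add] at h
    refine ⟨(-1 : k) ^ q • cupTo k H A B M (by omega) (by omega) χ ψ, trivial, ?_⟩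
    rw [map_smul, h, smul_smul, ← mul_pow, neg_mul_neg, one_mul, one_pow, one_smul]

theorem cupTo_mem_coboundaries_right {p q N : ℕ} (hN : p + q = N) (hp : p ≤ N) (hq : q ≤ N)
    {φ : CochainA k A M p}
    (hφ : φ ∈ cocycles (equivariantCochains k H A M) (hochschildDA k H A M) p)
    {ψ : CochainB k B M q}
    (hψ : ψ ∈ coboundaries (colinearCochains k H B M) (hochschildDB k H B M) q) :
    cupTo k H A B M hp hq φ ψ ∈ coboundaries (C := Cochain k (CrossedProduct k H A B))
      (fun _ => ⊤) (hochschildD k (CrossedProduct k H A B)) N := by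
  cases q with
  | zero =>
    obtain rfl : ψ = 0 := (Submodule.mem_bot k).1 hψ
    rw [map_zero]
    exact Submodule.zero_mem _
  | succ q =>
    obtain ⟨χ, hχ, rfl⟩ := hψ
    obtain ⟨N, rfl⟩ : ∃ N', N = N' + 1 := ⟨p + q, by omega⟩
    have h := hochschildD_cupTo (N := N) (by omega) (by omega) (by omega) hp (by omega)
        (by omega) hq
      hφ.1 hχ
    rw [LinearMap.mem_ker.1 hφ.2, map_zero, LinearMap.zero_apply, smul_zero, add_zero] at h
    exact ⟨_, trivial, h⟩

variable (k H A B M) in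
theorem existsUnique_cupCohomology (p q : ℕ) :
    ∃! c : HHA k H A M p →ₗ[k] HHB k H B M q →ₗ[k] HH k (CrossedProduct k H A B) (p + q),
      ∀ (φ : cocycles (equivariantCochains k H A M) (hochschildDA k H A M) p)
        (ψ : cocycles (colinearCochains k H B M) (hochschildDB k H B M) q),
        ∃ χ : cocycles (C := Cochain k (CrossedProduct k H A B))
            (fun _ => ⊤) (hochschildD k (CrossedProduct k H A B)) (p + q),
          χ.1 = cup k H A B M p q φ.1 ψ.1 ∧
          c (Submodule.Quotient.mk φ) (Submodule.Quotient.mk ψ) = Submodule.Quotient.mk χ := by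
  let cupZ : cocycles (equivariantCochains k H A M) (hochschildDA k H A M) p →ₗ[k]
      cocycles (colinearCochains k H B M) (hochschildDB k H B M) q →ₗ[k]
        cocyclesCrossed k H A B (p + q) :=
    LinearMap.mk₂ k (fun φ ψ => ⟨cupTo k H A B M (Nat.le_add_right p q)
        (Nat.le_add_left q p) φ.1 ψ.1,
        cupTo_mem_cocycles rfl _ _ φ.2 ψ.2⟩)
      (fun φ φ' ψ => Subtype.ext (by simp)) (fun r φ ψ => Subtype.ext (by simp))
      (fun φ ψ ψ' => Subtype.ext (by simp)) (fun r φ ψ => Subtype.ext (by simp))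
  -- The product on cocycles is passed to the quotient in `ψ` first and then in `φ`.
  let π : cocyclesCrossed k H A B (p + q) →ₗ[k] HH k (CrossedProduct k H A B) (p + q) :=
    Submodule.mkQ _
  let cupQ := cupZ.compr₂ π
  let cupB : HHB k H B M q →ₗ[k]
      cocycles (equivariantCochains k H A M) (hochschildDA k H A M) p →ₗ[k]
        HH k (CrossedProduct k H A B) (p + q) :=
    Submodule.liftQ _ cupQ.flip fun ψ hψ => LinearMap.mem_ker.2 <| LinearMap.ext fun φ =>
      (Submodule.Quotient.mk_eq_zero _).2 (cupTo_mem_coboundaries_right rfl _ _ φ.2 hψ)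
  have hc : ∀ φ ∈ (coboundaries (equivariantCochains k H A M) (hochschildDA k H A M) p).comap
      (cocycles (equivariantCochains k H A M) (hochschildDA k H A M) p).subtype,
      cupB.flip φ = 0 := by
    intro φ hφ
    refine LinearMap.ext fun y => ?_
    induction y using Submodule.Quotient.induction_on with
    | _ ψ =>
      exact (Submodule.Quotient.mk_eq_zero _).2 (cupTo_mem_coboundaries_left rfl _ _ hφ ψ.2)
  let c : HHA k H A M p →ₗ[k] HHB k H B M q →ₗ[k] HH k (CrossedProduct k H A B) (p + q) :=
    Submodule.liftQ _ cupB.flip fun φ hφ => LinearMap.mem_ker.2 (hc φ hφ)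
  refine ⟨c, fun φ ψ => ⟨cupZ φ ψ, (cup_eq_cupTo _ _).symm, rfl⟩, fun c' hc' => ?_⟩
  refine LinearMap.ext fun x => LinearMap.ext fun y => ?_
  induction x using Submodule.Quotient.induction_on with
  | _ φ =>
  induction y using Submodule.Quotient.induction_on with
  | _ ψ =>
    obtain ⟨χ, hχ, h⟩ := hc' φ ψ
    have hχ' : χ = cupZ φ ψ := Subtype.ext (hχ.trans (cup_eq_cupTo _ _))
    rw [h, hχ']
    rfl

end CupCoboundary

/-! ### Removing the last factors of a cup product -/

section Peel

variable {k : Type*} [Field k] {H A B M : Type*} [Ring H] [HopfAlgebra k H]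
  [Ring A] [Algebra k A] [Module H A] [IsScalarTower k H A]
  [Ring B] [Algebra k B] [LeftComodule k H B]
  [AddCommGroup M] [Module k M]

variable (k H) in
/-- `(a¹ ⊗ ⋯ ⊗ aᵖ) ⊗ b' ↦ a ⊗ b₍₋₁₎ (a¹ ⊗ ⋯ ⊗ aᵖ) ⊗ b₍₀₎ b'`, where `H` acts diagonally. -/
def headTail (p : ℕ) (a : A) (b : B) :
    (⨂[k]^p A) ⊗[k] B →ₗ[k] (⨂[k]^(p + 1) A) ⊗[k] B :=
  TensorProduct.map (consT k A p ∘ₗ TensorProduct.mk k A (⨂[k]^p A) a ∘ₗ actT k H A p)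
      (LinearMap.mul' k B) ∘ₗ
    (TensorProduct.tensorTensorTensorComm k H B (⨂[k]^p A) B).toLinearMap ∘ₗ
    TensorProduct.mk k (H ⊗[k] B) ((⨂[k]^p A) ⊗[k] B) (coact k H B b)

theorem headTail_tmul {ι : Type*} {s : Finset ι} {x : ι → H} {y : ι → B} {b : B}
    (hb : coact k H B b = ∑ i ∈ s, x i ⊗ₜ y i) (p : ℕ) (a : A) (α : ⨂[k]^p A) (b' : B) :
    headTail k H p a b (α ⊗ₜ b') =
      ∑ i ∈ s, consT k A p (a ⊗ₜ actT k H A p (x i ⊗ₜ α)) ⊗ₜ (y i * b') := by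
  simp only [headTail, LinearMap.comp_apply, hb, map_sum, LinearMap.sum_apply]
  rfl

variable (k H) in
/-- The factors `a¹ ⊗ b¹₍₋ₚ₊₁₎ a² ⊗ b¹₍₋ₚ₊₂₎ b²₍₋ₚ₊₂₎ a³ ⊗ ⋯ ⊗ b¹₍₋₁₎ ⋯ bᵖ⁻¹₍₋₁₎ aᵖ` of `A` and the
factor `b¹₍₀₎ ⋯ bᵖ₍₀₎` of `B` that `p` iterated last cofaces leave of `a¹ ⋊ b¹ ⊗ ⋯ ⊗ aᵖ ⋊ bᵖ`. -/
def tailTwist : (p : ℕ) → (ℕ → A) → (ℕ → B) → (⨂[k]^p A) ⊗[k] B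
  | 0, a, _ => seqT k 0 a ⊗ₜ 1
  | p + 1, a, b =>
    headTail k H p (a 0) (b 0) (tailTwist p (fun i => a (i + 1)) (fun i => b (i + 1)))

/-- `(α ⊗ β) ⊗ (α' ⊗ b') ↦ φ(ψ(b' β) ⊗ α ⊗ α')`, where `b'` multiplies the first factor of `β`. -/
def tailPairing {n p N : ℕ} (e : n + 1 + p = N + 1) (φ : CochainA k A M N) (ψ : CochainB k B M n) :
    ((⨂[k]^(n + 1) A) ⊗[k] (⨂[k]^(n + 1) B)) ⊗[k] ((⨂[k]^p A) ⊗[k] B) →ₗ[k] k :=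
  φ ∘ₗ (TensorProduct.comm k (⨂[k]^(N + 1) A) M).toLinearMap ∘ₗ
    TensorProduct.map (joinT k A e)
      (ψ ∘ₗ mulHead k B n ∘ₗ (TensorProduct.comm k (⨂[k]^(n + 1) B) B).toLinearMap) ∘ₗ
    (TensorProduct.tensorTensorTensorComm k (⨂[k]^(n + 1) A) (⨂[k]^(n + 1) B)
      (⨂[k]^p A) B).toLinearMap

theorem tailPairing_tmul {n p N : ℕ} (e : n + 1 + p = N + 1) (φ : CochainA k A M N)
    (ψ : CochainB k B M n) (α : ⨂[k]^(n + 1) A) (β : ⨂[k]^(n + 1) B) (α' : ⨂[k]^p A) (b' : B) :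
    tailPairing e φ ψ ((α ⊗ₜ β) ⊗ₜ (α' ⊗ₜ b')) =
      φ (ψ (mulHead k B n (b' ⊗ₜ β)) ⊗ₜ joinT k A e (α ⊗ₜ α')) := rfl

variable [InvertibleAntipode k H]
  [Module Hᵐᵒᵖ M] [IsScalarTower k Hᵐᵒᵖ M]

/-- One last coface of `ψ` turns the last factor `a ⋊ b` of the twist into a first factor of the
tail: the leg of `b` under `S⁻¹` acts on everything but the tail, and it is made to act on the
tail as well at the cost of a further leg acting there. -/
theorem tailPairing_faceB_last {n p N : ℕ} (e : n + 1 + 1 + p = N + 1)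
    (e' : n + 1 + (p + 1) = N + 1)
    {φ : CochainA k A M N} (hφ : IsBalanced H φ) (ψ : CochainB k B M n) (a : A) (b : B)
    (t : (⨂[k]^(n + 1) A) ⊗[k] (⨂[k]^(n + 1) B)) (u : (⨂[k]^p A) ⊗[k] B) :
    tailPairing e φ (faceB k H B M n (n + 1) ψ) (lastTwist k H (n + 1) a b t ⊗ₜ u) =
      tailPairing e' φ ψ (t ⊗ₜ headTail k H p a b u) := by
  induction t with
  | zero => simp only [LinearMap.map_zero, TensorProduct.zero_tmul]
  | add x y hx hy => simp only [LinearMap.map_add, TensorProduct.add_tmul, hx, hy]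
  | tmul α β =>
  induction u with
  | zero => simp only [LinearMap.map_zero, TensorProduct.tmul_zero]
  | add x y hx hy => simp only [LinearMap.map_add, TensorProduct.tmul_add, hx, hy]
  | tmul α' b' =>
    obtain ⟨q, ν, c, j, hc, rfl⟩ := exists_isCoeff_coact (k := k) (H := H) b
    -- `S⁻¹(b₍₋₁₎) γ ⊗ α' = S⁻¹(b₍₋₁₎) (γ ⊗ b₍₋₂₎ α')`.
    have h : ∀ (γ : ⨂[k]^(n + 2) A) (i : Fin q),
        joinT k A e (actT k H A (n + 2) (antipodeInv k H (c j i) ⊗ₜ γ) ⊗ₜ α') =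
          ∑ l, actT k H A (N + 1) (antipodeInv k H (c l i) ⊗ₜ
            joinT k A e (γ ⊗ₜ actT k H A p (c j l ⊗ₜ α'))) := by
      intro γ i
      simp only [actT_joinT (hc.comul_antipodeInv _ _)]
      rw [Finset.sum_comm]
      simp only [← actT_mul, ← map_sum, ← TensorProduct.tmul_sum, ← TensorProduct.sum_tmul]
      simp only [hc.antipodeInv_mul_self, TensorProduct.ite_tmul,
        apply_ite (actT k H A p), actT_one, map_zero, TensorProduct.tmul_ite,
        Finset.sum_ite_eq, Finset.mem_univ, if_true]
    rw [lastTwist_tmul (hc.coact j), headTail_tmul (hc.coact j)]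
    simp only [TensorProduct.sum_tmul, TensorProduct.tmul_sum, map_sum, tailPairing_tmul,
      mulHead_snocT, h]
    rw [Finset.sum_comm]
    simp only [pairing_faceB_last hφ ψ hc, joinT_snocT e e', mulHead_mul]

theorem pairing_twist_eq_tailPairing {n p N : ℕ} (e : n + 1 + p = N + 1) (h : n ≤ N)
    {φ : CochainA k A M N} (hφ : IsBalanced H φ) (ψ : CochainB k B M n) (a : ℕ → A) (b : ℕ → B) :
    pairing φ (iterFace (C := CochainB k B M) (fun n => faceB k H B M n (n + 1)) h ψ)
        (twist k H A B (N + 1) (seqT k (N + 1) fun i => CrossedProduct.mk k H A B (a i) (b i))) =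
      tailPairing e φ ψ
        (twist k H A B (n + 1) (seqT k (n + 1) fun i => CrossedProduct.mk k H A B (a i) (b i)) ⊗ₜ
          tailTwist k H p (fun i => a (n + 1 + i)) (fun i => b (n + 1 + i))) := by
  induction p generalizing n with
  | zero =>
    obtain rfl : n = N := by omega
    rw [iterFace_self, tailTwist]
    generalize twist k H A B (n + 1) _ = t
    induction t with
    | zero => simp only [LinearMap.map_zero, TensorProduct.zero_tmul]
    | add x y hx hy => simp only [LinearMap.map_add, TensorProduct.add_tmul, hx, hy]
    | tmul α β => rw [tailPairing_tmul, one_mulHead, joinT_zero, pairing_tmul]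
  | succ p ih =>
    rw [← iterFace_succ_left (C := CochainB k B M) (fun n => faceB k H B M n (n + 1)) h (by omega),
      ih (by omega), seqT_succ', twist_snocT, tailPairing_faceB_last _ e hφ, tailTwist]
    simp only [add_assoc, add_comm 1, add_zero]

end Peel

/-! ### Iterated coactions -/

section IterCoact

variable {k : Type*} [Field k] {H B : Type*} [Ring H] [HopfAlgebra k H]
  [AddCommGroup B] [Module k B] [LeftComodule k H B]

variable {J : Type*} [Fintype J] [DecidableEq J] {ν : J → B} {c : J → J → H}

theorem iterCoact_succ (n : ℕ) (b : B) :
    iterCoact k H B (n + 1) b =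
      ((consT k H n ∘ₗ (TensorProduct.comm k (⨂[k]^n H) H).toLinearMap).rTensor B ∘ₗ
        (TensorProduct.assoc k (⨂[k]^n H) H B).symm.toLinearMap ∘ₗ
        (coact k H B).lTensor (⨂[k]^n H)) (iterCoact k H B n b) := rfl

/-- The iterated coaction with the leg that is nearest to the comodule split off last. -/
theorem iterCoact_succ_of_eq (hc : IsCoeff (coact k H B) ν c) {n : ℕ} {b : B} {w : J → ⨂[k]^n H}
    (h : iterCoact k H B n b = ∑ l, w l ⊗ₜ ν l) :
    iterCoact k H B (n + 1) b = ∑ l, ∑ i, consT k H n (c l i ⊗ₜ w l) ⊗ₜ ν i := by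
  rw [iterCoact_succ, h]
  simp only [LinearMap.comp_apply, map_sum, LinearMap.lTensor_tmul, hc.coact,
    TensorProduct.tmul_sum]
  rfl

/-- The tensor `c_{j i₁} ⊗ ⋯ ⊗ c_{iₙ₋₁ l}`, summed over the inner indices, with the factors listed
from the last to the first. -/
def coeffT (k : Type*) [Field k] {H : Type*} [Ring H] [HopfAlgebra k H] {J : Type*} [Fintype J]
    [DecidableEq J] (c : J → J → H) : (n : ℕ) → J → J → ⨂[k]^n H
  | 0, j, l => if j = l then seqT k 0 0 else 0
  | n + 1, j, l => ∑ i, consT k H n (c i l ⊗ₜ coeffT k c n j i)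

theorem coeffT_succ (c : J → J → H) (n : ℕ) (j l : J) :
    coeffT k c (n + 1) j l = ∑ i, consT k H n (c i l ⊗ₜ coeffT k c n j i) := rfl

theorem iterCoact_coeff (hc : IsCoeff (coact k H B) ν c) (n : ℕ) (j : J) :
    iterCoact k H B n (ν j) = ∑ l, coeffT k c n j l ⊗ₜ ν l := by
  induction n with
  | zero =>
    simp only [coeffT, TensorProduct.ite_tmul, Finset.sum_ite_eq,
      Finset.mem_univ, if_true, iterCoact, TensorProduct.mk_apply, seqT]
    congr 2
    exact Subsingleton.elim _ _
  | succ n ih =>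
    rw [iterCoact_succ_of_eq hc ih, Finset.sum_comm]
    simp only [coeffT, TensorProduct.sum_tmul]

/-- In `coeffT` the leg that is farthest from the comodule may be split off first. -/
theorem coeffT_succ' (c : J → J → H) (n : ℕ) (j l : J) :
    coeffT k c (n + 1) j l = ∑ i, snocT k H n (coeffT k c n i l ⊗ₜ c j i) := by
  induction n generalizing l with
  | zero =>
    simp only [coeffT, TensorProduct.ite_tmul, TensorProduct.tmul_ite, apply_ite (snocT k H 0),
      apply_ite (consT k H 0), map_zero,
      snocT_zero, Finset.sum_ite_eq, Finset.sum_ite_eq', Finset.mem_univ, if_true]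
  | succ n ih =>
    rw [coeffT_succ]
    simp only [ih, TensorProduct.tmul_sum, map_sum, ← snocT_consT]
    rw [Finset.sum_comm]
    simp only [coeffT_succ, TensorProduct.sum_tmul, map_sum]

end IterCoact

section LegAction

variable {k : Type*} [Field k] {H A B : Type*} [Ring H] [HopfAlgebra k H]
  [AddCommGroup A] [Module k A] [Module H A] [IsScalarTower k H A]
  [AddCommGroup B] [Module k B] [LeftComodule k H B]

variable (k) in
/-- `h¹ ⊗ ⋯ ⊗ hⁿ ↦ hⁿ a¹ ⊗ ⋯ ⊗ h¹ aⁿ`. The order is reversed because iterated coactions list the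
legs from the nearest to the farthest, which is the one that acts on `a¹`. -/
def legAct (n : ℕ) (a : ℕ → A) : (⨂[k]^n H) →ₗ[k] ⨂[k]^n A :=
  PiTensorProduct.map (fun i : Fin n =>
      (Algebra.lsmul k k A : H →ₐ[k] Module.End k A).toLinearMap.flip (a i)) ∘ₗ
    (PiTensorProduct.reindex k (fun _ => H) Fin.revPerm).toLinearMap

theorem legAct_tprod (n : ℕ) (a : ℕ → A) (x : ℕ → H) :
    legAct k n a (PiTensorProduct.tprod k fun l : Fin n => x (l + 1)) =
      seqT k n fun i => x (n - i) • a i := by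
  rw [legAct, LinearMap.comp_apply, LinearEquiv.coe_coe]
  refine (congrArg _ (PiTensorProduct.reindex_tprod _ _)).trans ?_
  rw [PiTensorProduct.map_tprod, seqT]
  congr 1
  ext i
  have : n - (i + 1) + 1 = n - i := by omega
  simp [Fin.val_rev, this]

theorem legAct_snocT (n : ℕ) (a : ℕ → A) (w : ⨂[k]^n H) (h : H) :
    legAct k (n + 1) a (snocT k H n (w ⊗ₜ h)) =
      consT k A n ((h • a 0) ⊗ₜ legAct k n (fun i => a (i + 1)) w) := by
  induction w using PiTensorProduct.induction_on with
  | add x y hx hy => simp only [TensorProduct.add_tmul, TensorProduct.tmul_add, map_add, hx, hy]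
  | smul_tprod r f =>
    simp only [TensorProduct.tmul_smul, map_smul, ← TensorProduct.smul_tmul', snocT_tmul]
    congr 1
    -- `legAct_tprod` takes the factors from a sequence that starts in degree `1`.
    let x : ℕ → H := fun i => if h' : i - 1 < n then f ⟨i - 1, h'⟩ else h
    have h1 : (Fin.snoc f h : Fin (n + 1) → H) = fun l : Fin (n + 1) => x (l + 1) := by
      ext i
      refine Fin.lastCases ?_ (fun i => ?_) i <;> simp [x]
    have h2 : f = fun l : Fin n => x (l + 1) := by
      ext i
      simp [x]
    rw [h1, legAct_tprod, seqT_succ]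
    conv_rhs => rw [h2, legAct_tprod]
    have h3 : x (n + 1) = h := by simp [x]
    simp only [Nat.add_sub_add_right, Nat.sub_zero, h3, TensorProduct.smul_tmul']

/-- `b₍₋₁₎ (a¹ ⊗ ⋯ ⊗ aⁿ) ⊗ b₍₀₎ = b₍₋ₙ₎ a¹ ⊗ ⋯ ⊗ b₍₋₁₎ aⁿ ⊗ b₍₀₎`. -/
theorem actT_coeff_seqT {J : Type*} [Fintype J] [DecidableEq J] {ν : J → B} {c : J → J → H}
    (hc : IsCoeff (coact k H B) ν c) (n : ℕ) (a : ℕ → A) (j l : J) :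
    actT k H A n (c j l ⊗ₜ seqT k n a) = legAct k n a (coeffT k c n j l) := by
  induction n generalizing j a with
  | zero =>
    have h := legAct_tprod (k := k) 0 a (0 : ℕ → H)
    have h' : seqT k 0 (0 : ℕ → H) = PiTensorProduct.tprod k fun l : Fin 0 => 0 := rfl
    simp only [Pi.zero_apply] at h
    rw [actT_zero, hc.counit, coeffT, apply_ite (legAct k 0 a), map_zero, ite_smul, one_smul,
      zero_smul, h', h, seqT_congr fun i hi => absurd hi (Nat.not_lt_zero i)]
  | succ n ih =>
    rw [seqT_succ, actT_consT (hc.comul j l), coeffT_succ', map_sum]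
    simp only [ih, legAct_snocT]

theorem sum_actT_of_iterCoact {ι : Type*} {s : Finset ι} {n : ℕ} {x : ι → ℕ → H} {y : ι → B} {b : B}
    (hb : iterCoact k H B n b = ∑ r ∈ s, (PiTensorProduct.tprod k
      fun l : Fin n => x r (l + 1)) ⊗ₜ[k] y r) (a : ℕ → A)
    {J : Type*} [Fintype J] [DecidableEq J] {ν : J → B} {c : J → J → H}
    (hc : IsCoeff (coact k H B) ν c) {j : J} (hj : ν j = b) :
    ∑ l, actT k H A n (c j l ⊗ₜ seqT k n a) ⊗ₜ[k] ν l =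
      ∑ r ∈ s, (seqT k n fun i => x r (n - i) • a i) ⊗ₜ[k] y r := by
  have h := congrArg ((legAct k n a).rTensor B) hb
  rw [← hj, iterCoact_coeff hc] at h
  simpa only [map_sum, LinearMap.rTensor_tmul, legAct_tprod, ← actT_coeff_seqT hc] using h

variable [InvertibleAntipode k H]

variable (k) in
/-- `h¹ ⊗ ⋯ ⊗ hⁿ ↦ S⁻¹(h¹) a¹ ⊗ ⋯ ⊗ S⁻¹(hⁿ) aⁿ`. -/
def legActInv (n : ℕ) (a : ℕ → A) : (⨂[k]^n H) →ₗ[k] ⨂[k]^n A :=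
  PiTensorProduct.map fun i : Fin n =>
    (Algebra.lsmul k k A : H →ₐ[k] Module.End k A).toLinearMap.flip (a i) ∘ₗ antipodeInv k H

theorem legActInv_tprod (n : ℕ) (a : ℕ → A) (x : ℕ → H) :
    legActInv k n a (PiTensorProduct.tprod k fun l : Fin n => x (l + 1)) =
      seqT k n fun i => antipodeInv k H (x (i + 1)) • a i := by
  rw [legActInv, PiTensorProduct.map_tprod]
  rfl

theorem legActInv_consT (n : ℕ) (a : ℕ → A) (w : ⨂[k]^n H) (h : H) :
    legActInv k (n + 1) a (consT k H n (h ⊗ₜ w)) =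
      consT k A n ((antipodeInv k H h • a 0) ⊗ₜ legActInv k n (fun i => a (i + 1)) w) := by
  induction w using PiTensorProduct.induction_on with
  | add x y hx hy => simp only [TensorProduct.tmul_add, map_add, hx, hy]
  | smul_tprod r f =>
    simp only [TensorProduct.tmul_smul, map_smul, consT_tmul]
    congr 1
    rw [legActInv, legActInv, PiTensorProduct.map_tprod, PiTensorProduct.map_tprod, consT_tmul]
    congr 1
    ext i
    refine Fin.cases ?_ (fun i => ?_) i <;> simp

/-- `S⁻¹(b₍₋₁₎) (a¹ ⊗ ⋯ ⊗ aⁿ) ⊗ b₍₀₎ = S⁻¹(b₍₋₁₎) a¹ ⊗ ⋯ ⊗ S⁻¹(b₍₋ₙ₎) aⁿ ⊗ b₍₀₎`. -/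
theorem actT_antipodeInv_coeff_seqT {J : Type*} [Fintype J] [DecidableEq J] {ν : J → B}
    {c : J → J → H} (hc : IsCoeff (coact k H B) ν c) (n : ℕ) (a : ℕ → A) (j l : J) :
    actT k H A n (antipodeInv k H (c j l) ⊗ₜ seqT k n a) = legActInv k n a (coeffT k c n j l) := by
  induction n generalizing l a with
  | zero =>
    have h := legActInv_tprod (k := k) 0 a (0 : ℕ → H)
    have h' : seqT k 0 (0 : ℕ → H) = PiTensorProduct.tprod k fun l : Fin 0 => 0 := rfl
    simp only [Pi.zero_apply] at h
    rw [actT_zero, counit_antipodeInv, hc.counit, coeffT, apply_ite (legActInv k 0 a), map_zero,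
      ite_smul, one_smul, zero_smul, h', h, seqT_congr fun i hi => absurd hi (Nat.not_lt_zero i)]
  | succ n ih =>
    rw [seqT_succ, actT_consT (hc.comul_antipodeInv j l), coeffT, map_sum]
    simp only [ih, legActInv_consT]

theorem sum_actT_antipodeInv_of_iterCoact {ι : Type*} {s : Finset ι} {n : ℕ} {x : ι → ℕ → H}
    {y : ι → B} {b : B}
    (hb : iterCoact k H B n b = ∑ r ∈ s, (PiTensorProduct.tprod k
      fun l : Fin n => x r (l + 1)) ⊗ₜ[k] y r) (a : ℕ → A)
    {J : Type*} [Fintype J] [DecidableEq J] {ν : J → B} {c : J → J → H}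
    (hc : IsCoeff (coact k H B) ν c) {j : J} (hj : ν j = b) :
    ∑ l, actT k H A n (antipodeInv k H (c j l) ⊗ₜ seqT k n a) ⊗ₜ[k] ν l =
      ∑ r ∈ s, (seqT k n fun i => antipodeInv k H (x r (i + 1)) • a i) ⊗ₜ[k] y r := by
  have h := congrArg ((legActInv k n a).rTensor B) hb
  rw [← hj, iterCoact_coeff hc] at h
  simpa only [map_sum, LinearMap.rTensor_tmul, legActInv_tprod, ← actT_antipodeInv_coeff_seqT hc]
    using h

end LegAction

/-! ### Sums over choices of a summand for each factor -/

section ChoiceSum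

variable {W W' : Type*} [AddCommMonoid W] [AddCommMonoid W']

/-- The sum of `F g` over all `g` that differ from `f` at most in the places `m, …, m + p - 1`,
where `g i` runs through `s i`. Unlike a sum over a `Fintype.piFinset` it can be split off from
either end without a change of index types. -/
def choiceSum (s : ℕ → Finset ℕ) (F : (ℕ → ℕ) → W) : (m p : ℕ) → (ℕ → ℕ) → W
  | _, 0, f => F f
  | m, p + 1, f => ∑ r ∈ s m, choiceSum s F (m + 1) p (Function.update f m r)

theorem choiceSum_succ' (s : ℕ → Finset ℕ) (F : (ℕ → ℕ) → W) (m p : ℕ) (f : ℕ → ℕ) :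
    choiceSum s F m (p + 1) f =
      choiceSum s (fun g => ∑ r ∈ s (m + p), F (Function.update g (m + p) r)) m p f := by
  induction p generalizing m f with
  | zero => rfl
  | succ p ih =>
    rw [choiceSum, choiceSum]
    simp only [ih, show m + 1 + p = m + (p + 1) by omega]

theorem choiceSum_add (s : ℕ → Finset ℕ) (F : (ℕ → ℕ) → W) (m p p' : ℕ) (f : ℕ → ℕ) :
    choiceSum s F m (p + p') f = choiceSum s (choiceSum s F (m + p) p') m p f := by
  induction p generalizing m f with
  | zero => rw [zero_add]; rfl
  | succ p ih =>
    rw [show p + 1 + p' = p + p' + 1 by omega, choiceSum, choiceSum]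
    simp only [ih, show m + 1 + p = m + (p + 1) by omega]

theorem choiceSum_congr (s : ℕ → Finset ℕ) {F G : (ℕ → ℕ) → W} {m p : ℕ} {f : ℕ → ℕ}
    (h : ∀ g : ℕ → ℕ, (∀ i < m, g i = f i) → F g = G g) :
    choiceSum s F m p f = choiceSum s G m p f := by
  induction p generalizing m f with
  | zero => exact h f fun _ _ => rfl
  | succ p ih =>
    refine Finset.sum_congr rfl fun r _ => ih fun g hg => h g fun i hi => ?_
    rw [hg i (by omega), Function.update_of_ne (by omega)]

theorem map_choiceSum (L : W →+ W') (s : ℕ → Finset ℕ) (F : (ℕ → ℕ) → W) (m p : ℕ) (f : ℕ → ℕ) :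
    L (choiceSum s F m p f) = choiceSum s (fun g => L (F g)) m p f := by
  induction p generalizing m f with
  | zero => rfl
  | succ p ih => simp only [choiceSum, map_sum, ih]

theorem choiceSum_eq_sum_piFinset (s : ℕ → Finset ℕ) (F : (ℕ → ℕ) → W) (n : ℕ) (f : ℕ → ℕ) :
    choiceSum s F 0 n f = ∑ r ∈ Fintype.piFinset (fun i : Fin n => s i),
      F fun i => if h : i < n then r ⟨i, h⟩ else f i := by
  induction n generalizing F with
  | zero => simp [choiceSum]
  | succ n ih =>
    rw [choiceSum_succ', ih, ← Finset.sum_product']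
    refine Finset.sum_bij' (fun z _ => (Fin.snoc z.1 z.2 : Fin (n + 1) → ℕ))
      (fun r _ => (Fin.init r, r (Fin.last n))) ?_ ?_ ?_ ?_ ?_
    · rintro ⟨r, t⟩ h
      simpa [Fin.forall_fin_succ'] using h
    · intro r h
      simpa [Fin.forall_fin_succ', Fin.init] using h
    · rintro ⟨r, t⟩ _
      simp
    · intro r _
      simp
    · rintro ⟨r, t⟩ _
      congr 1
      ext i
      rw [zero_add]
      rcases lt_trichotomy i n with hi | rfl | hi
      · rw [Function.update_of_ne hi.ne, dif_pos hi, dif_pos (by omega)]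
        exact (Fin.snoc_castSucc (α := fun _ => ℕ) t r ⟨i, hi⟩).symm
      · rw [Function.update_self, dif_pos (by omega)]
        exact (Fin.snoc_last (α := fun _ => ℕ) t r).symm
      · rw [Function.update_of_ne hi.ne', dif_neg (by omega), dif_neg (by omega)]

end ChoiceSum

/-! ### The explicit formula -/

section OrderedProd

variable {R : Type*} [Monoid R]

theorem orderedProd_self (i : ℕ) (f : ℕ → R) : orderedProd i i f = 1 := by
  simp [orderedProd]

theorem orderedProd_succ_left {i j : ℕ} (h : i < j) (f : ℕ → R) :
    orderedProd i j f = f i * orderedProd (i + 1) j f := by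
  rw [orderedProd, orderedProd, show j - i = j - (i + 1) + 1 by omega, List.range'_succ,
    List.map_cons, List.prod_cons]

theorem orderedProd_succ_right {i j : ℕ} (h : i ≤ j) (f : ℕ → R) :
    orderedProd i (j + 1) f = orderedProd i j f * f j := by
  rw [orderedProd, orderedProd, show j + 1 - i = j - i + 1 by omega, List.range'_1_concat,
    List.map_append, List.prod_append, show i + (j - i) = j by omega]
  simp

theorem orderedProd_congr {i j : ℕ} {f g : ℕ → R} (h : ∀ l, i ≤ l → l < j → f l = g l) :
    orderedProd i j f = orderedProd i j g := by
  rw [orderedProd, orderedProd]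
  congr 1
  refine List.map_congr_left fun l hl => ?_
  rw [List.mem_range'_1] at hl
  exact h l hl.1 (by omega)

end OrderedProd

section Formula

theorem seqT_zero {k : Type*} [Field k] {V : Type*} [AddCommGroup V] [Module k V] (f : ℕ → V) :
    seqT k 0 f = PiTensorProduct.tprod k Fin.elim0 := by
  rw [seqT]
  congr 1
  exact Subsingleton.elim _ _

variable {k : Type*} [Field k] {H A B M : Type*} [Ring H] [HopfAlgebra k H]
  [InvertibleAntipode k H]
  [Ring A] [Algebra k A] [Module H A] [IsScalarTower k H A]
  [Ring B] [Algebra k B] [LeftComodule k H B]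
  [AddCommGroup M] [Module k M]

/-- The iterated first coface multiplies the first factors. -/
theorem iterFace_faceA_zero [LeftComodule k H M] {p q N : ℕ} (hN : p + q = N) (h : p ≤ N)
    (φ : CochainA k A M p) (m : M) (v : A) (a : ℕ → A) (l : ℕ) :
    iterFace (C := CochainA k A M) (fun n => faceA k H A M n 0) h φ
        (m ⊗ₜ consT k A N (v ⊗ₜ seqT k N fun i => a (l + i))) =
      φ (m ⊗ₜ consT k A p ((v * orderedProd l (l + q) a) ⊗ₜ seqT k p fun i => a (l + q + i))) := by
  induction q generalizing N l v with
  | zero =>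
    obtain rfl : p = N := by omega
    rw [iterFace_self, add_zero, orderedProd_self, mul_one]
  | succ q ih =>
    obtain ⟨N, rfl⟩ : ∃ N', N = N' + 1 := ⟨p + q, by omega⟩
    rw [iterFace_succ _ (by omega : p ≤ N), faceA_apply (Nat.zero_le N), seqT_succ,
      mulAt_zero_consT, mulHead_consT]
    have := ih (N := N) (by omega) (by omega) (v * a l) (l + 1)
    rw [orderedProd_succ_left (by omega), ← mul_assoc]
    simp only [show ∀ i, l + 1 + i = l + (i + 1) by intro i; omega, add_zero] at this ⊢
    rw [this]

/-- The twist of `a⁰ ⋊ b⁰ ⊗ ⋯ ⊗ aⁿ⁻¹ ⋊ bⁿ⁻¹` in terms of iterated coactions of the `bⁱ`. -/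
theorem twist_seqT (n : ℕ) (a : ℕ → A) (b : ℕ → B) (s : ℕ → Finset ℕ) (x : ℕ → ℕ → ℕ → H)
    (y : ℕ → ℕ → B)
    (hb : ∀ i < n, iterCoact k H B (i + 1) (b i) = ∑ r ∈ s i, (PiTensorProduct.tprod k
      fun l : Fin (i + 1) => x i r (l + 1)) ⊗ₜ[k] y i r) (f : ℕ → ℕ) :
    twist k H A B n (seqT k n fun i => CrossedProduct.mk k H A B (a i) (b i)) =
      choiceSum s (fun g => (seqT k n fun i =>
        antipodeInv k H (orderedProd i n fun j => x j (g j) (i + 1)) • a i) ⊗ₜ[k]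
          seqT k n fun i => y i (g i)) 0 n f := by
  induction n with
  | zero =>
    rw [choiceSum, twist]
    simp only [seqT_zero, LinearMap.comp_apply, LinearEquiv.coe_coe,
      PiTensorProduct.isEmptyEquiv_apply_tprod, LinearMap.toSpanSingleton_apply, one_smul]
  | succ n ih =>
    rw [seqT_succ', twist_snocT, ih fun i hi => hb i (by omega), choiceSum_succ']
    simp only [zero_add]
    refine (map_choiceSum (lastTwist k H n (a n) (b n)).toAddMonoidHom _ _ _ _ _).trans ?_
    refine choiceSum_congr _ fun g _ => ?_
    obtain ⟨p, ν, c, j, hc, hj⟩ := exists_isCoeff_coact (k := k) (H := H) (b n)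
    have h1 := sum_actT_antipodeInv_of_iterCoact (hb n (by omega))
      (fun i => antipodeInv k H (orderedProd i n fun j => x j (g j) (i + 1)) • a i) hc hj
    have h2 := congrArg ((snocT k B n ∘ₗ TensorProduct.mk k (⨂[k]^n B) B
      (seqT k n fun i => y i (g i))).lTensor (⨂[k]^(n + 1) A)) h1
    simp only [map_sum, LinearMap.lTensor_tmul, LinearMap.comp_apply, TensorProduct.mk_apply] at h2
    refine (lastTwist_tmul (hj ▸ hc.coact j) _ _ _).trans ?_
    have h3 : seqT k (n + 1) (fun i => antipodeInv k H (orderedProd i n fun j =>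
        x j (g j) (i + 1)) • a i) = snocT k A n ((seqT k n fun i => antipodeInv k H
          (orderedProd i n fun j => x j (g j) (i + 1)) • a i) ⊗ₜ a n) := by
      rw [seqT_succ', orderedProd_self, antipodeInv_one, one_smul]
    rw [h3] at h2
    refine h2.trans (Finset.sum_congr rfl fun r _ => ?_)
    have hg : ∀ i < n, Function.update g n r i = g i := fun i hi =>
      Function.update_of_ne hi.ne _ _
    rw [seqT_succ' n fun i => y i _, Function.update_self]
    congr 1
    · refine seqT_congr fun i hi => ?_
      rw [orderedProd_succ_right (by omega), antipodeInv_mul, mul_smul, Function.update_self,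
        orderedProd_congr (f := fun j => x j (Function.update g n r j) (i + 1))
          (g := fun j => x j (g j) (i + 1)) fun l _ hl => by rw [hg l hl]]
    · rw [seqT_congr (f := fun i => y i (Function.update g n r i)) (g := fun i => y i (g i))
        fun i hi => by rw [hg i hi]]

omit [InvertibleAntipode k H] in
/-- The tail in terms of iterated coactions of the `bⁱ`. -/
theorem tailTwist_eq_choiceSum (p m : ℕ) (a : ℕ → A) (b : ℕ → B) (s : ℕ → Finset ℕ)
    (x : ℕ → ℕ → ℕ → H) (y : ℕ → ℕ → B)
    (hb : ∀ i < p, iterCoact k H B (p - 1 - i) (b (m + i)) = ∑ r ∈ s (m + i),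
      (PiTensorProduct.tprod k fun l : Fin (p - 1 - i) => x (m + i) r (l + 1)) ⊗ₜ[k] y (m + i) r)
    (f : ℕ → ℕ) :
    tailTwist k H p (fun i => a (m + i)) (fun i => b (m + i)) =
      choiceSum s (fun g => (seqT k p fun i =>
        (orderedProd m (m + i) fun j => x j (g j) (p - i)) • a (m + i)) ⊗ₜ[k]
          orderedProd m (m + p) fun i => y i (g i)) m p f := by
  induction p generalizing m f with
  | zero =>
    rw [tailTwist, choiceSum, add_zero, orderedProd_self,
      seqT_congr fun i hi => absurd hi (Nat.not_lt_zero i)]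
  | succ p ih =>
    have hb0 := hb 0 (by omega)
    simp only [Nat.sub_zero, add_zero] at hb0
    have ih' := ih (m + 1) fun i hi => by
      have := hb (i + 1) (by omega)
      rwa [show p + 1 - 1 - (i + 1) = p - 1 - i by omega, show m + (i + 1) = m + 1 + i by omega]
        at this
    rw [tailTwist, choiceSum]
    obtain ⟨d, ν, c, j, hc, hj⟩ := exists_isCoeff_coact (k := k) (H := H) (b m)
    -- The summand of `headTail` that belongs to the summand `r` of the expansion of `b m`.
    let L : ℕ → (⨂[k]^p A) ⊗[k] B →ₗ[k] (⨂[k]^(p + 1) A) ⊗[k] B := fun r =>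
      TensorProduct.map (consT k A p ∘ₗ TensorProduct.mk k A (⨂[k]^p A) (a m) ∘ₗ
        PiTensorProduct.map fun i : Fin p => Algebra.lsmul k k A (x m r (p - i)))
        (LinearMap.mulLeft k (y m r))
    have hL : ∀ r (α : ℕ → A) (b' : B), L r (seqT k p α ⊗ₜ b') =
        consT k A p (a m ⊗ₜ seqT k p fun i => x m r (p - i) • α i) ⊗ₜ (y m r * b') := by
      intro r α b'
      simp only [L, TensorProduct.map_tmul, LinearMap.comp_apply, seqT, PiTensorProduct.map_tprod]
      rfl
    have hsum : ∀ T, headTail k H p (a m) (b m) T = ∑ r ∈ s m, L r T := by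
      intro T
      induction T with
      | zero => simp only [map_zero, Finset.sum_const_zero]
      | add x y hx hy => simp only [map_add, hx, hy, Finset.sum_add_distrib]
      | tmul α b' =>
      induction α using seqT_induction with
      | add x y hx hy =>
        simp only [TensorProduct.add_tmul, map_add, hx, hy, Finset.sum_add_distrib]
      | smul t α =>
        simp only [← TensorProduct.smul_tmul', map_smul, ← Finset.smul_sum]
        congr 1
        have h := congrArg (TensorProduct.map (consT k A p ∘ₗ TensorProduct.mk k A (⨂[k]^p A) (a m))
          (LinearMap.mulRight k b')) (sum_actT_of_iterCoact hb0 α hc hj)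
        simp only [map_sum] at h
        rw [headTail_tmul (hj ▸ hc.coact j)]
        simp only [hL]
        exact h
    have hshift : ∀ i, m + (i + 1) = m + 1 + i := fun i => by omega
    rw [show (fun i => a (m + (i + 1))) = fun i => a (m + 1 + i) from
        funext fun i => by rw [hshift],
      show (fun i => b (m + (i + 1))) = fun i => b (m + 1 + i) from
        funext fun i => by rw [hshift], add_zero, hsum]
    refine Finset.sum_congr rfl fun r _ => ?_
    rw [ih' (Function.update f m r)]
    refine (map_choiceSum (L r).toAddMonoidHom _ _ _ _ _).trans (choiceSum_congr _ fun g hg => ?_)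
    have hgm : g m = r := by rw [hg m (by omega), Function.update_self]
    refine (hL r _ _).trans ?_
    rw [orderedProd_succ_left (i := m) (by omega) (fun i => y i (g i)), hgm, seqT_succ, add_zero,
      orderedProd_self, one_smul]
    rw [hshift p]
    congr 3
    refine seqT_congr fun i _ => ?_
    rw [smul_smul, hshift i, orderedProd_succ_left (i := m) (by omega), hgm, Nat.add_sub_add_right]

omit [LeftComodule k H B] in
/-- The iterated first coface of `φ` multiplies the `q + 1` factors of `A` that are not in the
tail. -/
theorem tailPairing_seqT [LeftComodule k H M] {p q N : ℕ} (hN : p + q = N) (h : p ≤ N)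
    (e : q + 1 + p = N + 1) (φ : CochainA k A M p) (ψ : CochainB k B M q) (α α' : ℕ → A) (β : ℕ → B)
    (b : B) :
    tailPairing e (iterFace (C := CochainA k A M) (fun n => faceA k H A M n 0) h φ) ψ
        ((seqT k (q + 1) α ⊗ₜ seqT k (q + 1) β) ⊗ₜ (seqT k p α' ⊗ₜ b)) =
      φ (ψ (consT k B q ((b * β 0) ⊗ₜ seqT k q fun i => β (i + 1))) ⊗ₜ
        consT k A p (orderedProd 0 (q + 1) α ⊗ₜ seqT k p α')) := by
  let γ : ℕ → A := fun i => if i < q + 1 then α i else α' (i - (q + 1))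
  have h1 : ∀ i < q + 1, γ i = α i := fun i hi => if_pos hi
  have h2 : ∀ i, γ (q + 1 + i) = α' i := fun i => by
    rw [show γ (q + 1 + i) = α' (q + 1 + i - (q + 1)) from if_neg (by omega),
      Nat.add_sub_cancel_left]
  have h3 := iterFace_faceA_zero (H := H) hN h φ
    (ψ (consT k B q ((b * β 0) ⊗ₜ seqT k q fun i => β (i + 1)))) (γ 0) γ 1
  simp only [add_comm 1] at h3
  simp only [h2] at h3
  rw [tailPairing_tmul, joinT_seqT, seqT_succ, seqT_succ, mulHead_consT,
    ← orderedProd_congr fun l _ hl => h1 l hl, orderedProd_succ_left (by omega), zero_add, ← h3]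

omit [IsScalarTower k H A] [LeftComodule k H B] in
theorem cupTerm_eq (p q : ℕ) (φ : CochainA k A M p) (ψ : CochainB k B M q) (a : ℕ → A)
    (x : ℕ → ℕ → H) (y : ℕ → B) :
    cupTerm p q φ ψ a x y =
      φ (ψ (consT k B q ((orderedProd (q + 1) (p + q + 1) y * y 0) ⊗ₜ
        seqT k q fun i => y (i + 1))) ⊗ₜ
        consT k A p ((orderedProd 0 (q + 1) fun i =>
          antipodeInv k H (orderedProd i (q + 1) fun j => x j (i + 1)) • a i) ⊗ₜ
          seqT k p fun j =>
            (orderedProd (q + 1) (q + 1 + j) fun i => x i (p - j)) • a (q + 1 + j))) := by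
  rw [cupTerm, seqT, seqT, consT_tmul, consT_tmul]

omit [IsScalarTower k H A] [LeftComodule k H B] in
theorem cupTerm_congr {p q : ℕ} (φ : CochainA k A M p) (ψ : CochainB k B M q) (a : ℕ → A)
    {x x' : ℕ → ℕ → H} {y y' : ℕ → B} (hx : ∀ i < p + q + 1, x i = x' i)
    (hy : ∀ i < p + q + 1, y i = y' i) : cupTerm p q φ ψ a x y = cupTerm p q φ ψ a x' y' := by
  have h1 : ∀ i, orderedProd i (q + 1) (fun j => x j (i + 1)) =
      orderedProd i (q + 1) fun j => x' j (i + 1) := fun i =>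
    orderedProd_congr fun l _ hl => by rw [hx l (by omega)]
  have h2 : seqT k p (fun j => (orderedProd (q + 1) (q + 1 + j) fun i => x i (p - j)) •
      a (q + 1 + j)) = seqT k p fun j => (orderedProd (q + 1) (q + 1 + j) fun i => x' i (p - j)) •
        a (q + 1 + j) := seqT_congr fun j hj => by
    rw [orderedProd_congr fun l _ hl => by rw [hx l (by omega)]]
  have h3 : seqT k q (fun i => y (i + 1)) = seqT k q fun i => y' (i + 1) :=
    seqT_congr fun i hi => hy (i + 1) (by omega)
  simp only [cupTerm_eq, h1, h2, h3, hy 0 (by omega)]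
  rw [orderedProd_congr fun l _ hl => hy l hl]

variable [ModuleAlgebra k H A] [ComoduleAlgebra k H B]
  [Module Hᵐᵒᵖ M] [IsScalarTower k Hᵐᵒᵖ M] [LeftComodule k H M]

/-- The explicit formula for the cup product; of the cochains only the balancedness of `φ` is
needed. -/
theorem cup_tprod_eq_sum_cupTerm {p q : ℕ} {φ : CochainA k A M p} (hφ : IsBalanced H φ)
    (ψ : CochainB k B M q) (a : ℕ → A) (b : ℕ → B) (s : ℕ → Finset ℕ) (x : ℕ → ℕ → ℕ → H)
    (y : ℕ → ℕ → B)
    (hb : ∀ i ≤ p + q, iterCoact k H B (legCount p q i) (b i) = ∑ r ∈ s i, (PiTensorProduct.tprod k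
      fun l : Fin (legCount p q i) => x i r (l + 1)) ⊗ₜ[k] y i r) :
    cup k H A B M p q φ ψ (PiTensorProduct.tprod k
        fun i : Fin (p + q + 1) => CrossedProduct.mk k H A B (a i) (b i)) =
      ∑ r ∈ Fintype.piFinset (fun i : Fin (p + q + 1) => s i), cupTerm p q φ ψ a
        (fun i => x i (r (Fin.ofNat (p + q + 1) i)))
        (fun i => y i (r (Fin.ofNat (p + q + 1) i))) := by
  have e : q + 1 + p = p + q + 1 := by omega
  have hhead : ∀ i < q + 1, iterCoact k H B (i + 1) (b i) = ∑ r ∈ s i, (PiTensorProduct.tprod k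
      fun l : Fin (i + 1) => x i r (l + 1)) ⊗ₜ[k] y i r := fun i hi => by
    have := hb i (by omega)
    rwa [legCount, if_pos (by omega)] at this
  have htail : ∀ i < p, iterCoact k H B (p - 1 - i) (b (q + 1 + i)) = ∑ r ∈ s (q + 1 + i),
      (PiTensorProduct.tprod k fun l : Fin (p - 1 - i) => x (q + 1 + i) r (l + 1)) ⊗ₜ[k]
        y (q + 1 + i) r := fun i hi => by
    have := hb (q + 1 + i) (by omega)
    rwa [legCount, if_neg (by omega), show p + q - (q + 1 + i) = p - 1 - i by omega] at this
  let G : (ℕ → ℕ) → k := fun g => cupTerm p q φ ψ a (fun i => x i (g i)) (fun i => y i (g i))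
  have hG : ∑ r ∈ Fintype.piFinset (fun i : Fin (p + q + 1) => s i), cupTerm p q φ ψ a
        (fun i => x i (r (Fin.ofNat (p + q + 1) i))) (fun i => y i (r (Fin.ofNat (p + q + 1) i))) =
      choiceSum s G 0 (q + 1 + p) 0 := by
    rw [e, choiceSum_eq_sum_piFinset]
    refine Finset.sum_congr rfl fun r _ => ?_
    have hr : ∀ i < p + q + 1, r (Fin.ofNat (p + q + 1) i) =
        if h : i < p + q + 1 then r ⟨i, h⟩ else (0 : ℕ → ℕ) i := fun i hi => by
      rw [dif_pos hi]
      congr 1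
      exact Fin.ext (Nat.mod_eq_of_lt hi)
    exact cupTerm_congr φ ψ a (fun i hi => by rw [hr i hi]) fun i hi => by rw [hr i hi]
  rw [hG, choiceSum_add, cup_eq_cupTo, cupTo_apply, Psi_apply]
  refine (pairing_twist_eq_tailPairing e _ (hφ.iterFace _) ψ a b).trans ?_
  rw [twist_seqT (q + 1) a b s x y hhead 0]
  have hT := tailTwist_eq_choiceSum p (q + 1) a b s x y htail
  generalize tailTwist k H p (fun i => a (q + 1 + i)) (fun i => b (q + 1 + i)) = T at hT ⊢
  let P := tailPairing e (iterFace (C := CochainA k A M) (fun n => faceA k H A M n 0)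
    (Nat.le_add_right p q) φ) ψ
  refine (map_choiceSum (P ∘ₗ (TensorProduct.mk k _ _).flip T).toAddMonoidHom
    _ _ _ _ _).trans (choiceSum_congr _ fun g _ => ?_)
  -- The tail is expanded with base point `g`, so that its sum continues the choices made in `g`.
  rw [zero_add, hT g]
  refine (map_choiceSum (P ∘ₗ TensorProduct.mk k _ _ _).toAddMonoidHom
    _ _ _ _ _).trans (choiceSum_congr _ fun g' hg' => ?_)
  refine Eq.trans ?_ (cupTerm_eq p q φ ψ a _ _).symm
  refine (tailPairing_seqT rfl _ e φ ψ _ _ _ _).trans ?_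
  have h1 : ∀ i < q + 1, g i = g' i := fun i hi => (hg' i hi).symm
  have h2 : ∀ i, orderedProd i (q + 1) (fun j => x j (g j) (i + 1)) =
      orderedProd i (q + 1) fun j => x j (g' j) (i + 1) := fun i =>
    orderedProd_congr fun l _ hl => by rw [h1 l hl]
  have h3 : seqT k q (fun i => y (i + 1) (g (i + 1))) = seqT k q fun i => y (i + 1) (g' (i + 1)) :=
    seqT_congr fun i hi => by rw [h1 (i + 1) (by omega)]
  simp only [h2, h3, h1 0 (by omega), e]

end Formula

end HopfCup

end

theorem mainTheorem6 {k : Type*} [Field k] {H A B M : Type*}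
    [Ring H] [HopfAlgebra k H] [HopfCup.InvertibleAntipode k H]
    [Ring A] [Algebra k A] [Module H A] [IsScalarTower k H A] [HopfCup.ModuleAlgebra k H A]
    [Ring B] [Algebra k B] [HopfCup.LeftComodule k H B] [HopfCup.ComoduleAlgebra k H B]
    [AddCommGroup M] [Module k M] [Module Hᵐᵒᵖ M] [IsScalarTower k Hᵐᵒᵖ M]
    [HopfCup.LeftComodule k H M] [HopfCup.SAYD k H M] (p q : ℕ) :
    (∀ φ ∈ HopfCup.equivariantCochains k H A M p, ∀ ψ ∈ HopfCup.colinearCochains k H B M q,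
      ∀ (a : ℕ → A) (b : ℕ → B) (s : ℕ → Finset ℕ) (x : ℕ → ℕ → ℕ → H) (y : ℕ → ℕ → B),
        (∀ i ≤ p + q, HopfCup.iterCoact k H B (HopfCup.legCount p q i) (b i) =
          ∑ r ∈ s i, (PiTensorProduct.tprod k
            fun l : Fin (HopfCup.legCount p q i) => x i r (l + 1)) ⊗ₜ[k] y i r) →
        HopfCup.cup k H A B M p q φ ψ (PiTensorProduct.tprod k
            fun i : Fin (p + q + 1) => HopfCup.CrossedProduct.mk k H A B (a i) (b i)) =
          ∑ r ∈ Fintype.piFinset (fun i : Fin (p + q + 1) => s i),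
            HopfCup.cupTerm p q φ ψ a
              (fun i => x i (r (Fin.ofNat (p + q + 1) i)))
              (fun i => y i (r (Fin.ofNat (p + q + 1) i)))) ∧
    ∃! c : HopfCup.HHA k H A M p →ₗ[k] HopfCup.HHB k H B M q →ₗ[k]
        HopfCup.HH k (HopfCup.CrossedProduct k H A B) (p + q),
      ∀ (φ : HopfCup.cocycles (HopfCup.equivariantCochains k H A M)
            (HopfCup.hochschildDA k H A M) p)
        (ψ : HopfCup.cocycles (HopfCup.colinearCochains k H B M)
            (HopfCup.hochschildDB k H B M) q),
        ∃ χ : HopfCup.cocycles (C := HopfCup.Cochain k (HopfCup.CrossedProduct k H A B))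
            (fun _ => ⊤) (HopfCup.hochschildD k (HopfCup.CrossedProduct k H A B)) (p + q),
          χ.1 = HopfCup.cup k H A B M p q φ.1 ψ.1 ∧
          c (Submodule.Quotient.mk φ) (Submodule.Quotient.mk ψ) = Submodule.Quotient.mk χ :=
  ⟨fun _ hφ ψ _ a b s x y hb =>
      HopfCup.cup_tprod_eq_sum_cupTerm (HopfCup.isBalanced_of_mem hφ) ψ a b s x y hb,
    HopfCup.existsUnique_cupCohomology k H A B M p q⟩
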